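/- Let $F$ be a field of characteristic $0$ (for instance $\mathbb C$ or $\mathbb C(q^{1/2},t^{1/2})$), let $N\ge 0$, and let $q,t,u\in F^\times$ and $\mathcal E,\mathcal F\in F$. Assume that $q,t$ are generic, i.e. $q^at^b=1$ with $a,b\in\mathbb Z$ only for $a=b=0$, and that $t$ has a square root $t^{1/2}\in F$, which is fixed. Put $q_1=t^{-1}$, $q_1^{1/2}=t^{-1/2}$, $q_2=q$ and $q_3=(q_1q_2)^{-1}$. **The module.** The level-$N$ vertical Fock module $\mathcal F^{(3)}_N(u)$ of the quantum toroidal algebra of $\mathfrak{gl}_1$ has as basis the vectors $|\lambda\rangle$, $\lambda=(\lambda_1\ge\dots\ge\lambda_N)\in\mathbb Z^N$. Put $w_i=uq_1^{i-1}q_2^{\lambda_i}$, $\delta(z)=\sum_{m\in\mathbb Z}z^m$ and $$S_2(x)=\frac{(1-q_3x)(1-q_1x)}{(1-x)(1-q_2^{-1}x)} ,$$ and let $[\,\cdot\,]_\pm$ denote the expansion of a rational function of $z$ in powers of $z^{\mp1}$. The Drinfeld currents $E(z)=\sum_m \mathsf E_mz^{-m}$, $F(z)=\sum_m\mathsf F_mz^{-m}$,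 $K^{\pm}(z)=\sum_{r\ge0}\mathsf K^{\pm}_{\pm r}z^{\mp r}$ (with $\mathsf K_{\pm1}=\mathsf K^{\pm}_{\pm1}$) act by $$K^\pm(z)|\lambda\rangle=\prod_{i=1}^N[S_2(w_i/z)]_\pm|\lambda\rangle,$$ $$E(z)|\lambda\rangle=\mathcal E\sum_{i=1}^N\prod_{l<i}S_2(w_l/z)\,\delta(w_i/z)\,|\lambda+\square_i\rangle,\qquad F(z)|\lambda\rangle=\mathcal F\sum_{i=1}^N\prod_{l>i}S_2(w_l/z)\,\delta(q_2^{-1}w_i/z)\,|\lambda-\square_i\rangle ,$$ where $f(z)\delta(a/z)$ means $f(a)\delta(a/z)$, where $\lambda\pm\square_i$ is $\lambda$ with $\lambda_i$ replaced by $\lambda_i\pm1$, and where $|\mu\rangle=0$ if $\mu$ is not non-increasing. **Macdonald polynomials.** For $0\le k\le N$ put $$D_N^{(k)}(X;q,t)=\sum_{\substack{I\subset\{1,\dots,N\}\\|I|=k}}\ \prod_{i\in I,\,j\notin I}\frac{t^{1/2}X_i-t^{-1/2}X_j}{X_i-X_j}\ \prod_{i\in I}T_{q,X_i},\qquad T_{q,X_i}X_j=q^{\delta_{ij}}X_j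 ,$$ and $D_N^{(-1)}(X;q,t)=D_N^{(1)}(X;q^{-1},t^{-1})$ (with $(t^{-1})^{1/2}=(t^{1/2})^{-1}$). For $\lambda\in\mathbb Z^N$ non-increasing let $m_\lambda$ be the sum of the monomials $X^\alpha$ over the distinct permutations $\alpha$ of $\lambda$, and order such $\lambda$ by dominance: $\mu\le\lambda$ iff $\sum_{i\le N}\mu_i=\sum_{i\le N}\lambda_i$ and $\sum_{i\le r}\mu_i\le\sum_{i\le r}\lambda_i$ for all $r$. **Theorem (Feigin–Feigin–Jimbo–Miwa–Mukhin).** For every non-increasing $\lambda\in\mathbb Z^N$ there is exactly one Laurent polynomial $P_\lambda=P_\lambda(X;q,t)$ of the form $m_\lambda+\sum_{\mu<\lambda}a_{\lambda\mu}m_\mu$ with $a_{\lambda\mu}\in F$ and $$D_N^{(k)}(X;q,t)P_\lambda=e_k\bigl(t^{\frac{N+1}2-1}q^{\lambda_1},\dots,t^{\frac{N+1}2-N}q^{\lambda_N}\bigr)P_\lambda\qquad(0\le k\le N).$$ There is a linear isomorphism $$\mathcal F^{(3)}_N(u)\ \xrightarrow{\ \sim\ }\ F[X_1^{\pm1},\dots,X_N^{\pm1}]^{\mathfrak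 S_N},\qquad |\lambda\rangle\mapsto P_\lambda(X;q,t),$$ and under it $\mathsf E_0$ becomes multiplication by $\mathcal E\,e_1(X)=\mathcal E\sum_iX_i$, $\mathsf F_0$ becomes multiplication by $\mathcal F\,e_1(X^{-1})=\mathcal F\sum_iX_i^{-1}$, and $\mathsf K_{\pm1}$ becomes $$u^{\pm1}(1-q_1^{\pm1})(1-q_3^{\pm1})\,q_1^{\pm\frac{N-1}2}\,D_N^{(\pm1)}(X;q,t).$$ -/

import Mathlib

open scoped BigOperators

noncomputable section

namespace MacdonaldFock

/-! ### Symmetric Laurent polynomials in `N` variables -/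

/-- The ring `F[X₁^{±1}, …, X_N^{±1}]`, i.e. the group algebra of `ℤ^N`; the monomial `X^α` is
`AddMonoidAlgebra.single α 1`. -/
abbrev Laurent (F : Type*) [Field F] (N : ℕ) : Type _ := AddMonoidAlgebra F (Fin N → ℤ)

/-- The field `F(X₁, …, X_N)`, in which the coefficients of the difference operators live. -/
abbrev RatFrac (F : Type*) [Field F] (N : ℕ) : Type _ := FractionRing (Laurent F N)

/-- The space `F[X₁^{±1}, …, X_N^{±1}]^{𝔖_N}` of symmetric Laurent polynomials: the coefficient of
`X^α` does not change when the entries of `α` are permuted. -/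
def symLaurent (F : Type*) [Field F] (N : ℕ) : Submodule F (Laurent F N) where
  carrier := {f | ∀ (σ : Equiv.Perm (Fin N)) (α : Fin N → ℤ), f.coeff (α ∘ σ) = f.coeff α}
  zero_mem' := by intro σ α; simp
  add_mem' := by intro f g hf hg σ α; simp [hf σ α, hg σ α]
  smul_mem' := by intro c f hf σ α; simp [hf σ α]

/-- The variable `X_i`. -/
def varX (F : Type*) [Field F] {N : ℕ} (i : Fin N) : Laurent F N :=
  AddMonoidAlgebra.single (Pi.single i 1) 1

/-- The inverse variable `X_i⁻¹`. -/
def varXinv (F : Type*) [Field F] {N : ℕ} (i : Fin N) : Laurent F N :=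
  AddMonoidAlgebra.single (Pi.single i (-1)) 1

/-- `e₁(X) = X₁ + ⋯ + X_N`. -/
def e₁ (F : Type*) [Field F] (N : ℕ) : Laurent F N := ∑ i, varX F i

/-- `e₋₁(X) = e₁(X⁻¹) = X₁⁻¹ + ⋯ + X_N⁻¹`. -/
def e₁inv (F : Type*) [Field F] (N : ℕ) : Laurent F N := ∑ i, varXinv F i

/-! ### Dominant weights and monomial symmetric functions -/

/-- Dominant weights `λ₁ ≥ λ₂ ≥ ⋯ ≥ λ_N` in `ℤ^N` (entries indexed by `0, …, N-1`). -/
abbrev Weight (N : ℕ) : Type := {α : Fin N → ℤ // Antitone α}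

/-- The dominance order: `|μ| = |λ|` and `μ₁ + ⋯ + μ_r ≤ λ₁ + ⋯ + λ_r` for all `r`. -/
def Dominated {N : ℕ} (μ lam : Weight N) : Prop :=
  ∑ i, μ.1 i = ∑ i, lam.1 i ∧
    ∀ r : Fin N, ∑ i ∈ Finset.Iic r, μ.1 i ≤ ∑ i ∈ Finset.Iic r, lam.1 i

/-- The monomial symmetric function `m_λ`: the sum of `X^α` over the distinct permutations `α`
of `λ`. -/
def monomialSymm (F : Type*) [Field F] {N : ℕ} (lam : Weight N) : Laurent F N :=
  ∑ α ∈ Finset.univ.image (fun σ : Equiv.Perm (Fin N) => lam.1 ∘ σ), AddMonoidAlgebra.single α 1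

/-! ### Macdonald difference operators and Macdonald polynomials

Throughout, `s` is a chosen square root `t^{1/2}` of the parameter `t`. -/

/-- The product `∏_{i ∈ I} T_{q,X_i}` of `q`-shift operators, where `T_{q,X_i} X_j = q^{δ_ij} X_j`:
the linear map `X^α ↦ q^{∑_{i ∈ I} α_i} X^α`. -/
def qShift {F : Type*} [Field F] {N : ℕ} (q : F) (I : Finset (Fin N)) :
    Laurent F N →ₗ[F] Laurent F N :=
  Finsupp.linearCombination F
      (fun α : Fin N → ℤ =>
        (AddMonoidAlgebra.single α (q ^ (∑ i ∈ I, α i)) : Laurent F N)) ∘ₗ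
    (AddMonoidAlgebra.coeffLinearEquiv F).toLinearMap

/-- The Macdonald difference operator
`D_N^{(k)}(X;q,t) = ∑_{|I|=k} ∏_{i ∈ I, j ∉ I} (t^{1/2} X_i - t^{-1/2} X_j) / (X_i - X_j)
  ∏_{i ∈ I} T_{q,X_i}` with `s = t^{1/2}`, as a map from Laurent polynomials to rational
functions. -/
def macdonaldD {F : Type*} [Field F] (N : ℕ) (q s : F) (k : ℕ) :
    Laurent F N →ₗ[F] RatFrac F N :=
  ∑ I ∈ (Finset.univ : Finset (Fin N)).powersetCard k,
    LinearMap.mulLeft F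
        (∏ i ∈ I, ∏ j ∈ Iᶜ,
          algebraMap (Laurent F N) (RatFrac F N) (s • varX F i - s⁻¹ • varX F j) /
            algebraMap (Laurent F N) (RatFrac F N) (varX F i - varX F j)) ∘ₗ
      (IsScalarTower.toAlgHom F (Laurent F N) (RatFrac F N)).toLinearMap ∘ₗ
      qShift q I

/-- The value `e_k(t^ρ q^λ)` of the `k`-th elementary symmetric polynomial at the numbers
`t^{(N+1)/2 - i} q^{λ_i}`, `i = 1, …, N`; here `i` starts from `0` and `s = t^{1/2}`. -/
def eigenvalue {F : Type*} [Field F] {N : ℕ} (q s : F) (k : ℕ) (lam : Weight N) : F :=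
  ∑ I ∈ (Finset.univ : Finset (Fin N)).powersetCard k,
    ∏ i ∈ I, s ^ ((N : ℤ) - 1 - 2 * ((i : ℕ) : ℤ)) * q ^ lam.1 i

/-- `P` is the Macdonald polynomial `P_λ(X;q,t)`, with `s = t^{1/2}`: it has the form
`m_λ + ∑_{μ < λ} a_μ m_μ` and is a common eigenfunction of the Macdonald operators `D_N^{(k)}`
with eigenvalues `e_k(t^ρ q^λ)`, `0 ≤ k ≤ N`. -/
def IsMacdonald {F : Type*} [Field F] {N : ℕ} (q s : F) (lam : Weight N)
    (P : Laurent F N) : Prop :=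
  (∃ a : Weight N →₀ F, (∀ μ ∈ a.support, Dominated μ lam ∧ μ ≠ lam) ∧
    P = monomialSymm F lam + a.sum (fun μ c => c • monomialSymm F μ)) ∧
  ∀ k : ℕ, k ≤ N →
    macdonaldD N q s k P =
      eigenvalue q s k lam • algebraMap (Laurent F N) (RatFrac F N) P

/-! ### The level-`N` vertical Fock module `𝓕_N^{(3)}(u)` of quantum toroidal `𝔤𝔩₁` -/

/-- The underlying vector space, with basis the vectors `|λ⟩` for dominant weights `λ ∈ ℤ^N`. -/
abbrev Fock (F : Type*) [Field F] (N : ℕ) : Type _ := Weight N →₀ F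

/-- The vector `|α⟩`, understood to be `0` if `α` is not dominant. -/
def ket (F : Type*) [Field F] {N : ℕ} (α : Fin N → ℤ) : Fock F N :=
  open Classical in if h : Antitone α then Finsupp.single ⟨α, h⟩ 1 else 0

/-- The rational function
`S₂(x) = (1 - q₃ x)(1 - q₁ x) / ((1 - x)(1 - q₂⁻¹ x))`. -/
def S₂ {F : Type*} [Field F] (q₁ q₂ q₃ x : F) : F :=
  (1 - q₃ * x) * (1 - q₁ * x) / ((1 - x) * (1 - q₂⁻¹ * x))

/-- The power series `1 - a x` in one variable `x`. -/
def lin {F : Type*} [Field F] (a : F) : PowerSeries F :=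
  1 - PowerSeries.C a * PowerSeries.X

/-- `[S₂(w/z)]₊`: the expansion of `S₂(w/z)` in powers of `x = z⁻¹`. -/
def S₂plus {F : Type*} [Field F] (q₁ q₂ q₃ w : F) : PowerSeries F :=
  lin (q₃ * w) * lin (q₁ * w) * (lin w * lin (q₂⁻¹ * w))⁻¹

/-- `[S₂(w/z)]₋`: the expansion in powers of `z` of
`S₂(w/z) = (1 - q₃⁻¹ z/w)(1 - q₁⁻¹ z/w) / ((1 - z/w)(1 - q₂ z/w))`, where `q₁ q₂ q₃ = 1`. -/
def S₂minus {F : Type*} [Field F] (q₁ q₂ q₃ w : F) : PowerSeries F :=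
  lin (q₃⁻¹ * w⁻¹) * lin (q₁⁻¹ * w⁻¹) * (lin w⁻¹ * lin (q₂ * w⁻¹))⁻¹

/-- The coordinate `u q₁^{i-1} q₂^{λ_i}` of row `i` of `λ` (here `i` starts from `0`). -/
def coord {F : Type*} [Field F] {N : ℕ} (q₁ q₂ u : F) (lam : Weight N) (i : Fin N) : F :=
  u * q₁ ^ (i : ℕ) * q₂ ^ lam.1 i

/-- The mode `K_r` (`r ≥ 0`) of `K⁺(z) = ∑_{r ≥ 0} K_r z^{-r}`, where
`K⁺(z) |λ⟩ = ∏_i [S₂(u q₁^{i-1} q₂^{λ_i} / z)]₊ |λ⟩`. -/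
def Kplus {F : Type*} [Field F] {N : ℕ} (q₁ q₂ q₃ u : F) (r : ℕ) : Fock F N →ₗ[F] Fock F N :=
  Finsupp.linearCombination F fun lam : Weight N =>
    Finsupp.single lam (PowerSeries.coeff r (∏ i, S₂plus q₁ q₂ q₃ (coord q₁ q₂ u lam i)))

/-- The mode `K_{-r}` (`r ≥ 0`) of `K⁻(z) = ∑_{r ≥ 0} K_{-r} z^r`, where
`K⁻(z) |λ⟩ = ∏_i [S₂(u q₁^{i-1} q₂^{λ_i} / z)]₋ |λ⟩`. -/
def Kminus {F : Type*} [Field F] {N : ℕ} (q₁ q₂ q₃ u : F) (r : ℕ) : Fock F N →ₗ[F] Fock F N :=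
  Finsupp.linearCombination F fun lam : Weight N =>
    Finsupp.single lam (PowerSeries.coeff r (∏ i, S₂minus q₁ q₂ q₃ (coord q₁ q₂ u lam i)))

/-- The mode `E_m` of `E(z) = ∑_m E_m z^{-m}`, where, with `w_i = u q₁^{i-1} q₂^{λ_i}`,
`E(z) |λ⟩ = 𝓔 ∑_i ∏_{l < i} S₂(w_l / z) δ(w_i / z) |λ + □_i⟩`. Since
`f(z) δ(w/z) = f(w) δ(w/z)` and `δ(w/z) = ∑_m w^m z^{-m}`, the `i`-th coefficient of `E_m` is
`𝓔 w_i^m ∏_{l < i} S₂(w_l / w_i)`. -/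
def Emode {F : Type*} [Field F] {N : ℕ} (q₁ q₂ q₃ u cE : F) (m : ℤ) :
    Fock F N →ₗ[F] Fock F N :=
  Finsupp.linearCombination F fun lam : Weight N =>
    cE • ∑ i, (coord q₁ q₂ u lam i ^ m *
      ∏ l ∈ Finset.Iio i, S₂ q₁ q₂ q₃ (coord q₁ q₂ u lam l / coord q₁ q₂ u lam i)) •
        ket F (lam.1 + Pi.single i 1)

/-- The mode `F_m` of `F(z) = ∑_m F_m z^{-m}`, where, with `w_i = u q₁^{i-1} q₂^{λ_i}`,
`F(z) |λ⟩ = 𝓕 ∑_i ∏_{l > i} S₂(w_l / z) δ(q₂⁻¹ w_i / z) |λ - □_i⟩`; the delta function sets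
`z = q₂⁻¹ w_i`. -/
def Fmode {F : Type*} [Field F] {N : ℕ} (q₁ q₂ q₃ u cF : F) (m : ℤ) :
    Fock F N →ₗ[F] Fock F N :=
  Finsupp.linearCombination F fun lam : Weight N =>
    cF • ∑ i, ((q₂⁻¹ * coord q₁ q₂ u lam i) ^ m *
      ∏ l ∈ Finset.Ioi i,
        S₂ q₁ q₂ q₃ (coord q₁ q₂ u lam l / (q₂⁻¹ * coord q₁ q₂ u lam i))) •
        ket F (lam.1 - Pi.single i 1)

end MacdonaldFock

end

open MacdonaldFock

/-!
The proof constructs the polynomials `P_λ` and determines the coefficients of the Pieri formula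
`e₁ P_λ = ∑ c_i(λ) P_{λ + ε_i}` together, by induction on the number of variables. With
`w_i = t^{(N+1)/2 - i} q^{λ_i}` the claim is `c_i(λ) = ∏_{l < i} S₂(w_l / w_i)`; the action of `E₀`
is this formula, that of `F₀` is its image under `X_i ↦ X_i⁻¹`, and the actions of `K_{±1}` only
compare `e₁` of the spectral coordinates with the eigenvalues of `D^{(±1)}`.

*Triangularity.* Over the Vandermonde denominator `D^{(k)} m_λ` is a combination of alternants
(`clearedD_monomialSymm`), so that the Macdonald operators are triangular for the dominance order
(`exists_macdonaldD_monomialSymm`). As the joint eigenvalues are distinct, a joint eigenvector with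
eigenvalues `e_k(t^ρ q^β)` has `β` as its leading exponent (`JointEigen.dominated`); this gives
uniqueness and makes the vanishing of a joint eigenvector visible in one coefficient.

*Shape of the Pieri formula.* The partial fraction identities `sum_S₂_identities` show that
`D^{(1)}` commutes with all `D^{(k)}`, and they relate `D^{(k+1)}`, `D^{(k)}`, multiplication by
`e₁` and its commutator with `D^{(1)}` (`DifferenceField.D_e_relation`). By linear algebra alone
`e₁ P_λ` is then a sum of joint eigenvectors with the exponents `λ + ε_i`
(`exists_joint_eigen_decomposition`).

*Stability.* The lowest coefficient of `P_λ` in the last variable is `P_{λ'}`, where `λ'` omits the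
last entry of `λ` (`JointEigen.res`). Hence `c_i(λ)` for `i < N` is a coefficient in one variable
less (`coeff_pieri_castSucc`). It is not zero if `λ + ε_i` is dominant, so that the component of
`e₁ P_λ` there is a nonzero multiple of `P_{λ + ε_i}`: this proves existence
(`exists_jointEigen_succ`).

*The last coefficient.* The involution `X_i ↦ X_i⁻¹` sends `P_λ` to the Macdonald polynomial of
`λ* = (-λ_N, …, -λ_1)` (`JointEigen.invVars`), so that `e₁(X⁻¹) P_λ = ∑ d_i(λ) P_{λ - ε_i}` with
`d_i(λ) = c_{N+1-i}(λ*)`. The products `c_i(λ) d_i(λ + ε_i)` are expected to be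
`∏_{l ≠ i} S₂(w_l / w_i)`, and by stability they are for `1 < i < N`. The diagonal parts of the
commutation relations of `e₁(X⁻¹)` with `e₁` and with `[D^{(1)}, e₁]` are two linear relations for
these products at each `λ`, which the expected values satisfy by `sum_S₂_identities`. The
differences therefore vanish by induction on `λ_1 - λ_N` (`edge_function_eq_zero`). As
`d_N(λ + ε_N) = 1` by stability if `N > 1`, this gives `c_N(λ)`.
-/

/-! ### Partial fraction identities -/

/-- A residue theorem for `∏ S₂(w_a / z)`. The product has the numerator
`∏ (z - q₃ w_a)(z - q₁ w_a)` and the denominator `∏ (z - w_a)(z - q⁻¹ w_a)`. A polynomial `P` of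
smaller degree than the denominator that takes the values of `g` times the numerator at the poles
`w_i` and `q⁻¹ w_i` is recovered by Lagrange interpolation, and its top coefficient is the sum of
the residues of `g(z) ∏ S₂(w_a / z)`. -/
theorem sum_residues {K ι : Type*} [Field K] [DecidableEq ι] (J : Finset ι) (w : ι → K)
    (q q₁ q₃ : K) (hq : q ≠ 0) (hq1 : q ≠ 1)
    (h0 : ∀ i ∈ J, w i ≠ 0) (hne : ∀ i ∈ J, ∀ j ∈ J, w i = w j → i = j)
    (hqne : ∀ i ∈ J, ∀ j ∈ J, w i ≠ q * w j) (h123 : q₁ * q * q₃ = 1)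
    (P : Polynomial K) (hP : P.degree < ((J ×ˢ (Finset.univ : Finset Bool)).card : WithBot ℕ))
    (g : K → K)
    (hPe : ∀ i ∈ J, ∀ z, (z = w i ∨ z = q⁻¹ * w i) →
      P.eval z = g z * ∏ a ∈ J, (z - q₃ * w a) * (z - q₁ * w a)) :
    (1 - q⁻¹) * P.coeff ((J ×ˢ (Finset.univ : Finset Bool)).card - 1) =
      (1 - q₁) * (1 - q₃) * ∑ i ∈ J, w i *
        (g (w i) * ∏ a ∈ J.erase i, S₂ q₁ q q₃ (w a / w i) -
          q⁻¹ * (g (q⁻¹ * w i) * ∏ a ∈ J.erase i, S₂ q₁ q q₃ (q * w a / w i))) := by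
  set v : ι × Bool → K := fun x => if x.2 then q⁻¹ * w x.1 else w x.1 with hv
  have hqi : (1 - q⁻¹) ≠ 0 := by
    intro h; apply hq1; field_simp at h; linear_combination h
  have hinj : Set.InjOn v (J ×ˢ (Finset.univ : Finset Bool) : Finset (ι × Bool)) := by
    rintro ⟨i, b⟩ hi ⟨j, c⟩ hj h
    simp only [Finset.coe_product, Set.mem_prod, Finset.mem_coe, Finset.mem_univ] at hi hj
    cases b <;> cases c <;> simp only [hv, if_true, Bool.false_eq_true, if_false] at h
    · rw [hne i hi.1 j hj.1 h]
    · exfalso; apply hqne j hj.1 i hi.1; rw [h]; field_simp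
    · exfalso; apply hqne i hi.1 j hj.1; rw [← h]; field_simp
    · rw [hne i hi.1 j hj.1 (mul_left_cancel₀ (inv_ne_zero hq) h)]
  rw [Lagrange.coeff_eq_sum hinj hP, Finset.mul_sum, Finset.mul_sum, Finset.sum_product]
  refine Finset.sum_congr rfl fun i hi => ?_
  have her : ∀ b : Bool, (J ×ˢ (Finset.univ : Finset Bool)).erase (i, b) =
      insert (i, !b) ((J.erase i) ×ˢ (Finset.univ : Finset Bool)) := by
    intro b; ext ⟨a, c⟩
    simp only [Finset.mem_erase, Finset.mem_product, Finset.mem_univ, and_true, Finset.mem_insert,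
      Prod.mk.injEq, ne_eq]
    cases b <;> cases c <;> simp <;> grind
  have hprod : ∀ (b : Bool), ∏ j ∈ (J ×ˢ (Finset.univ : Finset Bool)).erase (i, b), (v (i, b) - v j)
      = (v (i, b) - v (i, !b)) * ∏ a ∈ J.erase i, (v (i,b) - w a) * (v (i,b) - q⁻¹ * w a) := by
    intro b
    rw [her, Finset.prod_insert (by simp), Finset.prod_product]
    congr 1
    refine Finset.prod_congr rfl fun a _ => ?_
    simp [hv, mul_comm]
  rw [Fintype.sum_bool, hprod, hprod, hPe i hi _ (by simp [hv]), hPe i hi _ (by simp [hv]),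
    ← Finset.mul_prod_erase J _ hi, ← Finset.mul_prod_erase J _ hi]
  have hw := h0 i hi
  have hS : ∀ z : K, z ≠ 0 → ∏ a ∈ J.erase i, S₂ q₁ q q₃ (w a / z) =
      (∏ a ∈ J.erase i, (z - q₃ * w a) * (z - q₁ * w a)) /
        ∏ a ∈ J.erase i, (z - w a) * (z - q⁻¹ * w a) := by
    intro z hz
    rw [← Finset.prod_div_distrib]
    refine Finset.prod_congr rfl fun a _ => ?_
    have e : ∀ c d : K, (1 - c * (w a / z)) * (1 - d * (w a / z)) =
        (z - c * w a) * (z - d * w a) / z ^ 2 := by intro c d; field_simp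
    have e2 := e 1 q⁻¹
    rw [one_mul, one_mul] at e2
    rw [S₂, e, e2, div_div_div_cancel_right₀ (pow_ne_zero 2 hz)]
  have hz : q⁻¹ * w i ≠ 0 := mul_ne_zero (inv_ne_zero hq) hw
  have hS2 : ∏ a ∈ J.erase i, S₂ q₁ q q₃ (q * w a / w i) =
      ∏ a ∈ J.erase i, S₂ q₁ q q₃ (w a / (q⁻¹ * w i)) := by
    refine Finset.prod_congr rfl fun a _ => ?_
    congr 1; field_simp
  rw [hS2, hS _ hw, hS _ hz]
  simp only [hv, if_true, Bool.not_true, Bool.not_false, Bool.false_eq_true, if_false]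
  have hq1' : q - 1 ≠ 0 := sub_ne_zero.2 hq1
  have h1 : w i - q⁻¹ * w i = (1 - q⁻¹) * w i := by ring
  have h2 : q⁻¹ * w i - w i = - ((1 - q⁻¹) * w i) := by ring
  have hk : (q⁻¹ - q₃) * (q⁻¹ - q₁) = q⁻¹ * ((1 - q₁) * (1 - q₃)) := by
    have : q₁ * q₃ = q⁻¹ := by field_simp; linear_combination h123
    linear_combination (1 - q⁻¹) * this
  have h3 : (q⁻¹ * w i - q₃ * w i) * (q⁻¹ * w i - q₁ * w i) =
      q⁻¹ * ((1 - q₁) * (1 - q₃)) * w i ^ 2 := by rw [← hk]; ring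
  rw [h1, h2, h3]
  generalize (∏ a ∈ J.erase i, (w i - w a) * (w i - q⁻¹ * w a)) = A
  generalize (∏ a ∈ J.erase i, (q⁻¹ * w i - w a) * (q⁻¹ * w i - q⁻¹ * w a)) = B
  generalize (1 - q⁻¹) = c at *
  simp only [div_eq_mul_inv, mul_inv, inv_neg]
  field_simp
  ring

/-- The vanishing of the total residue of `∏ S₂(w_a / z) dz / z` (whose residues at `0` and `∞`
cancel), and the evaluation of that of `∏ S₂(w_a / z) dz`. -/
theorem sum_S₂_identities {K ι : Type*} [Field K] [DecidableEq ι] (J : Finset ι) (w : ι → K)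
    (q q₁ q₃ : K) (hq : q ≠ 0) (hq1 : q ≠ 1) (h1 : q₁ ≠ 1) (h3 : q₃ ≠ 1)
    (h0 : ∀ i ∈ J, w i ≠ 0) (hne : ∀ i ∈ J, ∀ j ∈ J, w i = w j → i = j)
    (hqne : ∀ i ∈ J, ∀ j ∈ J, w i ≠ q * w j) (h123 : q₁ * q * q₃ = 1) :
    (∑ i ∈ J, ((∏ a ∈ J.erase i, S₂ q₁ q q₃ (w a / w i)) -
        ∏ a ∈ J.erase i, S₂ q₁ q q₃ (q * w a / w i)) = 0) ∧
    ∑ i ∈ J, w i * (q * (∏ a ∈ J.erase i, S₂ q₁ q q₃ (w a / w i)) -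
        ∏ a ∈ J.erase i, S₂ q₁ q q₃ (q * w a / w i)) = (q - 1) * ∑ i ∈ J, w i := by
  rcases J.eq_empty_or_nonempty with rfl | hJ
  · simp
  -- `Nn` and `Q` are the numerator and the denominator of `∏ S₂(w_a / z)`: monic polynomials of the
  -- same degree, so that `Nn - Q` has smaller degree and agrees with `Nn` at the zeros of `Q`.
  set s := J ×ˢ (Finset.univ : Finset Bool) with hs
  have hs0 : 0 < s.card := by
    rw [Finset.card_pos]; exact hJ.product Finset.univ_nonempty
  set Nn := Lagrange.nodal s (fun x : ι × Bool => if x.2 then q₁ * w x.1 else q₃ * w x.1) with hN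
  set Q := Lagrange.nodal s (fun x : ι × Bool => if x.2 then q⁻¹ * w x.1 else w x.1) with hQ
  have hdeg : (Nn - Q).degree < (s.card : WithBot ℕ) := by
    have := Polynomial.degree_sub_lt_left (p := Nn) (q := Q)
      (by rw [hN, hQ, Lagrange.degree_nodal, Lagrange.degree_nodal]) (Lagrange.nodal_ne_zero)
      (by rw [Lagrange.nodal_monic, Lagrange.nodal_monic])
    rwa [hN, Lagrange.degree_nodal] at this
  have hev : ∀ i ∈ J, ∀ z, (z = w i ∨ z = q⁻¹ * w i) →
      (Nn - Q).eval z = ∏ a ∈ J, (z - q₃ * w a) * (z - q₁ * w a) := by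
    intro i hi z hz
    have hQz : Q.eval z = 0 := by
      rw [hQ, Lagrange.eval_nodal]
      rcases hz with rfl | rfl
      · exact Finset.prod_eq_zero (i := (i, false)) (by simp [hs, hi]) (by simp)
      · exact Finset.prod_eq_zero (i := (i, true)) (by simp [hs, hi]) (by simp)
    rw [Polynomial.eval_sub, hQz, sub_zero, hN, Lagrange.eval_nodal, hs, Finset.prod_product]
    refine Finset.prod_congr rfl fun a _ => ?_
    simp [mul_comm]
  have hqi : (1 - q⁻¹) ≠ 0 := by
    intro h; apply hq1; field_simp at h; linear_combination h
  have hkap : (1 - q₁) * (1 - q₃) ≠ 0 :=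
    mul_ne_zero (sub_ne_zero.2 h1.symm) (sub_ne_zero.2 h3.symm)
  constructor
  -- The constant terms of `Nn` and `Q` agree because `q₁ q₃ = q⁻¹`, so that `(Nn - Q) / z` is a
  -- polynomial; its degree is too small to contribute a residue at infinity.
  · have hc0 : (Nn - Q).coeff 0 = 0 := by
      rw [Polynomial.coeff_zero_eq_eval_zero, Polynomial.eval_sub, hN, hQ, Lagrange.eval_nodal,
        Lagrange.eval_nodal, hs, Finset.prod_product, Finset.prod_product, sub_eq_zero]
      refine Finset.prod_congr rfl fun a _ => ?_
      have : q₁ * q₃ = q⁻¹ := by field_simp; linear_combination h123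
      simp only [Fintype.univ_bool, Finset.mem_singleton, Bool.true_eq_false, not_false_eq_true,
        Finset.prod_insert, if_true, Finset.prod_singleton, Bool.false_eq_true, if_false]
      linear_combination (w a) ^ 2 * this
    have hR := Polynomial.divX_mul_X_add (Nn - Q)
    rw [hc0, Polynomial.C_0, add_zero] at hR
    have key := sum_residues J w q q₁ q₃ hq hq1 h0 hne hqne h123 (Nn - Q).divX
      ((Polynomial.degree_lt_iff_coeff_zero _ _).2 fun m hm => by
        rw [← hs] at hm
        rw [Polynomial.coeff_divX]
        exact (Polynomial.degree_lt_iff_coeff_zero _ _).1 hdeg _ (by omega))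
      (fun z => z⁻¹) (by
        intro i hi z hz
        have hz0 : z ≠ 0 := by
          rcases hz with rfl | rfl
          · exact h0 i hi
          · exact mul_ne_zero (inv_ne_zero hq) (h0 i hi)
        rw [← hev i hi z hz]
        nth_rewrite 2 [← hR]
        rw [Polynomial.eval_mul, Polynomial.eval_X]
        field_simp)
    rw [← hs, Polynomial.coeff_divX, (Polynomial.degree_lt_iff_coeff_zero _ _).1 hdeg _ (by omega),
      mul_zero] at key
    have := (mul_eq_zero.1 key.symm).resolve_left hkap
    rw [← this]
    refine Finset.sum_congr rfl fun i hi => ?_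
    have := h0 i hi
    field_simp
  -- The residue at infinity is the subleading coefficient of `Nn - Q`.
  · have key := sum_residues J w q q₁ q₃ hq hq1 h0 hne hqne h123 (Nn - Q) hdeg (fun _ => 1)
      (by intro i hi z hz; rw [hev i hi z hz, one_mul])
    rw [Polynomial.coeff_sub, hN, hQ, Lagrange.nodal, Lagrange.nodal,
      Polynomial.prod_X_sub_C_coeff_card_pred _ _ hs0,
      Polynomial.prod_X_sub_C_coeff_card_pred _ _ hs0, hs, Finset.sum_product,
      Finset.sum_product] at key
    simp only [Fintype.sum_bool, if_true, Bool.false_eq_true, if_false, ← add_mul,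
      Finset.sum_add_distrib, ← Finset.mul_sum] at key
    have hcoef : -((q₁ + q₃) * ∑ i ∈ J, w i) - -(q⁻¹ * ∑ i ∈ J, w i + ∑ i ∈ J, w i) =
        (1 - q₁) * (1 - q₃) * ∑ i ∈ J, w i := by
      have : q₁ * q₃ = q⁻¹ := by field_simp; linear_combination h123
      linear_combination (-∑ i ∈ J, w i) * this
    have e1 : (1 - q₁) * (1 - q₃) * ((1 - q⁻¹) * ∑ i ∈ J, w i) = (1 - q₁) * (1 - q₃) *
        (q⁻¹ * ∑ i ∈ J, w i * (q * (∏ a ∈ J.erase i, S₂ q₁ q q₃ (w a / w i)) -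
        ∏ a ∈ J.erase i, S₂ q₁ q q₃ (q * w a / w i))) := by
      have e2 : q⁻¹ * ∑ i ∈ J, w i * (q * (∏ a ∈ J.erase i, S₂ q₁ q q₃ (w a / w i)) -
        ∏ a ∈ J.erase i, S₂ q₁ q q₃ (q * w a / w i)) = ∑ i ∈ J, w i *
        (1 * ∏ a ∈ J.erase i, S₂ q₁ q q₃ (w a / w i) -
          q⁻¹ * (1 * ∏ a ∈ J.erase i, S₂ q₁ q q₃ (q * w a / w i))) := by
        rw [Finset.mul_sum]
        refine Finset.sum_congr rfl fun i _ => ?_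
        field_simp
      rw [e2, ← key]
      have h' : (q₁ * ∑ i ∈ J, w i + q₃ * ∑ i ∈ J, w i) = (q₁ + q₃) * ∑ i ∈ J, w i := by ring
      rw [← mul_assoc, mul_comm ((1 - q₁) * (1 - q₃)), mul_assoc, ← hcoef]
    have e3 := mul_left_cancel₀ hkap e1
    have e4 : (q - 1) = q * (1 - q⁻¹) := by field_simp
    rw [e4, mul_assoc, e3]
    field_simp

theorem S₂_reflect {K : Type*} [Field K] (q q₁ q₃ x : K) (hq : q ≠ 0) (hx : x ≠ 0)
    (h123 : q₁ * q * q₃ = 1) : S₂ q₁ q q₃ (q / x) = S₂ q₁ q q₃ x := by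
  unfold S₂
  have e1 : (1 - q₃ * (q / x)) * (1 - q₁ * (q / x)) =
      (q / x ^ 2) * ((1 - q₃ * x) * (1 - q₁ * x)) := by
    field_simp
    linear_combination (q - x ^ 2) * h123
  have e2 : (1 - q / x) * (1 - q⁻¹ * (q / x)) = (q / x ^ 2) * ((1 - x) * (1 - q⁻¹ * x)) := by
    field_simp
    ring
  rw [e1, e2, mul_div_mul_left]
  exact div_ne_zero hq (pow_ne_zero 2 hx)

/-! ### Macdonald operators over a difference field -/

/-- A field `K` with elements `X_i` and pairwise commuting endomorphisms `τ_I` that multiply the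
`X_i`, `i ∈ I`, by `q` and fix the other ones; they also fix `s`, the square root of `t`, and the
`X_i` are in general position. -/
structure DifferenceField (K : Type*) [Field K] (N : ℕ) where
  X : Fin N → K
  q : K
  s : K
  τ : Finset (Fin N) → K →+* K
  q_ne_zero : q ≠ 0
  s_ne_zero : s ≠ 0
  q_ne_one : q ≠ 1
  t_ne_one : s ^ 2 ≠ 1
  t_ne_q : s ^ 2 ≠ q
  X_ne_zero : ∀ i, X i ≠ 0
  X_injective : Function.Injective X
  X_ne_q_mul : ∀ i j, X i ≠ q * X j
  τ_X : ∀ I i, τ I (X i) = if i ∈ I then q * X i else X i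
  τ_s : ∀ I, τ I s = s
  τ_empty : ∀ φ, τ ∅ φ = φ
  τ_insert : ∀ i I, i ∉ I → ∀ φ, τ (insert i I) φ = τ {i} (τ I φ)
  τ_comm : ∀ i I φ, τ {i} (τ I φ) = τ I (τ {i} φ)

namespace DifferenceField

variable {K : Type*} [Field K] {N : ℕ} (R : DifferenceField K N)

/-- The factor `(t^{1/2} x - t^{-1/2} y) / (x - y)`. -/
def f (x y : K) : K := (R.s * x - R.s⁻¹ * y) / (x - y)

/-- The coefficient `∏_{i ∈ I, j ∉ I} f(X_i, X_j)` of `τ_I` in the Macdonald operators. -/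
def A (I : Finset (Fin N)) : K := ∏ i ∈ I, ∏ j ∈ Iᶜ, R.f (R.X i) (R.X j)

/-- The `k`-th Macdonald operator on `K`. -/
def D (k : ℕ) (φ : K) : K := ∑ I ∈ (Finset.univ : Finset (Fin N)).powersetCard k, R.A I * R.τ I φ

/-- The operator `∑ A_i X_i τ_i`. -/
def E (φ : K) : K := ∑ i, R.A {i} * (R.X i * R.τ {i} φ)

/-- The sum of the `X_i`. -/
def e : K := ∑ i, R.X i

/-- The sum of the inverses of the `X_i`. -/
def eInv : K := ∑ i, (R.X i)⁻¹

theorem τ_f (I : Finset (Fin N)) (x y : K) : R.τ I (R.f x y) = R.f (R.τ I x) (R.τ I y) := by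
  simp [f, R.τ_s]

theorem f_mul_mul (x y : K) : R.f (R.q * x) (R.q * y) = R.f x y := by
  unfold f
  rw [← mul_div_mul_left _ (x - y) R.q_ne_zero]
  congr 1 <;> ring

/-- The product of the two factors that a shift of `x` by `q` produces is a value of `S₂`, which
depends on `y / x` alone. -/
theorem f_mul_f (x y : K) (hx : x ≠ 0) (hxy : x ≠ y) (hy : y ≠ R.q * x) :
    R.f x y * R.f y (R.q * x) = S₂ (R.s ^ 2)⁻¹ R.q (R.s ^ 2 * R.q⁻¹) (y / x) := by
  have := R.q_ne_zero
  have := R.s_ne_zero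
  have h1 : x - y ≠ 0 := sub_ne_zero.2 hxy
  have h2 : y - R.q * x ≠ 0 := sub_ne_zero.2 hy
  have h3 : 1 - y / x ≠ 0 := by
    intro h; field_simp at h; exact h1 (by simpa using h)
  have h4 : 1 - R.q⁻¹ * (y / x) ≠ 0 := by
    intro h; field_simp at h; apply h2; linear_combination -h
  unfold f S₂
  rw [div_mul_div_comm, div_eq_div_iff (mul_ne_zero h1 h2) (mul_ne_zero h3 h4)]
  field_simp
  ring

theorem compl_singleton_eq {i : Fin N} {I : Finset (Fin N)} (hi : i ∉ I) :
    ({i}ᶜ : Finset (Fin N)) = I ∪ (insert i I)ᶜ := by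
  ext a; simp only [Finset.mem_compl, Finset.mem_singleton, Finset.mem_union, Finset.mem_insert]
  by_cases h : a = i
  · subst h; simp [hi]
  · simp [h]; tauto

theorem A_singleton {i : Fin N} {I : Finset (Fin N)} (hi : i ∉ I) :
    R.A {i} = (∏ a ∈ I, R.f (R.X i) (R.X a)) * ∏ j ∈ (insert i I)ᶜ, R.f (R.X i) (R.X j) := by
  rw [A, Finset.prod_singleton, compl_singleton_eq hi, Finset.prod_union]
  rw [Finset.disjoint_left]; intro a ha; simp [ha]

theorem A_eq_of_notMem {i : Fin N} {I : Finset (Fin N)} (hi : i ∉ I) :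
    R.A I = ∏ a ∈ I, (R.f (R.X a) (R.X i) * ∏ j ∈ (insert i I)ᶜ, R.f (R.X a) (R.X j)) := by
  have h : Iᶜ = insert i (insert i I)ᶜ := by
    ext a; simp only [Finset.mem_compl, Finset.mem_insert]
    by_cases h : a = i
    · subst h; simp [hi]
    · simp [h]
  rw [A]
  refine Finset.prod_congr rfl fun a _ => ?_
  rw [h, Finset.prod_insert (by simp)]

theorem A_insert {i : Fin N} {I : Finset (Fin N)} (hi : i ∉ I) :
    R.A (insert i I) = (∏ j ∈ (insert i I)ᶜ, R.f (R.X i) (R.X j)) *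
      ∏ a ∈ I, ∏ j ∈ (insert i I)ᶜ, R.f (R.X a) (R.X j) := by
  rw [A, Finset.prod_insert hi]

/-- For `i ∉ I` the coefficient of `τ_{I ∪ i}` in `D₁ D_k` that comes from the pair `(i, I)` is
`A_{I ∪ i}` times a product of factors `S₂`. -/
theorem A_mul_τ_A_of_notMem {i : Fin N} {I : Finset (Fin N)} (hi : i ∉ I) :
    R.A {i} * R.τ {i} (R.A I) = R.A (insert i I) *
      ∏ a ∈ I, S₂ (R.s ^ 2)⁻¹ R.q (R.s ^ 2 * R.q⁻¹) (R.X a / R.X i) := by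
  rw [R.A_singleton hi, R.A_eq_of_notMem hi, R.A_insert hi, map_prod]
  have h1 : ∏ a ∈ I, R.τ {i} (R.f (R.X a) (R.X i) *
      ∏ j ∈ (insert i I)ᶜ, R.f (R.X a) (R.X j)) =
      (∏ a ∈ I, R.f (R.X a) (R.q * R.X i)) *
        ∏ a ∈ I, ∏ j ∈ (insert i I)ᶜ, R.f (R.X a) (R.X j) := by
    rw [← Finset.prod_mul_distrib]
    refine Finset.prod_congr rfl fun a ha => ?_
    have hai : a ≠ i := fun h => hi (h ▸ ha)
    rw [map_mul, map_prod, τ_f, R.τ_X, R.τ_X, if_neg (by simpa using hai), if_pos (by simp)]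
    congr 1
    refine Finset.prod_congr rfl fun j hj => ?_
    have hji : j ≠ i := by rintro rfl; simp at hj
    rw [τ_f, R.τ_X, R.τ_X, if_neg (by simpa using hai), if_neg (by simpa using hji)]
  have h2 : ∏ a ∈ I, S₂ (R.s ^ 2)⁻¹ R.q (R.s ^ 2 * R.q⁻¹) (R.X a / R.X i) =
      (∏ a ∈ I, R.f (R.X i) (R.X a)) * ∏ a ∈ I, R.f (R.X a) (R.q * R.X i) := by
    rw [← Finset.prod_mul_distrib]
    refine Finset.prod_congr rfl fun a ha => ?_
    rw [R.f_mul_f _ _ (R.X_ne_zero i) (fun h => hi (R.X_injective h ▸ ha)) (R.X_ne_q_mul _ _)]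
  rw [h1, h2]
  ring

/-- The counterpart of `A_mul_τ_A_of_notMem` for the composition in the other order. -/
theorem A_mul_τ_A_of_notMem' {i : Fin N} {I : Finset (Fin N)} (hi : i ∉ I) :
    R.A I * R.τ I (R.A {i}) = R.A (insert i I) *
      ∏ a ∈ I, S₂ (R.s ^ 2)⁻¹ R.q (R.s ^ 2 * R.q⁻¹) (R.q * R.X a / R.X i) := by
  rw [R.A_singleton hi, R.A_eq_of_notMem hi, R.A_insert hi, map_mul, map_prod, map_prod,
    Finset.prod_mul_distrib]
  have h1 : ∏ a ∈ I, R.τ I (R.f (R.X i) (R.X a)) = ∏ a ∈ I, R.f (R.X i) (R.q * R.X a) :=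
    Finset.prod_congr rfl fun a ha => by
      rw [τ_f, R.τ_X, R.τ_X, if_neg hi, if_pos ha]
  have h3 : ∏ j ∈ (insert i I)ᶜ, R.τ I (R.f (R.X i) (R.X j)) =
      ∏ j ∈ (insert i I)ᶜ, R.f (R.X i) (R.X j) :=
    Finset.prod_congr rfl fun j hj => by
      have hj' : j ∉ I := by intro h; simp [h] at hj
      rw [τ_f, R.τ_X, R.τ_X, if_neg hi, if_neg hj']
  have h2 : ∏ a ∈ I, S₂ (R.s ^ 2)⁻¹ R.q (R.s ^ 2 * R.q⁻¹) (R.q * R.X a / R.X i) =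
      (∏ a ∈ I, R.f (R.X a) (R.X i)) * ∏ a ∈ I, R.f (R.X i) (R.q * R.X a) := by
    rw [← Finset.prod_mul_distrib]
    refine Finset.prod_congr rfl fun a ha => ?_
    have hq := R.q_ne_zero
    have hs := R.s_ne_zero
    have ha0 := R.X_ne_zero a
    have hi0 := R.X_ne_zero i
    rw [R.f_mul_f _ _ ha0 (fun h => hi (by rw [← R.X_injective h]; exact ha)) (R.X_ne_q_mul _ _),
      ← S₂_reflect R.q _ _ (R.X i / R.X a) hq (div_ne_zero hi0 ha0) (by field_simp)]
    congr 1
    field_simp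
  rw [h1, h2, h3]
  ring

theorem A_mul_τ_A_of_mem {i : Fin N} {I : Finset (Fin N)} (hi : i ∈ I) :
    R.A {i} * R.τ {i} (R.A I) = R.A I * R.τ I (R.A {i}) := by
  obtain ⟨I, hi', rfl⟩ : ∃ I', i ∉ I' ∧ I = insert i I' :=
    ⟨I.erase i, by simp, (Finset.insert_erase hi).symm⟩
  rw [R.A_singleton hi', R.A_insert hi', map_mul, map_mul, map_prod, map_prod, map_prod, map_prod]
  have h1 : ∏ a ∈ I, R.τ (insert i I) (R.f (R.X i) (R.X a)) = ∏ a ∈ I, R.f (R.X i) (R.X a) :=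
    Finset.prod_congr rfl fun a ha => by
      rw [τ_f, R.τ_X, R.τ_X, if_pos hi, if_pos (by simp [ha]), f_mul_mul]
  have h2 : ∏ j ∈ (insert i I)ᶜ, R.τ (insert i I) (R.f (R.X i) (R.X j)) =
      ∏ j ∈ (insert i I)ᶜ, R.f (R.q * R.X i) (R.X j) :=
    Finset.prod_congr rfl fun j hj => by
      rw [τ_f, R.τ_X, R.τ_X, if_pos hi, if_neg (by simpa using hj)]
  have h3 : ∏ j ∈ (insert i I)ᶜ, R.τ {i} (R.f (R.X i) (R.X j)) =
      ∏ j ∈ (insert i I)ᶜ, R.f (R.q * R.X i) (R.X j) :=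
    Finset.prod_congr rfl fun j hj => by
      have hj' : j ≠ i := by rintro rfl; simp at hj
      rw [τ_f, R.τ_X, R.τ_X, if_pos (by simp), if_neg (by simpa using hj')]
  have h4 : ∏ a ∈ I, R.τ {i} (∏ j ∈ (insert i I)ᶜ, R.f (R.X a) (R.X j)) =
      ∏ a ∈ I, ∏ j ∈ (insert i I)ᶜ, R.f (R.X a) (R.X j) :=
    Finset.prod_congr rfl fun a ha => by
      rw [map_prod]
      refine Finset.prod_congr rfl fun j hj => ?_
      have hj' : j ≠ i := by rintro rfl; simp at hj
      have ha' : a ≠ i := by rintro rfl; exact hi' ha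
      rw [τ_f, R.τ_X, R.τ_X, if_neg (by simpa using ha'), if_neg (by simpa using hj')]
  rw [h1, h2, h3, h4]
  ring

/-- Regrouping of the pairs `(I, i)` with `i ∉ I` according to `I ∪ {i}`. -/
theorem sum_powersetCard_sum_compl {M : Type*} [AddCommMonoid M] (k : ℕ)
    (G : Fin N → Finset (Fin N) → M) :
    ∑ I ∈ (Finset.univ : Finset (Fin N)).powersetCard k, ∑ i ∈ Iᶜ, G i I =
      ∑ J ∈ (Finset.univ : Finset (Fin N)).powersetCard (k + 1), ∑ i ∈ J, G i (J.erase i) := by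
  rw [Finset.sum_sigma', Finset.sum_sigma']
  refine Finset.sum_bij' (fun x _ => ⟨insert x.2 x.1, x.2⟩) (fun x _ => ⟨x.1.erase x.2, x.2⟩)
    ?_ ?_ ?_ ?_ ?_
  · rintro ⟨I, i⟩ h
    simp only [Finset.mem_sigma, Finset.mem_powersetCard, Finset.mem_compl] at h ⊢
    refine ⟨⟨Finset.subset_univ _, ?_⟩, by simp⟩
    rw [Finset.card_insert_of_notMem h.2, h.1.2]
  · rintro ⟨I, i⟩ h
    simp only [Finset.mem_sigma, Finset.mem_powersetCard, Finset.mem_compl] at h ⊢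
    refine ⟨⟨Finset.subset_univ _, ?_⟩, by simp⟩
    rw [Finset.card_erase_of_mem h.2, h.1.2, Nat.add_sub_cancel]
  · rintro ⟨I, i⟩ h
    simp only [Finset.mem_sigma, Finset.mem_compl] at h
    simp [Finset.erase_insert h.2]
  · rintro ⟨I, i⟩ h
    simp only [Finset.mem_sigma] at h
    simp [Finset.insert_erase h.2]
  · rintro ⟨I, i⟩ h
    simp only [Finset.mem_sigma, Finset.mem_compl] at h
    simp [Finset.erase_insert h.2]

theorem D_one (φ : K) : R.D 1 φ = ∑ i, R.A {i} * R.τ {i} φ := by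
  simp [D, Finset.powersetCard_one]

theorem D_zero (φ : K) : R.D 0 φ = φ := by
  simp [D, A, R.τ_empty]

theorem D_eq_zero {k : ℕ} (hk : N < k) (φ : K) : R.D k φ = 0 := by
  rw [D, Finset.powersetCard_eq_empty.2 (by simpa using hk), Finset.sum_empty]

theorem S₂_identities (J : Finset (Fin N)) :
    (∑ i ∈ J, ((∏ a ∈ J.erase i, S₂ (R.s ^ 2)⁻¹ R.q (R.s ^ 2 * R.q⁻¹) (R.X a / R.X i)) -
        ∏ a ∈ J.erase i, S₂ (R.s ^ 2)⁻¹ R.q (R.s ^ 2 * R.q⁻¹) (R.q * R.X a / R.X i)) = 0) ∧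
    ∑ i ∈ J, R.X i * (R.q *
        (∏ a ∈ J.erase i, S₂ (R.s ^ 2)⁻¹ R.q (R.s ^ 2 * R.q⁻¹) (R.X a / R.X i)) -
        ∏ a ∈ J.erase i, S₂ (R.s ^ 2)⁻¹ R.q (R.s ^ 2 * R.q⁻¹) (R.q * R.X a / R.X i)) =
      (R.q - 1) * ∑ i ∈ J, R.X i := by
  have hq := R.q_ne_zero
  have hs := R.s_ne_zero
  refine sum_S₂_identities J R.X R.q _ _ hq R.q_ne_one ?_ ?_ (fun i _ => R.X_ne_zero i)
    (fun i _ j _ h => R.X_injective h) (fun i _ j _ => R.X_ne_q_mul i j) (by field_simp)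
  · rw [Ne, inv_eq_one]; exact R.t_ne_one
  · rw [Ne, ← div_eq_mul_inv, div_eq_one_iff_eq hq]; exact R.t_ne_q

/-- The first Macdonald operator commutes with all of them: the terms with `i ∈ I` cancel in pairs,
and those with `i ∉ I` cancel for each `I ∪ {i}` by the first identity for `S₂`. -/
theorem D_one_D_comm (k : ℕ) (φ : K) : R.D 1 (R.D k φ) = R.D k (R.D 1 φ) := by
  have hL : R.D 1 (R.D k φ) = ∑ I ∈ (Finset.univ : Finset (Fin N)).powersetCard k,
      ∑ i, R.A {i} * R.τ {i} (R.A I) * R.τ {i} (R.τ I φ) := by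
    rw [D_one, Finset.sum_comm]
    refine Finset.sum_congr rfl fun i _ => ?_
    rw [D, map_sum, Finset.mul_sum]
    refine Finset.sum_congr rfl fun I _ => ?_
    rw [map_mul, mul_assoc]
  have hR : R.D k (R.D 1 φ) = ∑ I ∈ (Finset.univ : Finset (Fin N)).powersetCard k,
      ∑ i, R.A I * R.τ I (R.A {i}) * R.τ {i} (R.τ I φ) := by
    rw [D]
    refine Finset.sum_congr rfl fun I _ => ?_
    rw [D_one, map_sum, Finset.mul_sum]
    refine Finset.sum_congr rfl fun i _ => ?_
    rw [map_mul, mul_assoc, R.τ_comm]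
  rw [← sub_eq_zero, hL, hR, ← Finset.sum_sub_distrib]
  have : ∀ I ∈ (Finset.univ : Finset (Fin N)).powersetCard k,
      (∑ i, R.A {i} * R.τ {i} (R.A I) * R.τ {i} (R.τ I φ)) -
      ∑ i, R.A I * R.τ I (R.A {i}) * R.τ {i} (R.τ I φ) = ∑ i ∈ Iᶜ,
      (R.A {i} * R.τ {i} (R.A I) - R.A I * R.τ I (R.A {i})) * R.τ {i} (R.τ I φ) := by
    intro I _
    rw [← Finset.sum_sub_distrib, ← Finset.sum_add_sum_compl I, Finset.sum_eq_zero, zero_add]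
    · exact Finset.sum_congr rfl fun i _ => by rw [sub_mul]
    · intro i hi
      rw [R.A_mul_τ_A_of_mem hi, sub_self]
  rw [Finset.sum_congr rfl this, sum_powersetCard_sum_compl]
  refine Finset.sum_eq_zero fun J _ => ?_
  have h0 := (R.S₂_identities J).1
  calc _ = ∑ i ∈ J, (R.A J * R.τ J φ) *
        ((∏ a ∈ J.erase i, S₂ (R.s ^ 2)⁻¹ R.q (R.s ^ 2 * R.q⁻¹) (R.X a / R.X i)) -
        ∏ a ∈ J.erase i, S₂ (R.s ^ 2)⁻¹ R.q (R.s ^ 2 * R.q⁻¹) (R.q * R.X a / R.X i)) := by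
        refine Finset.sum_congr rfl fun i hi => ?_
        rw [R.A_mul_τ_A_of_notMem (Finset.notMem_erase i J),
          R.A_mul_τ_A_of_notMem' (Finset.notMem_erase i J),
          ← R.τ_insert _ _ (Finset.notMem_erase i J), Finset.insert_erase hi]
        ring
    _ = 0 := by rw [← Finset.mul_sum, h0, mul_zero]

theorem τ_e (I : Finset (Fin N)) : R.τ I R.e = R.e + (R.q - 1) * ∑ i ∈ I, R.X i := by
  rw [e, map_sum, Finset.mul_sum, ← Finset.sum_add_sum_compl I, ← Finset.sum_add_sum_compl I,
    add_right_comm, ← Finset.sum_add_distrib]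
  congr 1
  · exact Finset.sum_congr rfl fun i hi => by rw [R.τ_X, if_pos hi]; ring
  · exact Finset.sum_congr rfl fun i hi => by rw [R.τ_X, if_neg (Finset.mem_compl.1 hi)]

theorem D_one_e_mul (φ : K) : R.D 1 (R.e * φ) = R.e * R.D 1 φ + (R.q - 1) * R.E φ := by
  rw [D_one, D_one, E, Finset.mul_sum, Finset.mul_sum, ← Finset.sum_add_distrib]
  refine Finset.sum_congr rfl fun i _ => ?_
  rw [map_mul, R.τ_e, Finset.sum_singleton]
  ring

theorem E_eInv_mul (φ : K) : R.E (R.eInv * φ) = R.eInv * R.E φ + (R.q⁻¹ - 1) * R.D 1 φ := by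
  rw [D_one, E, E, Finset.mul_sum, Finset.mul_sum, ← Finset.sum_add_distrib]
  refine Finset.sum_congr rfl fun i _ => ?_
  have : R.τ {i} R.eInv = R.eInv + (R.q⁻¹ - 1) * (R.X i)⁻¹ := by
    rw [eInv, map_sum, ← Finset.add_sum_erase _ _ (Finset.mem_univ i),
      ← Finset.add_sum_erase _ (fun i => (R.X i)⁻¹) (Finset.mem_univ i), map_inv₀, R.τ_X,
      if_pos (by simp), mul_inv]
    have : ∑ j ∈ Finset.univ.erase i, R.τ {i} (R.X j)⁻¹ =
        ∑ j ∈ Finset.univ.erase i, (R.X j)⁻¹ :=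
      Finset.sum_congr rfl fun j hj => by
        rw [map_inv₀, R.τ_X, if_neg (by simpa using hj)]
    rw [this]; ring
  have hX := R.X_ne_zero i
  rw [map_mul, this]
  field_simp

/-- The relation between the Macdonald operators, multiplication by `∑ X_i` and its commutator with
the first Macdonald operator. As in `D_one_D_comm`, only the terms with `i ∉ I` survive on the
right, and the second identity for `S₂` sums them. -/
theorem D_e_relation (k : ℕ) (φ : K) :
    R.D (k + 1) (R.e * φ) - R.e * R.D (k + 1) φ = R.q * R.E (R.D k φ) - R.D k (R.E φ) := by
  have hL : R.D (k + 1) (R.e * φ) - R.e * R.D (k + 1) φ =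
      ∑ J ∈ (Finset.univ : Finset (Fin N)).powersetCard (k + 1),
        (R.A J * R.τ J φ) * ((R.q - 1) * ∑ i ∈ J, R.X i) := by
    rw [D, D, Finset.mul_sum, ← Finset.sum_sub_distrib]
    refine Finset.sum_congr rfl fun J _ => ?_
    rw [map_mul, R.τ_e]; ring
  have h1 : R.q * R.E (R.D k φ) = ∑ I ∈ (Finset.univ : Finset (Fin N)).powersetCard k,
      ∑ i, R.q * R.X i * (R.A {i} * R.τ {i} (R.A I)) * R.τ {i} (R.τ I φ) := by
    rw [E, Finset.sum_comm, Finset.mul_sum]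
    refine Finset.sum_congr rfl fun i _ => ?_
    rw [D, map_sum, Finset.mul_sum, Finset.mul_sum, Finset.mul_sum]
    refine Finset.sum_congr rfl fun I _ => ?_
    rw [map_mul]; ring
  have h2 : R.D k (R.E φ) = ∑ I ∈ (Finset.univ : Finset (Fin N)).powersetCard k,
      ∑ i, R.τ I (R.X i) * (R.A I * R.τ I (R.A {i})) * R.τ {i} (R.τ I φ) := by
    rw [D]
    refine Finset.sum_congr rfl fun I _ => ?_
    rw [E, map_sum, Finset.mul_sum]
    refine Finset.sum_congr rfl fun i _ => ?_
    rw [map_mul, map_mul, R.τ_comm]; ring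
  rw [hL, h1, h2, ← Finset.sum_sub_distrib]
  have : ∀ I ∈ (Finset.univ : Finset (Fin N)).powersetCard k,
      (∑ i, R.q * R.X i * (R.A {i} * R.τ {i} (R.A I)) * R.τ {i} (R.τ I φ)) -
      ∑ i, R.τ I (R.X i) * (R.A I * R.τ I (R.A {i})) * R.τ {i} (R.τ I φ) = ∑ i ∈ Iᶜ,
      R.X i * (R.q * (R.A {i} * R.τ {i} (R.A I)) - R.A I * R.τ I (R.A {i})) *
        R.τ {i} (R.τ I φ) := by
    intro I _
    rw [← Finset.sum_sub_distrib, ← Finset.sum_add_sum_compl I, Finset.sum_eq_zero, zero_add]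
    · refine Finset.sum_congr rfl fun i hi => ?_
      rw [R.τ_X, if_neg (Finset.mem_compl.1 hi)]; ring
    · intro i hi
      rw [R.A_mul_τ_A_of_mem hi, R.τ_X, if_pos hi, sub_self]
  rw [Finset.sum_congr rfl this, sum_powersetCard_sum_compl]
  refine Finset.sum_congr rfl fun J _ => ?_
  rw [← (R.S₂_identities J).2, Finset.mul_sum]
  refine Finset.sum_congr rfl fun i hi => ?_
  rw [R.A_mul_τ_A_of_notMem (Finset.notMem_erase i J),
    R.A_mul_τ_A_of_notMem' (Finset.notMem_erase i J),
    ← R.τ_insert _ _ (Finset.notMem_erase i J), Finset.insert_erase hi]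
  ring

end DifferenceField

/-! ### Rescaling the variables -/

/-- The algebra endomorphism `X_i ↦ c_i X_i` of the Laurent polynomials. -/
noncomputable def scaleHom {F : Type*} [Field F] {N : ℕ} (c : Fin N → Fˣ) :
    Laurent F N →ₐ[F] Laurent F N :=
  AddMonoidAlgebra.lift F (Laurent F N) (Fin N → ℤ)
    { toFun := fun α => AddMonoidAlgebra.single α.toAdd (∏ i, (c i : F) ^ (α.toAdd i))
      map_one' := by simp [AddMonoidAlgebra.one_def]
      map_mul' := fun α β => by
        rw [AddMonoidAlgebra.single_mul_single, ← Finset.prod_mul_distrib, toAdd_mul]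
        congr 1
        refine Finset.prod_congr rfl fun i _ => ?_
        rw [Pi.add_apply, zpow_add₀ (c i).ne_zero] }

section
variable {F : Type*} [Field F] {N : ℕ}

theorem scaleHom_single (c : Fin N → Fˣ) (α : Fin N → ℤ) (x : F) :
    scaleHom c (AddMonoidAlgebra.single α x) =
      AddMonoidAlgebra.single α (x * ∏ i, (c i : F) ^ (α i)) := by
  rw [scaleHom, AddMonoidAlgebra.lift_single]
  simp

theorem coeff_scaleHom (c : Fin N → Fˣ) (f : Laurent F N) (α : Fin N → ℤ) :
    (scaleHom c f).coeff α = (∏ i, (c i : F) ^ (α i)) * f.coeff α := by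
  induction f using AddMonoidAlgebra.induction_linear with
  | zero => simp
  | add f g hf hg => simp [hf, hg, mul_add]
  | single β x =>
    classical
    rw [scaleHom_single, AddMonoidAlgebra.coeff_single, AddMonoidAlgebra.coeff_single,
      Finsupp.single_apply, Finsupp.single_apply]
    split_ifs with h
    · rw [h, mul_comm]
    · simp

theorem scaleHom_injective (c : Fin N → Fˣ) : Function.Injective (scaleHom c) := by
  intro f g h
  refine AddMonoidAlgebra.coeff_injective (Finsupp.ext fun α => ?_)
  have := congrArg (fun f => f.coeff α) h
  simp only [coeff_scaleHom] at this
  exact mul_left_cancel₀ (Finset.prod_ne_zero_iff.2 fun i _ => zpow_ne_zero _ (c i).ne_zero) this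

theorem scaleHom_varX (c : Fin N → Fˣ) (i : Fin N) :
    scaleHom c (varX F i) = (c i : F) • varX F i := by
  rw [varX, scaleHom_single, AddMonoidAlgebra.smul_single, one_mul, smul_eq_mul, mul_one,
    Finset.prod_eq_single i]
  · simp
  · intro j _ hj; simp [hj]
  · simp

theorem scaleHom_mul (c d : Fin N → Fˣ) (f : Laurent F N) :
    scaleHom (c * d) f = scaleHom c (scaleHom d f) := by
  refine AddMonoidAlgebra.coeff_injective (Finsupp.ext fun α => ?_)
  simp only [coeff_scaleHom, Pi.mul_apply, Units.val_mul, mul_zpow, Finset.prod_mul_distrib,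
    mul_assoc]

/-- The units `q` at the places in `I` and `1` elsewhere. -/
def unitsOn (q : Fˣ) (I : Finset (Fin N)) : Fin N → Fˣ := fun i => if i ∈ I then q else 1

theorem prod_unitsOn (q : Fˣ) (I : Finset (Fin N)) (α : Fin N → ℤ) :
    ∏ i, (unitsOn q I i : F) ^ (α i) = (q : F) ^ (∑ i ∈ I, α i) := by
  have : ∀ i, (unitsOn q I i : F) ^ (α i) = if i ∈ I then (q : F) ^ (α i) else 1 := by
    intro i; unfold unitsOn; split_ifs <;> simp
  simp_rw [this]
  rw [Finset.prod_ite_mem, Finset.univ_inter]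
  clear this
  induction I using Finset.induction_on with
  | empty => simp
  | insert a s ha ih => rw [Finset.prod_insert ha, Finset.sum_insert ha, zpow_add₀ q.ne_zero, ih]

theorem qShift_single (q : F) (I : Finset (Fin N)) (α : Fin N → ℤ) (x : F) :
    qShift q I (AddMonoidAlgebra.single α x) =
      AddMonoidAlgebra.single α (x * q ^ (∑ i ∈ I, α i)) := by
  simp [qShift]

theorem qShift_eq_scaleHom (q : Fˣ) (I : Finset (Fin N)) (f : Laurent F N) :
    qShift (q : F) I f = scaleHom (unitsOn q I) f := by
  induction f using AddMonoidAlgebra.induction_linear with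
  | zero => simp
  | add f g hf hg => simp [hf, hg]
  | single β x => rw [qShift_single, scaleHom_single, prod_unitsOn]

/-- The embedding of the Laurent polynomials in the rational functions. -/
noncomputable abbrev toRat (F : Type*) [Field F] (N : ℕ) : Laurent F N →+* RatFrac F N :=
  algebraMap (Laurent F N) (RatFrac F N)

theorem toRat_injective : Function.Injective (toRat F N) :=
  IsFractionRing.injective (Laurent F N) (RatFrac F N)

/-- The extension of `scaleHom` to the field of fractions. -/
noncomputable def scaleFrac (c : Fin N → Fˣ) : RatFrac F N →+* RatFrac F N :=
  IsFractionRing.lift (A := Laurent F N) (g := (toRat F N).comp (scaleHom c).toRingHom)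
    (toRat_injective.comp (scaleHom_injective c))

theorem scaleFrac_toRat (c : Fin N → Fˣ) (f : Laurent F N) :
    scaleFrac c (toRat F N f) = toRat F N (scaleHom c f) :=
  IsFractionRing.lift_algebraMap _ _

theorem scaleFrac_mul (c d : Fin N → Fˣ) (φ : RatFrac F N) :
    scaleFrac (c * d) φ = scaleFrac c (scaleFrac d φ) := by
  obtain ⟨a, b, -, rfl⟩ := IsFractionRing.div_surjective (A := Laurent F N) φ
  simp only [map_div₀, scaleFrac_toRat, scaleHom_mul]

theorem scaleFrac_one (φ : RatFrac F N) : scaleFrac (1 : Fin N → Fˣ) φ = φ := by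
  obtain ⟨a, b, -, rfl⟩ := IsFractionRing.div_surjective (A := Laurent F N) φ
  have h1 : ∀ f : Laurent F N, scaleHom (1 : Fin N → Fˣ) f = f := by
    intro f
    refine AddMonoidAlgebra.coeff_injective (Finsupp.ext fun α => ?_)
    simp [coeff_scaleHom]
  rw [map_div₀, scaleFrac_toRat, scaleFrac_toRat, h1, h1]

end

/-! ### Macdonald operators on Laurent polynomials -/

/-- The parameters `q` and `t = s ^ 2` are nonzero and multiplicatively independent. -/
structure IsGeneric {F : Type*} [Field F] (q s : F) : Prop where
  q_ne_zero : q ≠ 0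
  s_ne_zero : s ≠ 0
  eq_zero_of_zpow_mul : ∀ a b : ℤ, q ^ a * (s ^ 2) ^ b = 1 → a = 0 ∧ b = 0

section
variable {F : Type*} [Field F] {N : ℕ} {q s : F}

theorem IsGeneric.inv (h : IsGeneric q s) : IsGeneric q⁻¹ s⁻¹ where
  q_ne_zero := inv_ne_zero h.q_ne_zero
  s_ne_zero := inv_ne_zero h.s_ne_zero
  eq_zero_of_zpow_mul := fun a b hab => by
    have := h.eq_zero_of_zpow_mul (-a) (-b) (by
      rw [← hab, inv_zpow', inv_pow, inv_zpow'])
    omega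

theorem IsGeneric.q_ne_one (h : IsGeneric q s) : q ≠ 1 := fun h1 => by
  have := h.eq_zero_of_zpow_mul 1 0 (by simp [h1]); omega

theorem IsGeneric.t_ne_one (h : IsGeneric q s) : s ^ 2 ≠ 1 := fun h1 => by
  have := h.eq_zero_of_zpow_mul 0 1 (by simp [h1]); omega

theorem IsGeneric.t_ne_q (h : IsGeneric q s) : s ^ 2 ≠ q := fun h1 => by
  have hq := h.q_ne_zero
  have := h.eq_zero_of_zpow_mul 1 (-1) (by rw [h1]; simp [hq]); omega

theorem toRat_smul (c : F) (f : Laurent F N) :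
    toRat F N (c • f) = algebraMap F (RatFrac F N) c * toRat F N f := by
  rw [Algebra.smul_def, map_mul, ← IsScalarTower.algebraMap_apply]

theorem scaleFrac_algebraMap (c : Fin N → Fˣ) (x : F) :
    scaleFrac c (algebraMap F (RatFrac F N) x) = algebraMap F (RatFrac F N) x := by
  rw [IsScalarTower.algebraMap_apply F (Laurent F N) (RatFrac F N), scaleFrac_toRat,
    AlgHom.commutes]

theorem varX_ne_smul_varX {i j : Fin N} (c : F) (h : i = j → c ≠ 1) : varX F i ≠ c • varX F j := by
  intro he
  rw [varX, varX, AddMonoidAlgebra.smul_single, smul_eq_mul, mul_one,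
    AddMonoidAlgebra.single_inj] at he
  rcases he with ⟨h1, h2⟩ | h2
  · have h3 := congrFun h1 i
    refine h ?_ h2.symm
    by_contra hij
    rw [Pi.single_eq_same, Pi.single_eq_of_ne hij] at h3
    exact one_ne_zero h3
  · exact one_ne_zero h2.1

theorem varX_ne_zero (i : Fin N) : varX F i ≠ 0 := by
  rw [varX, AddMonoidAlgebra.single_ne_zero]; exact one_ne_zero

theorem varX_injective : Function.Injective (varX F : Fin N → Laurent F N) := by
  intro i j h
  by_contra hij
  exact varX_ne_smul_varX (1 : F) (fun h => absurd h hij) (by rw [one_smul]; exact h)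

theorem unitsOn_insert (u : Fˣ) {i : Fin N} {I : Finset (Fin N)} (hi : i ∉ I) :
    unitsOn u (insert i I) = unitsOn u {i} * unitsOn u I := by
  funext j
  simp only [unitsOn, Finset.mem_insert, Pi.mul_apply, Finset.mem_singleton]
  by_cases hj : j = i
  · subst hj; simp [hi]
  · simp [hj]

/-- The rational functions in `X_1, …, X_N` with the `q`-shifts of the variables. -/
noncomputable def ratDifferenceField (h : IsGeneric q s) (N : ℕ) :
    DifferenceField (RatFrac F N) N where
  X := fun i => toRat F N (varX F i)
  q := algebraMap F (RatFrac F N) q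
  s := algebraMap F (RatFrac F N) s
  τ := fun I => scaleFrac (unitsOn (Units.mk0 q h.q_ne_zero) I)
  q_ne_zero := by rw [Ne, FaithfulSMul.algebraMap_eq_zero_iff]; exact h.q_ne_zero
  s_ne_zero := by rw [Ne, FaithfulSMul.algebraMap_eq_zero_iff]; exact h.s_ne_zero
  q_ne_one := by rw [Ne, FaithfulSMul.algebraMap_eq_one_iff]; exact h.q_ne_one
  t_ne_one := by rw [← map_pow, Ne, FaithfulSMul.algebraMap_eq_one_iff]; exact h.t_ne_one
  t_ne_q := by
    rw [← map_pow]
    exact fun he => h.t_ne_q (FaithfulSMul.algebraMap_injective F (RatFrac F N) he)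
  X_ne_zero := fun i => by
    rw [Ne, FaithfulSMul.algebraMap_eq_zero_iff]; exact varX_ne_zero i
  X_injective := toRat_injective.comp varX_injective
  X_ne_q_mul := fun i j he => by
    rw [← toRat_smul] at he
    exact varX_ne_smul_varX q (fun _ => h.q_ne_one) (toRat_injective he)
  τ_X := fun I i => by
    rw [scaleFrac_toRat, scaleHom_varX, toRat_smul, unitsOn]
    split_ifs <;> simp
  τ_s := fun I => scaleFrac_algebraMap _ _
  τ_empty := fun φ => by
    have : unitsOn (Units.mk0 q h.q_ne_zero) (∅ : Finset (Fin N)) = 1 := by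
      funext i; simp [unitsOn]
    rw [this, scaleFrac_one]
  τ_insert := fun i I hi φ => by rw [unitsOn_insert _ hi, scaleFrac_mul]
  τ_comm := fun i I φ => by rw [← scaleFrac_mul, ← scaleFrac_mul, mul_comm]

theorem macdonaldD_apply (q s : F) (k : ℕ) (f : Laurent F N) :
    macdonaldD N q s k f = ∑ I ∈ (Finset.univ : Finset (Fin N)).powersetCard k,
      (∏ i ∈ I, ∏ j ∈ Iᶜ, toRat F N (s • varX F i - s⁻¹ • varX F j) /
        toRat F N (varX F i - varX F j)) * toRat F N (qShift q I f) := by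
  rw [macdonaldD, LinearMap.sum_apply]
  rfl

theorem macdonaldD_eq (h : IsGeneric q s) (k : ℕ) (f : Laurent F N) :
    macdonaldD N q s k f = (ratDifferenceField h N).D k (toRat F N f) := by
  rw [macdonaldD_apply, DifferenceField.D]
  refine Finset.sum_congr rfl fun I _ => ?_
  congr 1
  · refine Finset.prod_congr rfl fun i _ => Finset.prod_congr rfl fun j _ => ?_
    rw [DifferenceField.f, map_sub, map_sub, toRat_smul, toRat_smul, map_inv₀]
    rfl
  · change _ = scaleFrac _ _
    rw [scaleFrac_toRat, ← qShift_eq_scaleHom, Units.val_mk0]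

theorem toRat_e₁ (h : IsGeneric q s) : toRat F N (e₁ F N) = (ratDifferenceField h N).e := by
  rw [e₁, map_sum]; rfl

theorem toRat_e₁inv (h : IsGeneric q s) :
    toRat F N (e₁inv F N) = (ratDifferenceField h N).eInv := by
  rw [e₁inv, map_sum, DifferenceField.eInv]
  refine Finset.sum_congr rfl fun i _ => ?_
  refine eq_inv_of_mul_eq_one_left ?_
  change _ * toRat F N (varX F i) = 1
  rw [← map_mul, varXinv, varX, AddMonoidAlgebra.single_mul_single, ← Pi.single_add]
  simp [← AddMonoidAlgebra.one_def]

end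

/-! ### The dominance order -/

section
variable {N : ℕ}

/-- The strict dominance order. -/
def Below (μ lam : Weight N) : Prop := Dominated μ lam ∧ μ ≠ lam

/-- The squared length of a weight, a measure of its height in the dominance order. -/
def normSq (μ : Weight N) : ℤ := ∑ i, μ.1 i ^ 2

theorem normSq_nonneg (μ : Weight N) : 0 ≤ normSq μ := Finset.sum_nonneg fun _ _ => sq_nonneg _

theorem dominated_refl (μ : Weight N) : Dominated μ μ := ⟨rfl, fun _ => le_rfl⟩

theorem dominated_trans {μ ν lam : Weight N} (h : Dominated μ ν) (h' : Dominated ν lam) :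
    Dominated μ lam := ⟨h.1.trans h'.1, fun r => (h.2 r).trans (h'.2 r)⟩

/-- Summation by parts. -/
theorem mul_sum_le_sum_mul_of_antitone {n : ℕ} (ν d : Fin n → ℤ) (hν : Antitone ν)
    (hd : ∀ r, 0 ≤ ∑ i ∈ Finset.Iic r, d i) (c : ℤ) (hc : ∀ i, c ≤ ν i) :
    c * ∑ i, d i ≤ ∑ i, ν i * d i := by
  induction n generalizing c with
  | zero => simp
  | succ n ih =>
    have h1 := ih (ν ∘ Fin.castSucc) (d ∘ Fin.castSucc)
      (fun i j hij => hν (Fin.castSucc_le_castSucc_iff.2 hij))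
      (fun r => by
        have := hd r.castSucc
        rw [← Fin.map_castSuccEmb_Iic, Finset.sum_map] at this
        exact this) (ν (Fin.last n)) (fun i => hν (Fin.le_last _))
    have h2 : 0 ≤ ∑ i, d i := by
      have := hd (Fin.last n)
      rwa [← Fin.top_eq_last, Finset.Iic_top] at this
    rw [Fin.sum_univ_castSucc (fun i => ν i * d i)]
    have h3 : c * ∑ i, d i ≤ ν (Fin.last n) * ∑ i, d i :=
      mul_le_mul_of_nonneg_right (hc _) h2
    rw [Fin.sum_univ_castSucc d] at h3 ⊢
    simp only [Function.comp_apply] at h1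
    linarith

/-- The norm is strictly monotone for the dominance order: expand `|μ + (λ - μ)|²` and sum the mixed
term by parts. This makes the dominance order well-founded and its antisymmetry plain. -/
theorem Below.normSq_lt {μ lam : Weight N} (h : Below μ lam) : normSq μ < normSq lam := by
  have hd : ∀ r, 0 ≤ ∑ i ∈ Finset.Iic r, (lam.1 i - μ.1 i) := fun r => by
    rw [Finset.sum_sub_distrib]; linarith [h.1.2 r]
  have h0 : ∑ i, (lam.1 i - μ.1 i) = 0 := by rw [Finset.sum_sub_distrib, h.1.1, sub_self]
  have h1 : 0 ≤ ∑ i, μ.1 i * (lam.1 i - μ.1 i) := by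
    rcases Nat.eq_zero_or_pos N with rfl | hN
    · simp
    · have := mul_sum_le_sum_mul_of_antitone μ.1 _ μ.2 hd (μ.1 ⟨N - 1, by omega⟩)
        (fun i => μ.2 (by rw [Fin.le_def]; have := i.2; simp only; omega))
      rwa [h0, mul_zero] at this
  have h2 : 0 < ∑ i, (lam.1 i - μ.1 i) ^ 2 := by
    obtain ⟨i, hi⟩ := Function.ne_iff.1 (fun he => h.2 (Subtype.ext he))
    refine Finset.sum_pos' (fun _ _ => sq_nonneg _) ⟨i, Finset.mem_univ _, ?_⟩
    have : lam.1 i - μ.1 i ≠ 0 := sub_ne_zero.2 (Ne.symm hi)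
    positivity
  have h3 : normSq lam - normSq μ =
      ∑ i, (lam.1 i - μ.1 i) ^ 2 + 2 * ∑ i, μ.1 i * (lam.1 i - μ.1 i) := by
    rw [normSq, normSq, ← Finset.sum_sub_distrib, Finset.mul_sum, ← Finset.sum_add_distrib]
    exact Finset.sum_congr rfl fun i _ => by ring
  linarith

theorem Below.trans_dominated {μ ν lam : Weight N} (h : Below μ ν) (h' : Dominated ν lam) :
    Below μ lam := by
  refine ⟨dominated_trans h.1 h', ?_⟩
  rintro rfl
  have h1 := h.normSq_lt
  have h2 : Below ν μ := ⟨h', h.2.symm⟩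
  exact absurd h2.normSq_lt (by omega)

/-- The staircase weight `(N-1, N-2, …, 0)`. -/
def stair (N : ℕ) : Fin N → ℤ := fun i => (N : ℤ) - 1 - (i : ℕ)

theorem stair_antitone : Antitone (stair N) := fun i j hij => by
  have : (i : ℕ) ≤ j := hij
  simp only [stair]; omega

theorem exists_perm_antitone (α : Fin N → ℤ) : ∃ σ : Equiv.Perm (Fin N), Antitone (α ∘ σ) := by
  refine ⟨Tuple.sort (fun i => - α i), fun i j hij => ?_⟩
  have := Tuple.monotone_sort (fun i => - α i) hij
  simp only [Function.comp_apply] at this ⊢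
  omega

theorem sub_stair_antitone {β : Fin N → ℤ} (hβ : Antitone β) (hinj : Function.Injective β) :
    Antitone (β - stair N) := by
  cases N with
  | zero => intro i; exact i.elim0
  | succ n =>
    rw [Fin.antitone_iff_succ_le]
    intro i
    have h1 : β i.succ ≤ β i.castSucc := hβ (Fin.castSucc_lt_succ).le
    have h2 : β i.succ ≠ β i.castSucc := fun h => absurd (hinj h) (Fin.castSucc_lt_succ).ne'
    simp only [Pi.sub_apply, stair, Fin.val_succ, Fin.val_castSucc]
    push_cast
    omega

theorem sum_Iic_perm_le {μ : Fin N → ℤ} (hμ : Antitone μ) (σ : Equiv.Perm (Fin N)) (r : Fin N) :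
    ∑ i ∈ Finset.Iic r, μ (σ i) ≤ ∑ i ∈ Finset.Iic r, μ i := by
  have hm : Monovary (fun i : Fin N => if i ≤ r then (1 : ℤ) else 0) μ := by
    intro i j hij
    have hji : j ≤ i := by
      by_contra h
      exact absurd (hμ (not_le.1 h).le) (not_le.2 hij)
    simp only
    split_ifs with h1 h2
    · exact le_rfl
    · exact absurd (hji.trans h1) h2
    · exact zero_le_one
    · exact le_rfl
  have := hm.sum_mul_comp_perm_le_sum_mul (σ := σ)
  simp only [ite_mul, one_mul, zero_mul, ← Finset.sum_filter] at this
  have he : Finset.univ.filter (fun i => i ≤ r) = Finset.Iic r := by ext; simp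
  rwa [he] at this

/-- If `ν + δ` is a rearrangement of `α + δ`, where `α` is a rearrangement of `μ` and `δ` is the
staircase, then `ν ≤ μ`. -/
theorem dominated_of_stair {μ ν : Weight N} (σ τ : Equiv.Perm (Fin N))
    (h : ν.1 + stair N = (μ.1 ∘ σ + stair N) ∘ τ) : Dominated ν μ := by
  have hi : ∀ i, ν.1 i = μ.1 ((τ.trans σ) i) + (stair N (τ i) - stair N i) := fun i => by
    have := congrFun h i
    simp only [Pi.add_apply, Function.comp_apply] at this
    simp only [Equiv.trans_apply]; omega
  constructor
  · simp_rw [hi]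
    rw [Finset.sum_add_distrib, Finset.sum_sub_distrib, Equiv.sum_comp (τ.trans σ) μ.1,
      Equiv.sum_comp τ (stair N)]
    ring
  · intro r
    simp_rw [hi]
    rw [Finset.sum_add_distrib, Finset.sum_sub_distrib]
    have h1 := sum_Iic_perm_le μ.2 (τ.trans σ) r
    have h2 := sum_Iic_perm_le (stair_antitone (N := N)) τ r
    linarith

/-- The case of equality in `dominated_of_stair`. Comparing norms gives
`∑ δ_i μ_{σ i} = ∑ δ_i μ_i`, and the rearrangement inequality for the strictly decreasing `δ` is
strict unless `μ ∘ σ` is decreasing. -/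
theorem comp_eq_of_stair {μ : Weight N} (σ τ : Equiv.Perm (Fin N))
    (h : μ.1 + stair N = (μ.1 ∘ σ + stair N) ∘ τ) : μ.1 ∘ σ = μ.1 := by
  have hsq : ∑ i, (μ.1 i + stair N i) ^ 2 = ∑ i, (μ.1 (σ i) + stair N i) ^ 2 := by
    rw [← Equiv.sum_comp τ (fun i => (μ.1 (σ i) + stair N i) ^ 2)]
    exact Finset.sum_congr rfl fun i _ => by rw [← Pi.add_apply, h]; rfl
  have hs : ∑ i, stair N i * μ.1 (σ i) = ∑ i, stair N i * μ.1 i := by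
    simp only [add_sq, Finset.sum_add_distrib] at hsq
    rw [Equiv.sum_comp σ (fun i => μ.1 i ^ 2)] at hsq
    have h1 : ∀ g : Fin N → ℤ, ∑ i, 2 * g i * stair N i = 2 * ∑ i, stair N i * g i := fun g => by
      rw [Finset.mul_sum]; exact Finset.sum_congr rfl fun i _ => by ring
    rw [h1 μ.1, h1 (fun i => μ.1 (σ i))] at hsq
    linarith
  have hm : Monovary (stair N) μ.1 := by
    intro i j hij
    refine stair_antitone ?_
    by_contra h
    exact absurd (μ.2 (not_le.1 h).le) (not_le.2 hij)
  have hm' := (hm.sum_mul_comp_perm_eq_sum_mul_iff (σ := σ)).1 hs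
  have ha : Antitone (μ.1 ∘ σ) := by
    intro i j hij
    by_contra h
    have h2 := hm' (not_le.1 h)
    have : (i : ℕ) ≤ j := hij
    simp only [stair] at h2
    have : i = j := Fin.ext (by omega)
    subst this
    exact h le_rfl
  have := Tuple.unique_antitone (σ := σ) (τ := 1) ha (by simpa using μ.2)
  simpa using this

end

/-! ### Symmetric and alternating Laurent polynomials -/

section
variable {F : Type*} [Field F] {N : ℕ}

theorem laurent_ext {f g : Laurent F N} (h : ∀ α, f.coeff α = g.coeff α) : f = g :=
  AddMonoidAlgebra.coeff_injective (Finsupp.ext h)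

/-- The rearrangements of a weight. -/
def orbit (lam : Weight N) : Finset (Fin N → ℤ) :=
  Finset.univ.image (fun σ : Equiv.Perm (Fin N) => lam.1 ∘ σ)

theorem mem_orbit {lam : Weight N} {α : Fin N → ℤ} :
    α ∈ orbit lam ↔ ∃ σ : Equiv.Perm (Fin N), lam.1 ∘ σ = α := by
  simp [orbit]

theorem self_mem_orbit (lam : Weight N) : lam.1 ∈ orbit lam := mem_orbit.2 ⟨1, by simp⟩

theorem sum_orbit_comp {M : Type*} [AddCommMonoid M] (lam : Weight N) (g : (Fin N → ℤ) → M)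
    (τ : Equiv.Perm (Fin N)) : ∑ α ∈ orbit lam, g (α ∘ τ) = ∑ α ∈ orbit lam, g α := by
  refine Finset.sum_bij' (fun α _ => α ∘ τ) (fun α _ => α ∘ τ.symm) ?_ ?_ ?_ ?_ ?_
  · intro α hα
    obtain ⟨σ, rfl⟩ := mem_orbit.1 hα
    exact mem_orbit.2 ⟨τ.trans σ, by funext i; simp⟩
  · intro α hα
    obtain ⟨σ, rfl⟩ := mem_orbit.1 hα
    exact mem_orbit.2 ⟨τ.symm.trans σ, by funext i; simp⟩
  · intro α _; funext i; simp
  · intro α _; funext i; simp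
  · intro α _; rfl

theorem monomialSymm_eq (lam : Weight N) :
    monomialSymm F lam = ∑ α ∈ orbit lam, AddMonoidAlgebra.single α 1 := rfl

theorem coeff_sum' {ι : Type*} (s : Finset ι) (f : ι → Laurent F N) (α : Fin N → ℤ) :
    (∑ i ∈ s, f i).coeff α = ∑ i ∈ s, (f i).coeff α := by
  rw [AddMonoidAlgebra.coeff_sum, Finsupp.finsetSum_apply]

theorem coeff_monomialSymm (lam : Weight N) (α : Fin N → ℤ) :
    (monomialSymm F lam).coeff α = if α ∈ orbit lam then 1 else 0 := by
  rw [monomialSymm_eq, coeff_sum']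
  simp [Finsupp.single_apply]

theorem comp_mem_orbit {lam : Weight N} {α : Fin N → ℤ} (σ : Equiv.Perm (Fin N)) :
    α ∘ σ ∈ orbit lam ↔ α ∈ orbit lam := by
  constructor
  · intro h
    obtain ⟨τ, hτ⟩ := mem_orbit.1 h
    refine mem_orbit.2 ⟨σ.symm.trans τ, ?_⟩
    funext i
    have := congrFun hτ (σ.symm i)
    simpa using this
  · intro h
    obtain ⟨τ, rfl⟩ := mem_orbit.1 h
    exact mem_orbit.2 ⟨σ.trans τ, by funext i; simp⟩

theorem monomialSymm_mem (lam : Weight N) : monomialSymm F lam ∈ symLaurent F N := by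
  intro σ α
  simp only [coeff_monomialSymm, comp_mem_orbit]

theorem weight_mem_orbit {lam μ : Weight N} : μ.1 ∈ orbit lam ↔ μ = lam := by
  constructor
  · intro h
    obtain ⟨σ, hσ⟩ := mem_orbit.1 h
    have := Tuple.unique_antitone (f := lam.1) (σ := σ) (τ := 1) (by rw [hσ]; exact μ.2)
      (by simpa using lam.2)
    refine Subtype.ext ?_
    rw [← hσ, this]; simp
  · rintro rfl; exact self_mem_orbit _

theorem coeff_monomialSymm_weight (lam μ : Weight N) :
    (monomialSymm F lam).coeff μ.1 = if μ = lam then 1 else 0 := by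
  rw [coeff_monomialSymm]; simp only [weight_mem_orbit]

/-- A symmetric Laurent polynomial is determined by its coefficients at dominant weights. -/
theorem symLaurent_ext {f g : Laurent F N} (hf : f ∈ symLaurent F N) (hg : g ∈ symLaurent F N)
    (h : ∀ μ : Weight N, f.coeff μ.1 = g.coeff μ.1) : f = g := by
  refine laurent_ext fun α => ?_
  obtain ⟨σ, hσ⟩ := exists_perm_antitone α
  rw [← hf σ α, ← hg σ α]
  exact h ⟨α ∘ σ, hσ⟩

theorem finsupp_sum_mem (a : Weight N →₀ F) :
    a.sum (fun μ c => c • monomialSymm F μ) ∈ symLaurent F N :=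
  Submodule.sum_mem _ fun μ _ => Submodule.smul_mem _ _ (monomialSymm_mem μ)

theorem coeff_finsupp_sum (a : Weight N →₀ F) (ν : Weight N) :
    (a.sum (fun μ c => c • monomialSymm F μ)).coeff ν.1 = a ν := by
  rw [Finsupp.sum, coeff_sum']
  simp only [AddMonoidAlgebra.coeff_smul_apply, coeff_monomialSymm_weight, smul_eq_mul, mul_ite,
    mul_one, mul_zero, Finset.sum_ite_eq, Finsupp.mem_support_iff]
  by_cases h : a ν = 0 <;> simp [h]

/-- The coefficients of a Laurent polynomial at dominant weights. -/
noncomputable def dominantCoeff (f : Laurent F N) : Weight N →₀ F :=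
  Finsupp.subtypeDomain (fun α : Fin N → ℤ => Antitone α) f.coeff

theorem dominantCoeff_apply (f : Laurent F N) (μ : Weight N) : dominantCoeff f μ = f.coeff μ.1 :=
  rfl

theorem sum_dominantCoeff {f : Laurent F N} (hf : f ∈ symLaurent F N) :
    (dominantCoeff f).sum (fun μ c => c • monomialSymm F μ) = f :=
  symLaurent_ext (finsupp_sum_mem _) hf fun μ => by rw [coeff_finsupp_sum]; rfl

/-- The symmetric Laurent polynomials that are combinations of the `m_ν` with `ν < λ`. -/
def lowerSub (F : Type*) [Field F] {N : ℕ} (lam : Weight N) : Submodule F (Laurent F N) where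
  carrier := {f | f ∈ symLaurent F N ∧ ∀ ν : Weight N, f.coeff ν.1 ≠ 0 → Below ν lam}
  zero_mem' := ⟨Submodule.zero_mem _, fun ν h => absurd rfl h⟩
  add_mem' := fun {f g} hf hg => ⟨Submodule.add_mem _ hf.1 hg.1, fun ν h => by
    by_cases h1 : f.coeff ν.1 = 0
    · refine hg.2 ν fun h2 => h ?_
      rw [AddMonoidAlgebra.coeff_add, Finsupp.add_apply, h1, h2, add_zero]
    · exact hf.2 ν h1⟩
  smul_mem' := fun c f hf => ⟨Submodule.smul_mem _ _ hf.1, fun ν h => hf.2 ν fun h2 => h (by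
    rw [AddMonoidAlgebra.coeff_smul_apply, h2, smul_zero])⟩

theorem mem_lowerSub_of_below {ν lam : Weight N} (h : Below ν lam) {f : Laurent F N}
    (hf : f - monomialSymm F ν ∈ lowerSub F ν) : f ∈ lowerSub F lam := by
  have hs : f ∈ symLaurent F N := by
    have := Submodule.add_mem _ hf.1 (monomialSymm_mem (F := F) ν)
    rwa [sub_add_cancel] at this
  refine ⟨hs, fun ρ hρ => ?_⟩
  by_cases hr : ρ = ν
  · rw [hr]; exact h
  · refine (hf.2 ρ ?_).trans_dominated h.1
    rw [AddMonoidAlgebra.coeff_sub, Finsupp.sub_apply, coeff_monomialSymm_weight, if_neg hr,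
      sub_zero]
    exact hρ

/-- The alternating sum of the monomials `X^{β ∘ σ}`. -/
noncomputable def alt (F : Type*) [Field F] {N : ℕ} (β : Fin N → ℤ) : Laurent F N :=
  ∑ σ : Equiv.Perm (Fin N), AddMonoidAlgebra.single (β ∘ σ) ((Equiv.Perm.sign σ : ℤ) : F)

theorem alt_comp (β : Fin N → ℤ) (τ : Equiv.Perm (Fin N)) :
    alt F (β ∘ τ) = ((Equiv.Perm.sign τ : ℤ) : F) • alt F β := by
  rw [alt, alt, Finset.smul_sum, ← Equiv.sum_comp (Equiv.mulLeft τ)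
    (fun σ => ((Equiv.Perm.sign τ : ℤ) : F) •
      AddMonoidAlgebra.single (β ∘ σ) ((Equiv.Perm.sign σ : ℤ) : F))]
  refine Finset.sum_congr rfl fun σ _ => ?_
  rw [AddMonoidAlgebra.smul_single, smul_eq_mul, Equiv.coe_mulLeft, Equiv.Perm.sign_mul,
    Units.val_mul, Int.cast_mul, ← mul_assoc, ← Int.cast_mul]
  have : ((Equiv.Perm.sign τ : ℤ)) * (Equiv.Perm.sign τ : ℤ) = 1 := by
    rw [← Units.val_mul, Int.units_mul_self, Units.val_one]
  rw [this, Int.cast_one, one_mul]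
  rfl

theorem alt_eq_zero [CharZero F] {β : Fin N → ℤ} (h : ¬ Function.Injective β) : alt F β = 0 := by
  obtain ⟨i, j, hij, hne⟩ : ∃ i j, β i = β j ∧ i ≠ j := by
    simpa [Function.Injective] using h
  have h1 : β ∘ Equiv.swap i j = β := by
    funext k
    simp only [Function.comp_apply, Equiv.swap_apply_def]
    split_ifs with h1 h2
    · rw [h1, hij]
    · rw [h2, hij]
    · rfl
  have h2 := alt_comp (F := F) β (Equiv.swap i j)
  rw [h1, Equiv.Perm.sign_swap hne] at h2
  have h3 : (2 : F) • alt F β = 0 := by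
    rw [two_smul]; nth_rewrite 1 [h2]; simp
  exact (smul_eq_zero.1 h3).resolve_left two_ne_zero

theorem alt_mul_monomialSymm (β : Fin N → ℤ) (lam : Weight N) :
    alt F β * monomialSymm F lam = ∑ α ∈ orbit lam, alt F (β + α) := by
  simp only [alt]
  rw [Finset.sum_comm, Finset.sum_mul]
  refine Finset.sum_congr rfl fun σ _ => ?_
  rw [monomialSymm_eq, ← sum_orbit_comp lam _ σ, Finset.mul_sum]
  refine Finset.sum_congr rfl fun α _ => ?_
  rw [AddMonoidAlgebra.single_mul_single, mul_one]
  rfl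

/-- Straightening of an alternant: `alt (δ + α)` vanishes if `δ + α` has equal entries, and is
otherwise up to sign `alt (δ + ν)`, where `δ + ν` is the decreasing rearrangement. -/
theorem alt_stair_add_eq [CharZero F] {μ : Weight N} {α : Fin N → ℤ} (hα : α ∈ orbit μ)
    (hne : α ≠ μ.1) : alt F (stair N + α) = 0 ∨ ∃ ν : Weight N, Below ν μ ∧
      ∃ c : F, alt F (stair N + α) = c • alt F (stair N + ν.1) := by
  obtain ⟨σ, rfl⟩ := mem_orbit.1 hα
  by_cases hinj : Function.Injective (stair N + μ.1 ∘ σ)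
  · obtain ⟨τ, hτ⟩ := exists_perm_antitone (stair N + μ.1 ∘ σ)
    set ν : Weight N := ⟨(stair N + μ.1 ∘ σ) ∘ τ - stair N,
      sub_stair_antitone hτ (hinj.comp τ.injective)⟩ with hν
    have hν' : ν.1 + stair N = (μ.1 ∘ σ + stair N) ∘ τ := by
      rw [hν, sub_add_cancel, add_comm]
    refine Or.inr ⟨ν, ⟨dominated_of_stair σ τ hν', fun he => hne ?_⟩,
      ((Equiv.Perm.sign τ : ℤ) : F), ?_⟩
    · rw [he] at hν'
      exact comp_eq_of_stair σ τ hν'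
    · rw [add_comm (stair N) ν.1, hν', alt_comp, smul_smul, ← Int.cast_mul,
        ← Units.val_mul, Int.units_mul_self, Units.val_one, Int.cast_one, one_smul, add_comm]
  · exact Or.inl (alt_eq_zero hinj)

/-- The alternant `alt (δ + μ)` is the product of `alt δ` and a symmetric Laurent polynomial with
leading term `m_μ` (a Schur polynomial). -/
theorem exists_alt_quotient [CharZero F] (μ : Weight N) :
    ∃ h : Laurent F N, h - monomialSymm F μ ∈ lowerSub F μ ∧
      alt F (stair N) * h = alt F (stair N + μ.1) := by
  induction hn : (normSq μ).toNat using Nat.strong_induction_on generalizing μ with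
  | _ n ih =>
    have key : ∀ α ∈ (orbit μ).erase μ.1, ∃ g ∈ lowerSub F μ,
        alt F (stair N) * g = alt F (stair N + α) := by
      intro α hα
      rw [Finset.mem_erase] at hα
      rcases alt_stair_add_eq (F := F) hα.2 hα.1 with h0 | ⟨ν, hb, c, hc⟩
      · exact ⟨0, Submodule.zero_mem _, by rw [h0, mul_zero]⟩
      · have hlt := hb.normSq_lt
        have hnn := normSq_nonneg ν
        obtain ⟨h, h1, h2⟩ := ih (normSq ν).toNat (by omega) ν rfl
        exact ⟨c • h, Submodule.smul_mem _ _ (mem_lowerSub_of_below hb h1),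
          by rw [mul_smul_comm, h2, hc]⟩
    choose! g hg1 hg2 using key
    refine ⟨monomialSymm F μ - ∑ α ∈ (orbit μ).erase μ.1, g α, ?_, ?_⟩
    · rw [sub_sub_cancel_left]
      exact Submodule.neg_mem _ (Submodule.sum_mem _ hg1)
    · rw [mul_sub, alt_mul_monomialSymm, Finset.mul_sum, Finset.sum_congr rfl hg2,
        ← Finset.add_sum_erase _ _ (self_mem_orbit μ), add_sub_cancel_right]

theorem exists_alt_quotient_of_ne [CharZero F] {μ : Weight N} {α : Fin N → ℤ} (hα : α ∈ orbit μ)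
    (hne : α ≠ μ.1) : ∃ g ∈ lowerSub F μ, alt F (stair N) * g = alt F (stair N + α) := by
  rcases alt_stair_add_eq (F := F) hα hne with h0 | ⟨ν, hb, c, hc⟩
  · exact ⟨0, Submodule.zero_mem _, by rw [h0, mul_zero]⟩
  · obtain ⟨h, h1, h2⟩ := exists_alt_quotient (F := F) ν
    exact ⟨c • h, Submodule.smul_mem _ _ (mem_lowerSub_of_below hb h1),
      by rw [mul_smul_comm, h2, hc]⟩

end

/-! ### Triangularity of the Macdonald operators -/

/-- Multiplied by the Vandermonde product, the coefficient `A_I` becomes up to a power of `t^{1/2}`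
the Vandermonde product in which the `X_i`, `i ∈ I`, are multiplied by `t`. -/
theorem DifferenceField.A_mul_vandermonde {K : Type*} [Field K] {N : ℕ} (R : DifferenceField K N)
    (I : Finset (Fin N)) :
    R.s ^ ((I.card : ℤ) * ((N : ℤ) - 1)) *
        (R.A I * ∏ i, ∏ j ∈ Finset.Ioi i, (R.X j - R.X i)) =
      ∏ i, ∏ j ∈ Finset.Ioi i, ((if j ∈ I then R.s ^ 2 * R.X j else R.X j) -
        (if i ∈ I then R.s ^ 2 * R.X i else R.X i)) := by
  have hs := R.s_ne_zero
  -- `θ a b` is the contribution of the ordered pair `(a, b)` to `s ^ (|I| (N - 1)) A_I`.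
  set θ : Fin N → Fin N → K := fun a b =>
    if a ∈ I then R.s * (if b ∈ I then 1 else R.f (R.X a) (R.X b)) else 1 with hθ
  have h1 : ∀ i j, i ≠ j → (if j ∈ I then R.s ^ 2 * R.X j else R.X j) -
        (if i ∈ I then R.s ^ 2 * R.X i else R.X i) = (R.X j - R.X i) * (θ i j * θ j i) := by
    intro i j hij
    have hx : R.X j - R.X i ≠ 0 := sub_ne_zero.2 fun h => hij (R.X_injective h).symm
    have hx' : R.X i - R.X j ≠ 0 := sub_ne_zero.2 fun h => hij (R.X_injective h)
    simp only [hθ, DifferenceField.f]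
    split_ifs with hj hi hi
    · ring
    · field_simp
    · field_simp; ring
    · ring
  have h2 : ∏ i, ∏ j ∈ Finset.Ioi i, ((if j ∈ I then R.s ^ 2 * R.X j else R.X j) -
        (if i ∈ I then R.s ^ 2 * R.X i else R.X i)) =
      (∏ i, ∏ j ∈ Finset.Ioi i, (R.X j - R.X i)) * ∏ i, ∏ j ∈ {i}ᶜ, θ i j := by
    rw [← Finset.prod_prod_Ioi_mul_eq_prod_prod_off_diag (fun j i => θ i j),
      ← Finset.prod_mul_distrib]
    refine Finset.prod_congr rfl fun i _ => ?_
    rw [← Finset.prod_mul_distrib]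
    refine Finset.prod_congr rfl fun j hj => ?_
    rw [h1 i j (ne_of_lt (Finset.mem_Ioi.1 hj))]
  have h3 : ∏ i, ∏ j ∈ {i}ᶜ, θ i j = R.s ^ ((I.card : ℤ) * ((N : ℤ) - 1)) * R.A I := by
    have h4 : ∀ i, ∏ j ∈ {i}ᶜ, θ i j = if i ∈ I then
        R.s ^ ((N : ℤ) - 1) * ∏ j ∈ Iᶜ, R.f (R.X i) (R.X j) else 1 := by
      intro i
      split_ifs with hi
      · simp only [hθ, if_pos hi]
        rw [Finset.prod_mul_distrib, Finset.prod_const, Finset.card_compl, Finset.card_singleton,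
          Fintype.card_fin, ← zpow_natCast, Nat.cast_sub (Nat.one_le_of_lt i.2), Nat.cast_one]
        congr 1
        rw [← Finset.prod_subset (s₁ := Iᶜ)]
        · refine Finset.prod_congr rfl fun j hj => ?_
          rw [if_neg (Finset.mem_compl.1 hj)]
        · intro j hj
          rw [Finset.mem_compl, Finset.mem_singleton]
          rintro rfl
          exact Finset.mem_compl.1 hj hi
        · intro j _ hj
          rw [Finset.mem_compl, not_not] at hj
          rw [if_pos hj]
      · simp only [hθ, if_neg hi, Finset.prod_const_one]
    simp_rw [h4]
    rw [Finset.prod_ite_mem, Finset.univ_inter, Finset.prod_mul_distrib, Finset.prod_const,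
      ← zpow_natCast, ← zpow_mul, mul_comm ((N : ℤ) - 1), DifferenceField.A]
  rw [h2, h3]
  ring

section
variable {F : Type*} [Field F] {N : ℕ} {q s : F}

/-- The Vandermonde product `∏_{i < j} (X_j - X_i)`. -/
noncomputable def vand (F : Type*) [Field F] (N : ℕ) : Laurent F N :=
  ∏ i, ∏ j ∈ Finset.Ioi i, (varX F j - varX F i)

theorem vand_ne_zero : vand F N ≠ 0 := by
  rw [vand, Finset.prod_ne_zero_iff]
  intro i _
  rw [Finset.prod_ne_zero_iff]
  intro j hj
  exact sub_ne_zero.2 fun h => (ne_of_gt (Finset.mem_Ioi.1 hj)) (varX_injective h)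

theorem prod_varX_pow (σ : Equiv.Perm (Fin N)) :
    ∏ i, varX F (σ i) ^ (i : ℕ) =
      AddMonoidAlgebra.single (fun i => ((σ⁻¹ i : Fin N) : ℤ)) 1 := by
  simp only [varX, AddMonoidAlgebra.single_pow, one_pow]
  rw [AddMonoidAlgebra.prod_single, Finset.prod_const_one]
  congr 1
  funext j
  rw [Finset.sum_apply, Finset.sum_eq_single (σ⁻¹ j)]
  · simp
  · intro b _ hb
    have : j ≠ σ b := by rintro rfl; simp at hb
    simp [this]
  · simp

theorem vand_eq_alt : vand F N = alt F (fun i : Fin N => ((i : ℕ) : ℤ)) := by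
  rw [vand, ← Matrix.det_vandermonde, Matrix.det_apply, alt,
    ← Equiv.sum_comp (Equiv.inv (Equiv.Perm (Fin N)))]
  refine Finset.sum_congr rfl fun σ _ => ?_
  simp only [Matrix.vandermonde_apply, Equiv.inv_apply]
  rw [prod_varX_pow, inv_inv, Equiv.Perm.sign_inv, Units.smul_def, ← Int.cast_smul_eq_zsmul F,
    AddMonoidAlgebra.smul_single, smul_eq_mul, mul_one]
  rfl

theorem exists_alt_stair_eq : ∃ ε : F, ε ≠ 0 ∧ alt F (stair N) = ε • vand F N := by
  refine ⟨((Equiv.Perm.sign (Fin.revPerm : Equiv.Perm (Fin N)) : ℤ) : F), ?_, ?_⟩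
  · rcases Int.units_eq_one_or (Equiv.Perm.sign (Fin.revPerm : Equiv.Perm (Fin N))) with h | h <;>
      simp [h]
  · rw [vand_eq_alt, ← alt_comp]
    congr 1
    funext i
    simp only [stair, Function.comp_apply, Fin.revPerm_apply, Fin.val_rev]
    omega

/-- The numerator of `D_N^{(k)} f` over the Vandermonde denominator, up to a power of `s`. -/
noncomputable def clearedD (q s : F) (W : Laurent F N) (k : ℕ) (f : Laurent F N) : Laurent F N :=
  ∑ I ∈ (Finset.univ : Finset (Fin N)).powersetCard k, qShift (s ^ 2) I W * qShift q I f

theorem toRat_vand_mul_macdonaldD (h : IsGeneric q s) (k : ℕ) (f : Laurent F N) :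
    algebraMap F (RatFrac F N) (s ^ ((k : ℤ) * ((N : ℤ) - 1))) *
      (toRat F N (vand F N) * macdonaldD N q s k f) = toRat F N (clearedD q s (vand F N) k f) := by
  rw [macdonaldD_eq h, DifferenceField.D, clearedD, map_sum, Finset.mul_sum, Finset.mul_sum]
  refine Finset.sum_congr rfl fun I hI => ?_
  have hc := (Finset.mem_powersetCard.1 hI).2
  have h1 := (ratDifferenceField h N).A_mul_vandermonde I
  have h2 : ∏ i, ∏ j ∈ Finset.Ioi i, ((ratDifferenceField h N).X j - (ratDifferenceField h N).X i) =
      toRat F N (vand F N) := by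
    simp only [vand, map_prod, map_sub]; rfl
  have h3 : toRat F N (qShift (s ^ 2) I (vand F N)) = ∏ i, ∏ j ∈ Finset.Ioi i,
      ((if j ∈ I then (ratDifferenceField h N).s ^ 2 * (ratDifferenceField h N).X j else
        (ratDifferenceField h N).X j) - (if i ∈ I then
        (ratDifferenceField h N).s ^ 2 * (ratDifferenceField h N).X i else
        (ratDifferenceField h N).X i)) := by
    have := qShift_eq_scaleHom (Units.mk0 (s ^ 2) (pow_ne_zero 2 h.s_ne_zero)) I (vand F N)
    rw [Units.val_mk0] at this
    rw [this]
    simp only [vand, map_prod, map_sub, scaleHom_varX, unitsOn, toRat_smul]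
    refine Finset.prod_congr rfl fun i _ => Finset.prod_congr rfl fun j _ => ?_
    congr 1 <;> split_ifs <;> simp <;> rfl
  rw [hc, h2] at h1
  rw [map_mul, h3, ← h1, map_zpow₀]
  have h4 : (ratDifferenceField h N).τ I (toRat F N f) = toRat F N (qShift q I f) := by
    change scaleFrac _ _ = _
    rw [scaleFrac_toRat, ← qShift_eq_scaleHom, Units.val_mk0]
  rw [h4]
  change _ = (algebraMap F (RatFrac F N) s) ^ _ * _ * _
  ring

/-- The eigenvalue equation with denominators cleared. -/
theorem macdonaldD_eq_iff (h : IsGeneric q s) (k : ℕ) (f g : Laurent F N) :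
    macdonaldD N q s k f = toRat F N g ↔
      clearedD q s (vand F N) k f = s ^ ((k : ℤ) * ((N : ℤ) - 1)) • (vand F N * g) := by
  rw [← (toRat_injective (F := F) (N := N)).eq_iff, ← toRat_vand_mul_macdonaldD h, toRat_smul,
    map_mul]
  have h1 : algebraMap F (RatFrac F N) (s ^ ((k : ℤ) * ((N : ℤ) - 1))) ≠ 0 := by
    rw [Ne, FaithfulSMul.algebraMap_eq_zero_iff]; exact zpow_ne_zero _ h.s_ne_zero
  have h2 : toRat F N (vand F N) ≠ 0 := by
    rw [Ne, FaithfulSMul.algebraMap_eq_zero_iff]; exact vand_ne_zero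
  rw [mul_right_inj' h1, mul_right_inj' h2]

theorem macdonaldD_eq_iff_alt (h : IsGeneric q s) (k : ℕ) (f g : Laurent F N) :
    macdonaldD N q s k f = toRat F N g ↔ clearedD q s (alt F (stair N)) k f =
      s ^ ((k : ℤ) * ((N : ℤ) - 1)) • (alt F (stair N) * g) := by
  obtain ⟨ε, hε, he⟩ := exists_alt_stair_eq (F := F) (N := N)
  rw [macdonaldD_eq_iff h, he]
  have : clearedD q s (ε • vand F N) k f = ε • clearedD q s (vand F N) k f := by
    simp only [clearedD, map_smul, smul_mul_assoc, Finset.smul_sum]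
  rw [this, smul_mul_assoc, smul_comm, (smul_right_injective _ hε).eq_iff]

/-- The value `e_k(t^ρ q^α)` for an arbitrary exponent `α`. -/
noncomputable def eig (q s : F) (k : ℕ) (α : Fin N → ℤ) : F :=
  ∑ I ∈ (Finset.univ : Finset (Fin N)).powersetCard k,
    ∏ i ∈ I, s ^ ((N : ℤ) - 1 - 2 * ((i : ℕ) : ℤ)) * q ^ α i

theorem prod_zpow_sum {x : F} (hx : x ≠ 0) {ι : Type*} (I : Finset ι) (α : ι → ℤ) :
    ∏ i ∈ I, x ^ α i = x ^ (∑ i ∈ I, α i) := by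
  classical
  induction I using Finset.induction_on with
  | empty => simp
  | insert a t ha ih => rw [Finset.prod_insert ha, Finset.sum_insert ha, zpow_add₀ hx, ih]

theorem sum_zpow_eq_eig (h : IsGeneric q s) (k : ℕ) (α : Fin N → ℤ) :
    ∑ I ∈ (Finset.univ : Finset (Fin N)).powersetCard k,
      (s ^ 2) ^ (∑ i ∈ I, stair N i) * q ^ (∑ i ∈ I, α i) =
    s ^ ((k : ℤ) * ((N : ℤ) - 1)) * eig q s k α := by
  rw [eig, Finset.mul_sum]
  refine Finset.sum_congr rfl fun I hI => ?_
  have hc := (Finset.mem_powersetCard.1 hI).2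
  rw [Finset.prod_mul_distrib, prod_zpow_sum h.q_ne_zero, prod_zpow_sum h.s_ne_zero, ← mul_assoc,
    ← zpow_add₀ h.s_ne_zero, ← zpow_natCast s 2, ← zpow_mul]
  congr 2
  have hN : (k : ℤ) * ((N : ℤ) - 1) = ∑ i ∈ I, ((N : ℤ) - 1) := by
    rw [Finset.sum_const, hc, nsmul_eq_mul]
  rw [hN, ← Finset.sum_add_distrib, Finset.mul_sum]
  refine Finset.sum_congr rfl fun i _ => ?_
  simp only [stair]; push_cast; ring

/-- The Macdonald operators map `m_λ = ∑ X^α` to the combination of the quotients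
`alt (δ + α) / alt δ` with the coefficients `e_k(t^ρ q^α)`. -/
theorem clearedD_monomialSymm (h : IsGeneric q s) (k : ℕ) (lam : Weight N) :
    clearedD q s (alt F (stair N)) k (monomialSymm F lam) =
      s ^ ((k : ℤ) * ((N : ℤ) - 1)) •
        ∑ α ∈ orbit lam, eig q s k α • alt F (stair N + α) := by
  have h1 : ∀ I : Finset (Fin N), qShift (s ^ 2) I (alt F (stair N)) *
      qShift q I (monomialSymm F lam) = ∑ σ : Equiv.Perm (Fin N), ∑ α ∈ orbit lam,
        AddMonoidAlgebra.single ((stair N + α) ∘ σ) (((Equiv.Perm.sign σ : ℤ) : F) *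
          ((s ^ 2) ^ (∑ i ∈ I, stair N (σ i)) * q ^ (∑ i ∈ I, α (σ i)))) := by
    intro I
    rw [alt, map_sum, Finset.sum_mul]
    refine Finset.sum_congr rfl fun σ _ => ?_
    rw [monomialSymm_eq, ← sum_orbit_comp lam _ σ, map_sum, Finset.mul_sum]
    refine Finset.sum_congr rfl fun α _ => ?_
    rw [qShift_single, qShift_single, AddMonoidAlgebra.single_mul_single, one_mul, mul_assoc]
    rfl
  have h2 : ∀ (σ : Equiv.Perm (Fin N)) (α : Fin N → ℤ),
      ∑ I ∈ (Finset.univ : Finset (Fin N)).powersetCard k,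
        (s ^ 2) ^ (∑ i ∈ I, stair N (σ i)) * q ^ (∑ i ∈ I, α (σ i)) =
      s ^ ((k : ℤ) * ((N : ℤ) - 1)) * eig q s k α := by
    intro σ α
    rw [← sum_zpow_eq_eig h]
    refine Finset.sum_bij' (fun I _ => I.map σ.toEmbedding) (fun I _ => I.map σ.symm.toEmbedding)
      ?_ ?_ ?_ ?_ ?_
    · intro I hI; simpa using hI
    · intro I hI; simpa using hI
    · intro I _; ext; simp
    · intro I _; ext; simp
    · intro I _; simp
  rw [clearedD, Finset.sum_congr rfl fun I _ => h1 I, Finset.sum_comm, Finset.smul_sum]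
  simp_rw [alt, Finset.smul_sum]
  rw [Finset.sum_comm (s := orbit lam)]
  refine Finset.sum_congr rfl fun σ _ => ?_
  rw [Finset.sum_comm]
  refine Finset.sum_congr rfl fun α _ => ?_
  rw [smul_smul, AddMonoidAlgebra.smul_single, ← h2 σ α, smul_eq_mul, Finset.sum_mul]
  refine laurent_ext fun β => ?_
  rw [coeff_sum']
  simp only [AddMonoidAlgebra.coeff_single, Finsupp.single_apply]
  split_ifs
  · exact Finset.sum_congr rfl fun I _ => mul_comm _ _
  · exact Finset.sum_const_zero

/-- The Macdonald operators are triangular with respect to the dominance order: in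
`clearedD_monomialSymm` only `α = λ` contributes the leading term `m_λ`. -/
theorem exists_macdonaldD_monomialSymm [CharZero F] (h : IsGeneric q s) (k : ℕ) (lam : Weight N) :
    ∃ g ∈ lowerSub F lam, macdonaldD N q s k (monomialSymm F lam) =
      toRat F N (eig q s k lam.1 • monomialSymm F lam + g) := by
  have key : ∀ α ∈ (orbit lam).erase lam.1, ∃ g ∈ lowerSub F lam,
      alt F (stair N) * g = alt F (stair N + α) := fun α hα =>
    exists_alt_quotient_of_ne (Finset.mem_of_mem_erase hα) (Finset.ne_of_mem_erase hα)
  choose! g hg1 hg2 using key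
  obtain ⟨p, hp1, hp2⟩ := exists_alt_quotient (F := F) lam
  refine ⟨eig q s k lam.1 • (p - monomialSymm F lam) +
      ∑ α ∈ (orbit lam).erase lam.1, eig q s k α • g α, ?_, ?_⟩
  · exact Submodule.add_mem _ (Submodule.smul_mem _ _ hp1)
      (Submodule.sum_mem _ fun α hα => Submodule.smul_mem _ _ (hg1 α hα))
  · rw [macdonaldD_eq_iff_alt h, clearedD_monomialSymm h, ← add_assoc, ← smul_add,
      add_sub_cancel, mul_add, mul_smul_comm, hp2, Finset.mul_sum,
      ← Finset.add_sum_erase _ _ (self_mem_orbit lam)]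
    congr 2
    refine Finset.sum_congr rfl fun α hα => ?_
    rw [mul_smul_comm, hg2 α hα]

end

/-! ### Elementary symmetric functions and a spectral decomposition -/

section
variable {F : Type*} [Field F]

/-- The `k`-th elementary symmetric function of the `w i`, `i ∈ A`. -/
def esym {ι : Type*} (A : Finset ι) (w : ι → F) (k : ℕ) : F :=
  ∑ I ∈ A.powersetCard k, ∏ i ∈ I, w i

theorem esym_zero {ι : Type*} (A : Finset ι) (w : ι → F) : esym A w 0 = 1 := by
  simp [esym]

theorem esym_eq_zero {ι : Type*} (A : Finset ι) (w : ι → F) {k : ℕ} (hk : A.card < k) :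
    esym A w k = 0 := by
  rw [esym, Finset.powersetCard_eq_empty.2 hk, Finset.sum_empty]

theorem esym_card {ι : Type*} (A : Finset ι) (w : ι → F) : esym A w A.card = ∏ i ∈ A, w i := by
  simp [esym]

theorem esym_congr {ι : Type*} (A : Finset ι) {w w' : ι → F} (h : ∀ i ∈ A, w i = w' i) (k : ℕ) :
    esym A w k = esym A w' k :=
  Finset.sum_congr rfl fun _ hI => Finset.prod_congr rfl fun i hi =>
    h i ((Finset.mem_powersetCard.1 hI).1 hi)

theorem sum_powersetCard_insert {ι M : Type*} [DecidableEq ι] [AddCommMonoid M] {A : Finset ι}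
    {j : ι} (hj : j ∉ A) (G : Finset ι → M) (k : ℕ) :
    ∑ I ∈ (insert j A).powersetCard (k + 1), G I =
      ∑ I ∈ A.powersetCard (k + 1), G I + ∑ I ∈ A.powersetCard k, G (insert j I) := by
  have hmem : ∀ {m I}, I ∈ A.powersetCard m → j ∉ I := fun hI h =>
    hj ((Finset.mem_powersetCard.1 hI).1 h)
  rw [Finset.powersetCard_succ_insert hj, Finset.sum_union, Finset.sum_image]
  · intro I hI I' hI' h
    rw [← Finset.erase_insert (hmem hI), h, Finset.erase_insert (hmem hI')]
  · rw [Finset.disjoint_left]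
    intro I hI hI'
    obtain ⟨I', _, rfl⟩ := Finset.mem_image.1 hI'
    exact hmem hI (Finset.mem_insert_self _ _)

theorem esym_insert {ι : Type*} [DecidableEq ι] {A : Finset ι} {j : ι} (hj : j ∉ A) (w : ι → F)
    (k : ℕ) : esym (insert j A) w (k + 1) = esym A w (k + 1) + w j * esym A w k := by
  rw [esym, sum_powersetCard_insert hj, esym, esym, Finset.mul_sum]
  congr 1
  refine Finset.sum_congr rfl fun I hI => ?_
  rw [Finset.prod_insert fun h => hj ((Finset.mem_powersetCard.1 hI).1 h)]

theorem esym_smul {ι : Type*} (A : Finset ι) (w : ι → F) (c : F) (k : ℕ) :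
    esym A (fun i => c * w i) k = c ^ k * esym A w k := by
  rw [esym, esym, Finset.mul_sum]
  refine Finset.sum_congr rfl fun I hI => ?_
  rw [Finset.prod_mul_distrib, Finset.prod_const, (Finset.mem_powersetCard.1 hI).2]

theorem prod_one_add_mul_eq {ι : Type*} (A : Finset ι) (w : ι → F) (x : F) :
    ∏ i ∈ A, (1 + x * w i) = ∑ k ∈ Finset.range (A.card + 1), x ^ k * esym A w k := by
  classical
  rw [Finset.prod_one_add, Finset.sum_powerset]
  exact Finset.sum_congr rfl fun k _ => esym_smul A w x k

/-- If two families of nonzero scalars have the same elementary symmetric functions, then every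
member of the first one occurs in the second one. -/
theorem exists_eq_of_esym_eq {ι : Type*} (A : Finset ι) (w w' : ι → F)
    (h : ∀ k, esym A w k = esym A w' k) {i : ι} (hi : i ∈ A) (hw : w i ≠ 0) :
    ∃ j ∈ A, w i = w' j := by
  have h1 : ∏ j ∈ A, (1 + -(w i)⁻¹ * w j) = 0 :=
    Finset.prod_eq_zero hi (by field_simp; ring)
  rw [prod_one_add_mul_eq] at h1
  simp_rw [h] at h1
  rw [← prod_one_add_mul_eq, Finset.prod_eq_zero_iff] at h1
  obtain ⟨j, hj, hj'⟩ := h1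
  refine ⟨j, hj, ?_⟩
  field_simp at hj'
  linear_combination hj'

/-- Multiplication of one variable by `q` in elementary symmetric functions. -/
theorem esym_update {N : ℕ} (w : Fin N → F) (q : F) (j : Fin N) (k : ℕ) :
    esym Finset.univ (Function.update w j (q * w j)) (k + 1) =
      esym Finset.univ w (k + 1) + q * esym Finset.univ w k * w j -
        w j * esym Finset.univ (Function.update w j (q * w j)) k := by
  have hj : j ∉ Finset.univ.erase j := Finset.notMem_erase _ _
  have hu : (Finset.univ : Finset (Fin N)) = insert j (Finset.univ.erase j) := by simp
  have hc : ∀ m, esym (Finset.univ.erase j) (Function.update w j (q * w j)) m =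
      esym (Finset.univ.erase j) w m := fun m =>
    esym_congr _ (fun i hi => Function.update_of_ne (Finset.ne_of_mem_erase hi) _ _) m
  rw [hu, esym_insert hj, esym_insert hj, Function.update_self, hc, hc]
  cases k with
  | zero => simp only [esym_zero]; ring
  | succ k =>
    rw [esym_insert hj, esym_insert hj, Function.update_self, hc, hc]
    ring

theorem aeval_apply_of_eigen {V : Type*} [AddCommGroup V] [Module F V] (S : Module.End F V) {v : V}
    {y : F} (h : S v = y • v) (g : Polynomial F) : Polynomial.aeval S g v = g.eval y • v := by
  induction g using Polynomial.induction_on' with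
  | add p r hp hr => rw [map_add, LinearMap.add_apply, hp, hr, Polynomial.eval_add, add_smul]
  | monomial n a =>
    rw [Polynomial.aeval_monomial, Polynomial.eval_monomial, Module.End.mul_apply,
      Module.algebraMap_end_apply, mul_smul]
    congr 1
    induction n with
    | zero => simp
    | succ n ih =>
      rw [pow_succ, Module.End.mul_apply, h, map_smul, ih, smul_smul, pow_succ, mul_comm]

/-- The polynomials in a normalization of `D_1` through which the operators `D_k` act on `E₀ p` in
`exists_joint_eigen_decomposition`. The recursion is that of `esym_update` with `w j` replaced by
the variable. -/
noncomputable def shiftPoly {N : ℕ} (w : Fin N → F) (q : F) : ℕ → Polynomial F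
  | 0 => 1
  | k + 1 => Polynomial.C (esym Finset.univ w (k + 1)) +
      Polynomial.C (q * esym Finset.univ w k) * Polynomial.X - Polynomial.X * shiftPoly w q k

theorem eval_shiftPoly {N : ℕ} (w : Fin N → F) (q : F) (j : Fin N) (k : ℕ) :
    (shiftPoly w q k).eval (w j) = esym Finset.univ (Function.update w j (q * w j)) k := by
  induction k with
  | zero => simp [shiftPoly, esym_zero]
  | succ k ih => rw [esym_update, ← ih]; simp [shiftPoly]

theorem eval_zero_shiftPoly {N : ℕ} (w : Fin N → F) (q : F) (k : ℕ) :
    (shiftPoly w q k).eval 0 = esym Finset.univ w k := by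
  cases k with
  | zero => simp [shiftPoly, esym_zero]
  | succ k => simp [shiftPoly]

theorem natDegree_shiftPoly_le {N : ℕ} (w : Fin N → F) (q : F) (k : ℕ) :
    (shiftPoly w q k).natDegree ≤ k := by
  induction k with
  | zero => simp [shiftPoly]
  | succ k ih =>
    rw [shiftPoly]
    refine (Polynomial.natDegree_sub_le _ _).trans (max_le ?_ ?_)
    · refine (Polynomial.natDegree_add_le _ _).trans (max_le (by simp) ?_)
      exact (Polynomial.natDegree_C_mul_le _ _).trans (Polynomial.natDegree_X_le.trans (by omega))
    · refine Polynomial.natDegree_mul_le.trans ?_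
      rw [Polynomial.natDegree_X]; omega

theorem coeff_shiftPoly {N : ℕ} (w : Fin N → F) (q : F) (k : ℕ) :
    (shiftPoly w q (k + 1)).coeff (k + 1) = (-1) ^ k * (q - 1) := by
  induction k with
  | zero => simp [shiftPoly, esym_zero]
  | succ k ih =>
    rw [shiftPoly, Polynomial.coeff_sub, Polynomial.coeff_X_mul, ih, Polynomial.coeff_add,
      Polynomial.coeff_C, Polynomial.coeff_C_mul, Polynomial.coeff_X]
    simp [pow_succ]

/-- The polynomial of degree `N + 1` vanishes at `0` and at all `w j`, because `e_{N + 1}`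
vanishes. -/
theorem shiftPoly_eq {N : ℕ} (w : Fin N → F) (q : F) (hw0 : ∀ i, w i ≠ 0)
    (hw : Function.Injective w) : shiftPoly w q (N + 1) =
      Polynomial.C ((-1) ^ N * (q - 1)) * (Polynomial.X * Lagrange.nodal Finset.univ w) := by
  set v : Option (Fin N) → F := fun o => o.elim 0 w with hv
  have hinj : Set.InjOn v (Finset.univ : Finset (Option (Fin N))) := by
    rintro (_ | i) _ (_ | j) _ h
    · rfl
    · exact absurd h.symm (hw0 j)
    · exact absurd h (hw0 i)
    · rw [hw h]
  have hnd : (Polynomial.X * Lagrange.nodal Finset.univ w).natDegree = N + 1 := by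
    rw [Polynomial.natDegree_X_mul Lagrange.nodal_ne_zero, Lagrange.natDegree_nodal]; simp
  have hmon : (Polynomial.X * Lagrange.nodal Finset.univ w).Monic :=
    Polynomial.monic_X.mul Lagrange.nodal_monic
  refine sub_eq_zero.1 (Polynomial.eq_zero_of_degree_lt_of_eval_index_eq_zero _ hinj ?_ ?_)
  · rw [Polynomial.degree_lt_iff_coeff_zero]
    intro m hm
    simp only [Finset.card_univ, Fintype.card_option, Fintype.card_fin] at hm
    rw [Polynomial.coeff_sub, Polynomial.coeff_C_mul]
    rcases hm.eq_or_lt with rfl | hlt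
    · rw [coeff_shiftPoly]
      have := hmon.coeff_natDegree
      rw [hnd] at this
      rw [this, mul_one, sub_self]
    · rw [Polynomial.coeff_eq_zero_of_natDegree_lt ((natDegree_shiftPoly_le w q _).trans_lt hlt),
        Polynomial.coeff_eq_zero_of_natDegree_lt (by rw [hnd]; exact hlt), mul_zero, sub_zero]
  · rintro (_ | j) _
    · rw [Polynomial.eval_sub]
      simp only [hv, Option.elim_none]
      rw [eval_zero_shiftPoly, esym_eq_zero _ _ (by simp)]
      simp
    · rw [Polynomial.eval_sub]
      simp only [hv, Option.elim_some]
      rw [eval_shiftPoly, esym_eq_zero _ _ (by simp), Polynomial.eval_mul, Polynomial.eval_mul,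
        Lagrange.eval_nodal_at_node (Finset.mem_univ j), mul_zero, mul_zero, sub_zero]

theorem X_sub_C_mul_basis {N : ℕ} (w : Fin N → F) (j : Fin N) :
    (Polynomial.X - Polynomial.C (w j)) * Lagrange.basis Finset.univ w j =
      Polynomial.C (Lagrange.nodalWeight Finset.univ w j) * Lagrange.nodal Finset.univ w := by
  rw [Lagrange.basis_eq_prod_sub_inv_mul_nodal_div (Finset.mem_univ j),
    ← Lagrange.nodal_erase_eq_nodal_div (Finset.mem_univ j), mul_left_comm,
    ← Lagrange.nodal_eq_mul_nodal_erase (Finset.mem_univ j)]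

/-- Let `D_k` be operators related to an operator `E₀` as the Macdonald operators are related to
multiplication by `∑ X_i`. If `p` is a joint eigenvector of the `D_k` with eigenvalues `e_k(w)`,
then `E₀ p` is a sum of joint eigenvectors for which one of the `w_j` is multiplied by `q`. -/
theorem exists_joint_eigen_decomposition {V : Type*} [AddCommGroup V] [Module F V] {N : ℕ}
    (D : ℕ → Module.End F V) (E₀ E₁ : Module.End F V) (q : F) (hq1 : q ≠ 1)
    (hcomm : ∀ k v, D 1 (D k v) = D k (D 1 v))
    (hE₁ : ∀ v, D 1 (E₀ v) = E₀ (D 1 v) + (q - 1) • E₁ v)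
    (hrel : ∀ k v, D (k + 1) (E₀ v) - E₀ (D (k + 1) v) = q • E₁ (D k v) - D k (E₁ v))
    (hD0 : ∀ v, D 0 v = v) (hDlast : ∀ v, D (N + 1) v = 0)
    (hDN : ∀ v, D N (E₀ v) = q • E₀ (D N v))
    (w : Fin N → F) (hw0 : ∀ i, w i ≠ 0) (hw : Function.Injective w)
    (p : V) (hp : ∀ k, D k p = esym Finset.univ w k • p) :
    ∃ v : Fin N → V, E₀ p = ∑ j, v j ∧
      ∀ j k, D k (v j) = esym Finset.univ (Function.update w j (q * w j)) k • v j := by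
  have hq1' : q - 1 ≠ 0 := sub_ne_zero.2 hq1
  -- `S` is normalized so that it takes the value `w j` where one `w j` is multiplied by `q`.
  set S : Module.End F V := (q - 1)⁻¹ • (D 1 - esym Finset.univ w 1 • 1) with hS
  set a := E₀ p with ha
  have hSapp : ∀ v, S v = (q - 1)⁻¹ • (D 1 v - esym Finset.univ w 1 • v) := fun v => rfl
  have hDS : ∀ k, Commute (D k) S := fun k => by
    refine LinearMap.ext fun v => ?_
    rw [Module.End.mul_apply, Module.End.mul_apply, hSapp, hSapp, map_smul, map_sub, map_smul,
      hcomm]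
  have hDP : ∀ k (g : Polynomial F) v,
      D k (Polynomial.aeval S g v) = Polynomial.aeval S g (D k v) := fun k g v => by
    induction g using Polynomial.induction_on' with
    | add p r hp hr => simp only [map_add, LinearMap.add_apply, hp, hr]
    | monomial n c =>
      have h1 : D k ((S ^ n) v) = (S ^ n) (D k v) := LinearMap.congr_fun ((hDS k).pow_right n) v
      rw [Polynomial.aeval_monomial, Module.End.mul_apply, Module.End.mul_apply,
        Module.algebraMap_end_apply, Module.algebraMap_end_apply, map_smul, h1]
  have hPP : ∀ (g g' : Polynomial F) v, Polynomial.aeval S g (Polynomial.aeval S g' v) =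
      Polynomial.aeval S (g * g') v := fun g g' v => by rw [map_mul, Module.End.mul_apply]
  have hE₁p : E₁ p = S a := by
    have := hE₁ p
    rw [hp 1, map_smul] at this
    rw [hSapp, ha, this, add_sub_cancel_left, smul_smul, inv_mul_cancel₀ hq1', one_smul]
  have hDa : ∀ k, D k a = Polynomial.aeval S (shiftPoly w q k) a := by
    intro k
    induction k with
    | zero => simp [shiftPoly, hD0]
    | succ k ih =>
      have h1 := hrel k p
      have h2 : D k (S a) = S (D k a) := LinearMap.congr_fun (hDS k) a
      rw [hp, hp, map_smul, map_smul, hE₁p, h2, ih, ← ha] at h1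
      rw [sub_eq_iff_eq_add.1 h1, shiftPoly]
      simp only [map_sub, map_add, map_mul, Polynomial.aeval_C, Polynomial.aeval_X,
        LinearMap.sub_apply, LinearMap.add_apply, Module.End.mul_apply,
        Module.algebraMap_end_apply, smul_smul]
      abel
  -- `b` vanishes as soon as `S b = 0`, since `D N` would otherwise have two eigenvalues on it. Thus
  -- `P(S)` annihilates `a`, where `P = ∏ (X - w j)`, and `a` is a sum of eigenvectors of `S`.
  set P := Lagrange.nodal Finset.univ w with hP
  set b := Polynomial.aeval S P a with hb
  have hSb : S b = 0 := by
    have h1 := hDa (N + 1)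
    rw [hDlast, shiftPoly_eq w q hw0 hw, ← hPP, Polynomial.aeval_C, Module.algebraMap_end_apply,
      ← hPP, Polynomial.aeval_X] at h1
    exact (smul_eq_zero.1 h1.symm).resolve_left
      (mul_ne_zero (pow_ne_zero _ (neg_ne_zero.2 one_ne_zero)) hq1')
  have hb0 : b = 0 := by
    have h1 : D N b = esym Finset.univ w N • b := by
      rw [hb, hDP, hDa, hPP, mul_comm, ← hPP, ← hb,
        aeval_apply_of_eigen S (y := 0) (by rw [hSb, zero_smul]), eval_zero_shiftPoly]
    have h2 : D N b = q • esym Finset.univ w N • b := by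
      rw [hb, hDP, ha, hDN, hp, map_smul, map_smul, map_smul]
    have h3 : ((q - 1) * esym Finset.univ w N) • b = 0 := by
      rw [mul_smul, sub_smul, one_smul, ← h2, ← h1, sub_self]
    have h4 : esym Finset.univ w N ≠ 0 := by
      have := esym_card Finset.univ w
      rw [Finset.card_univ, Fintype.card_fin] at this
      rw [this]
      exact Finset.prod_ne_zero_iff.2 fun i _ => hw0 i
    exact (smul_eq_zero.1 h3).resolve_left (mul_ne_zero hq1' h4)
  refine ⟨fun j => Polynomial.aeval S (Lagrange.basis Finset.univ w j) a, ?_, ?_⟩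
  · rcases Nat.eq_zero_or_pos N with rfl | hN
    · rw [hb, hP] at hb0
      simpa using hb0
    · have : Nonempty (Fin N) := ⟨⟨0, hN⟩⟩
      rw [← LinearMap.sum_apply, ← map_sum, Lagrange.sum_basis hw.injOn Finset.univ_nonempty]
      simp
  · intro j k
    have hev : S (Polynomial.aeval S (Lagrange.basis Finset.univ w j) a) =
        w j • Polynomial.aeval S (Lagrange.basis Finset.univ w j) a := by
      have h1 : Polynomial.aeval S ((Polynomial.X - Polynomial.C (w j)) *
          Lagrange.basis Finset.univ w j) a = 0 := by
        rw [X_sub_C_mul_basis, ← hPP, ← hP, ← hb, hb0, map_zero]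
      rw [← hPP, map_sub, Polynomial.aeval_X, Polynomial.aeval_C, LinearMap.sub_apply,
        Module.algebraMap_end_apply, sub_eq_zero] at h1
      exact h1
    rw [hDP, hDa, hPP, mul_comm, ← hPP, aeval_apply_of_eigen S hev, eval_shiftPoly]

end

/-! ### Joint eigenvectors of the Macdonald operators -/

section
variable {F : Type*} [Field F] {N : ℕ} {q s : F}

/-- The permutation of the variables, as an algebra automorphism. -/
noncomputable def permHom (F : Type*) [Field F] {N : ℕ} (σ : Equiv.Perm (Fin N)) :
    Laurent F N ≃ₐ[F] Laurent F N :=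
  AddMonoidAlgebra.domCongr F F
    { toFun := fun α => α ∘ σ.symm
      invFun := fun α => α ∘ σ
      left_inv := fun α => by funext i; simp
      right_inv := fun α => by funext i; simp
      map_add' := fun α β => rfl }

theorem mem_symLaurent_iff {f : Laurent F N} :
    f ∈ symLaurent F N ↔ ∀ σ, permHom F σ f = f := by
  constructor
  · intro h σ
    refine laurent_ext fun α => ?_
    rw [permHom, AddMonoidAlgebra.coeff_domCongr]
    exact h σ α
  · intro h σ α
    have := congrArg (fun f => f.coeff α) (h σ)
    simp only [permHom, AddMonoidAlgebra.coeff_domCongr] at this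
    exact this

theorem mul_mem_symLaurent {f g : Laurent F N} (hf : f ∈ symLaurent F N)
    (hg : g ∈ symLaurent F N) : f * g ∈ symLaurent F N := by
  rw [mem_symLaurent_iff] at *
  intro σ
  rw [map_mul, hf, hg]

theorem permHom_single (σ : Equiv.Perm (Fin N)) (i : Fin N) (a : ℤ) :
    permHom F σ (AddMonoidAlgebra.single (Pi.single i a) 1) =
      AddMonoidAlgebra.single (Pi.single (σ i) a) 1 := by
  rw [permHom, AddMonoidAlgebra.domCongr_single]
  congr 1
  funext j
  change (Pi.single i a : Fin N → ℤ) (σ.symm j) = _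
  by_cases h : j = σ i
  · subst h; simp
  · rw [Pi.single_eq_of_ne h, Pi.single_eq_of_ne]
    intro h'; exact h (by rw [← h']; simp)

theorem e₁_mem : e₁ F N ∈ symLaurent F N := by
  rw [mem_symLaurent_iff]
  intro σ
  simp only [e₁, varX, map_sum, permHom_single]
  exact Equiv.sum_comp σ (fun i => (AddMonoidAlgebra.single (Pi.single i 1) 1 : Laurent F N))

theorem e₁inv_mem : e₁inv F N ∈ symLaurent F N := by
  rw [mem_symLaurent_iff]
  intro σ
  simp only [e₁inv, varXinv, map_sum, permHom_single]
  exact Equiv.sum_comp σ (fun i => (AddMonoidAlgebra.single (Pi.single i (-1)) 1 : Laurent F N))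

/-- The spectral coordinates `t^{(N+1)/2 - i} q^{α_i}`. -/
def spec (q s : F) (α : Fin N → ℤ) (i : Fin N) : F :=
  s ^ ((N : ℤ) - 1 - 2 * ((i : ℕ) : ℤ)) * q ^ α i

theorem eig_eq_esym (k : ℕ) (α : Fin N → ℤ) :
    eig q s k α = esym Finset.univ (spec q s α) k := rfl

theorem IsGeneric.spec_ne_zero (h : IsGeneric q s) (α : Fin N → ℤ) (i : Fin N) :
    spec q s α i ≠ 0 :=
  mul_ne_zero (zpow_ne_zero _ h.s_ne_zero) (zpow_ne_zero _ h.q_ne_zero)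

theorem IsGeneric.eq_of_spec_eq (h : IsGeneric q s) {α β : Fin N → ℤ} {i j : Fin N} (n : ℤ)
    (he : spec q s α i = q ^ n * spec q s β j) : i = j ∧ α i = β j + n := by
  have hq := h.q_ne_zero
  have hs := h.s_ne_zero
  have h1 : q ^ (α i - β j - n) * (s ^ 2) ^ (((j : ℕ) : ℤ) - (i : ℕ)) = 1 := by
    have h2 : s ^ ((N : ℤ) - 1 - 2 * ((i : ℕ) : ℤ)) =
        s ^ ((N : ℤ) - 1 - 2 * ((j : ℕ) : ℤ)) * (s ^ 2) ^ (((j : ℕ) : ℤ) - (i : ℕ)) := by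
      rw [← zpow_natCast s 2, ← zpow_mul, ← zpow_add₀ hs]
      congr 1; push_cast; ring
    rw [spec, spec, h2] at he
    rw [zpow_sub₀ hq, zpow_sub₀ hq]
    have h3 := zpow_ne_zero (α i) hq
    have h4 := zpow_ne_zero (β j) hq
    have h5 := zpow_ne_zero n hq
    have h6 := zpow_ne_zero ((N : ℤ) - 1 - 2 * ((j : ℕ) : ℤ)) hs
    rw [div_div, div_mul_eq_mul_div, div_eq_one_iff_eq (mul_ne_zero h4 h5)]
    exact mul_left_cancel₀ h6 (by linear_combination he)
  have h2 := h.eq_zero_of_zpow_mul _ _ h1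
  exact ⟨Fin.ext (by omega), by omega⟩

theorem IsGeneric.spec_injective (h : IsGeneric q s) (α : Fin N → ℤ) :
    Function.Injective (spec q s α) := fun i j hij =>
  (h.eq_of_spec_eq (α := α) (β := α) 0 (by rw [hij, zpow_zero, one_mul])).1

theorem IsGeneric.eq_of_eig_eq (h : IsGeneric q s) {α β : Fin N → ℤ}
    (he : ∀ k, eig q s k α = eig q s k β) : α = β := by
  funext i
  obtain ⟨j, -, hj⟩ := exists_eq_of_esym_eq Finset.univ (spec q s α) (spec q s β) he
    (Finset.mem_univ i) (h.spec_ne_zero α i)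
  obtain ⟨h1, h2⟩ := h.eq_of_spec_eq (α := α) (β := β) (i := i) (j := j) 0
    (by rw [hj, zpow_zero, one_mul])
  rw [h2, h1, add_zero]

theorem spec_add_single (h : IsGeneric q s) (α : Fin N → ℤ) (j : Fin N) :
    spec q s (α + Pi.single j 1) = Function.update (spec q s α) j (q * spec q s α j) := by
  funext i
  by_cases hi : i = j
  · subst hi
    simp only [spec, Pi.add_apply, Pi.single_eq_same, Function.update_self,
      zpow_add_one₀ h.q_ne_zero]
    ring
  · simp [spec, hi]

/-- A symmetric Laurent polynomial on which the Macdonald operators act by `e_k(t^ρ q^β)`, where the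
exponent `β` need not be dominant. -/
def JointEigen (q s : F) (β : Fin N → ℤ) (v : Laurent F N) : Prop :=
  v ∈ symLaurent F N ∧ ∀ k, macdonaldD N q s k v = toRat F N (eig q s k β • v)

theorem JointEigen.add {β : Fin N → ℤ} {v v' : Laurent F N} (h : JointEigen q s β v)
    (h' : JointEigen q s β v') : JointEigen q s β (v + v') :=
  ⟨Submodule.add_mem _ h.1 h'.1, fun k => by
    rw [map_add, h.2, h'.2, ← map_add, smul_add]⟩

theorem JointEigen.smul {β : Fin N → ℤ} {v : Laurent F N} (h : JointEigen q s β v) (c : F) :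
    JointEigen q s β (c • v) :=
  ⟨Submodule.smul_mem _ _ h.1, fun k => by
    rw [map_smul, h.2, smul_comm, Algebra.smul_def c (toRat F N _), ← toRat_smul]⟩

theorem JointEigen.sub {β : Fin N → ℤ} {v v' : Laurent F N} (h : JointEigen q s β v)
    (h' : JointEigen q s β v') : JointEigen q s β (v - v') := by
  have := h.add (h'.smul (-1))
  rwa [neg_one_smul, ← sub_eq_add_neg] at this

/-- The Macdonald operators preserve the symmetric Laurent polynomials, and act on the coefficient
at a dominance-maximal weight by the eigenvalue. -/
theorem exists_macdonaldD_symm [CharZero F] (h : IsGeneric q s) (k : ℕ) {v : Laurent F N}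
    (hv : v ∈ symLaurent F N) : ∃ g ∈ symLaurent F N, macdonaldD N q s k v = toRat F N g ∧
      ∀ ν : Weight N, (∀ ρ : Weight N, v.coeff ρ.1 ≠ 0 → ¬ Below ν ρ) →
        g.coeff ν.1 = eig q s k ν.1 * v.coeff ν.1 := by
  choose g hg1 hg2 using exists_macdonaldD_monomialSymm h k (N := N)
  refine ⟨∑ μ ∈ (dominantCoeff v).support, v.coeff μ.1 •
    (eig q s k μ.1 • monomialSymm F μ + g μ), ?_, ?_, ?_⟩
  · exact Submodule.sum_mem _ fun μ _ => Submodule.smul_mem _ _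
      (Submodule.add_mem _ (Submodule.smul_mem _ _ (monomialSymm_mem μ)) (hg1 μ).1)
  · conv_lhs => rw [← sum_dominantCoeff hv, Finsupp.sum, map_sum]
    rw [map_sum]
    refine Finset.sum_congr rfl fun μ _ => ?_
    rw [map_smul, hg2, toRat_smul, Algebra.smul_def]
    rfl
  · intro ν hν
    rw [coeff_sum']
    have : ∀ μ ∈ (dominantCoeff v).support, (v.coeff μ.1 •
        (eig q s k μ.1 • monomialSymm F μ + g μ)).coeff ν.1 =
        if ν = μ then eig q s k ν.1 * v.coeff ν.1 else 0 := by
      intro μ hμ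
      have h0 : (g μ).coeff ν.1 = 0 := by
        by_contra hne
        refine hν μ ?_ ((hg1 μ).2 ν hne)
        rwa [Finsupp.mem_support_iff, dominantCoeff_apply] at hμ
      rw [AddMonoidAlgebra.coeff_smul_apply, AddMonoidAlgebra.coeff_add, Finsupp.add_apply, h0,
        add_zero, AddMonoidAlgebra.coeff_smul_apply, coeff_monomialSymm_weight]
      split_ifs with hνμ
      · subst hνμ; simp only [smul_eq_mul]; ring
      · simp
    rw [Finset.sum_congr rfl this, Finset.sum_ite_eq]
    split_ifs with hmem
    · rfl
    · have h0 : v.coeff ν.1 = 0 := by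
        rw [← dominantCoeff_apply]; exact Finsupp.notMem_support_iff.1 hmem
      rw [h0, mul_zero]

/-- The exponent `β` of a joint eigenvector is dominant and is its leading exponent: a
dominance-maximal exponent has the eigenvalues of `β`, which determine it by genericity. -/
theorem JointEigen.dominated [CharZero F] (h : IsGeneric q s) {β : Fin N → ℤ} {v : Laurent F N}
    (hv : JointEigen q s β v) {ν : Weight N} (hν : v.coeff ν.1 ≠ 0) :
    ∃ hβ : Antitone β, Dominated ν ⟨β, hβ⟩ ∧ v.coeff β ≠ 0 := by
  classical
  have hmem : ∀ ρ : Weight N, ρ ∈ (dominantCoeff v).support ↔ v.coeff ρ.1 ≠ 0 := fun ρ => by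
    rw [Finsupp.mem_support_iff, dominantCoeff_apply]
  obtain ⟨lam, hlam, hmax⟩ := Finset.exists_max_image
    ((dominantCoeff v).support.filter (fun ρ => Dominated ν ρ)) normSq
    ⟨ν, Finset.mem_filter.2 ⟨(hmem ν).2 hν, dominated_refl ν⟩⟩
  rw [Finset.mem_filter, hmem] at hlam
  have hno : ∀ ρ : Weight N, v.coeff ρ.1 ≠ 0 → ¬ Below lam ρ := fun ρ hρ hb =>
    absurd hb.normSq_lt (not_lt.2 (hmax ρ (Finset.mem_filter.2
      ⟨(hmem ρ).2 hρ, dominated_trans hlam.2 hb.1⟩)))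
  have he : ∀ k, eig q s k lam.1 = eig q s k β := by
    intro k
    obtain ⟨g, -, hg2, hg3⟩ := exists_macdonaldD_symm h k hv.1
    rw [hv.2 k] at hg2
    have h1 := hg3 lam hno
    rw [← toRat_injective hg2, AddMonoidAlgebra.coeff_smul_apply, smul_eq_mul] at h1
    exact (mul_right_cancel₀ hlam.1 h1).symm
  have hl := h.eq_of_eig_eq he
  subst hl
  exact ⟨lam.2, hlam.2, hlam.1⟩

/-- A joint eigenvector vanishes if its expected leading coefficient does. -/
theorem JointEigen.eq_zero [CharZero F] (h : IsGeneric q s) {β : Fin N → ℤ} {v : Laurent F N}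
    (hv : JointEigen q s β v) (h0 : v.coeff β = 0) : v = 0 :=
  symLaurent_ext hv.1 (Submodule.zero_mem _) fun ν => by
    by_contra hne
    obtain ⟨-, -, h1⟩ := hv.dominated h hne
    exact h1 h0

theorem JointEigen.eq_zero_of_not_antitone [CharZero F] (h : IsGeneric q s) {β : Fin N → ℤ}
    {v : Laurent F N} (hv : JointEigen q s β v) (hβ : ¬ Antitone β) : v = 0 :=
  symLaurent_ext hv.1 (Submodule.zero_mem _) fun ν => by
    by_contra hne
    obtain ⟨h1, -⟩ := hv.dominated h hne
    exact hβ h1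

theorem JointEigen.eq_smul [CharZero F] (h : IsGeneric q s) {β : Fin N → ℤ} {v P : Laurent F N}
    (hv : JointEigen q s β v) (hP : JointEigen q s β P) (h1 : P.coeff β = 1) :
    v = v.coeff β • P := by
  refine sub_eq_zero.1 ((hv.sub (hP.smul _)).eq_zero h ?_)
  rw [AddMonoidAlgebra.coeff_sub, Finsupp.sub_apply, AddMonoidAlgebra.coeff_smul_apply, h1]
  simp

theorem eig_eq_zero {k : ℕ} (hk : N < k) (α : Fin N → ℤ) : eig q s k α = 0 := by
  rw [eig_eq_esym, esym_eq_zero _ _ (by simpa using hk)]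

/-- Macdonald polynomials are the normalized joint eigenvectors. -/
theorem isMacdonald_iff [CharZero F] (h : IsGeneric q s) (lam : Weight N) (P : Laurent F N) :
    IsMacdonald q s lam P ↔ JointEigen q s lam.1 P ∧ P.coeff lam.1 = 1 := by
  constructor
  · rintro ⟨⟨a, ha, rfl⟩, h2⟩
    refine ⟨⟨Submodule.add_mem _ (monomialSymm_mem lam) (finsupp_sum_mem a), fun k => ?_⟩, ?_⟩
    · by_cases hk : k ≤ N
      · rw [h2 k hk, toRat_smul, Algebra.smul_def]; rfl
      · rw [macdonaldD_eq h, DifferenceField.D_eq_zero _ (not_le.1 hk), eig_eq_zero (not_le.1 hk),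
          zero_smul, map_zero]
    · rw [AddMonoidAlgebra.coeff_add, Finsupp.add_apply, coeff_finsupp_sum,
        coeff_monomialSymm_weight, if_pos rfl]
      have : a lam = 0 := by
        by_contra hne
        exact (ha lam (Finsupp.mem_support_iff.2 hne)).2 rfl
      rw [this, add_zero]
  · rintro ⟨h1, h2⟩
    refine ⟨⟨dominantCoeff P - Finsupp.single lam 1, fun μ hμ => ?_, ?_⟩, fun k _ => ?_⟩
    · have hne : μ ≠ lam := by
        rintro rfl
        rw [Finsupp.mem_support_iff, Finsupp.sub_apply, dominantCoeff_apply, h2,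
          Finsupp.single_eq_same, sub_self] at hμ
        exact hμ rfl
      rw [Finsupp.mem_support_iff, Finsupp.sub_apply, dominantCoeff_apply,
        Finsupp.single_eq_of_ne hne, sub_zero] at hμ
      obtain ⟨_, h3, -⟩ := h1.dominated h hμ
      exact ⟨h3, hne⟩
    · refine symLaurent_ext h1.1 (Submodule.add_mem _ (monomialSymm_mem lam) (finsupp_sum_mem _))
        fun ν => ?_
      rw [AddMonoidAlgebra.coeff_add, Finsupp.add_apply, coeff_finsupp_sum,
        coeff_monomialSymm_weight, Finsupp.sub_apply, dominantCoeff_apply, Finsupp.single_apply]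
      by_cases hn : ν = lam
      · simp [hn]
      · simp [hn, Ne.symm hn]
    · rw [h1.2 k, toRat_smul, Algebra.smul_def]; rfl

/-! ### The shape of the Pieri formula -/

/-- The Macdonald operator as an endomorphism of the symmetric Laurent polynomials. -/
noncomputable def symD [CharZero F] (h : IsGeneric q s) (N k : ℕ) :
    Module.End F (symLaurent F N) where
  toFun v := ⟨(exists_macdonaldD_symm h k v.2).choose,
    (exists_macdonaldD_symm h k v.2).choose_spec.1⟩
  map_add' v v' := Subtype.ext (toRat_injective (by
    refine (exists_macdonaldD_symm h k (v + v').2).choose_spec.2.1.symm.trans ?_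
    rw [Submodule.coe_add, Submodule.coe_add, map_add, map_add]
    exact congrArg₂ _ (exists_macdonaldD_symm h k v.2).choose_spec.2.1
      (exists_macdonaldD_symm h k v'.2).choose_spec.2.1))
  map_smul' c v := Subtype.ext (toRat_injective (by
    refine (exists_macdonaldD_symm h k (c • v).2).choose_spec.2.1.symm.trans ?_
    rw [Submodule.coe_smul, Submodule.coe_smul, map_smul, toRat_smul, Algebra.smul_def]
    exact congrArg _ (exists_macdonaldD_symm h k v.2).choose_spec.2.1))

theorem toRat_symD [CharZero F] (h : IsGeneric q s) (k : ℕ) (v : symLaurent F N) :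
    toRat F N (symD h N k v) = (ratDifferenceField h N).D k (toRat F N v) := by
  rw [← macdonaldD_eq, (exists_macdonaldD_symm h k v.2).choose_spec.2.1]
  rfl

/-- Multiplication by a symmetric Laurent polynomial. -/
noncomputable def symMul (g : symLaurent F N) : Module.End F (symLaurent F N) where
  toFun v := ⟨g * v, mul_mem_symLaurent g.2 v.2⟩
  map_add' _ _ := Subtype.ext (mul_add _ _ _)
  map_smul' c v := Subtype.ext (mul_smul_comm c (g : Laurent F N) (v : Laurent F N))

theorem coe_symMul (g v : symLaurent F N) :
    (symMul g v : Laurent F N) = (g : Laurent F N) * v := rfl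

theorem symLaurent_ext_toRat {v v' : symLaurent F N}
    (h : toRat F N (v : Laurent F N) = toRat F N v') : v = v' :=
  Subtype.ext (toRat_injective h)

/-- The operator `∑ A_i X_i T_i` on symmetric Laurent polynomials. -/
noncomputable def symE [CharZero F] (h : IsGeneric q s) (N : ℕ) : Module.End F (symLaurent F N) :=
  (q - 1)⁻¹ • (symD h N 1 * symMul ⟨e₁ F N, e₁_mem⟩ - symMul ⟨e₁ F N, e₁_mem⟩ * symD h N 1)

theorem toRat_symE [CharZero F] (h : IsGeneric q s) (v : symLaurent F N) :
    toRat F N (symE h N v) = (ratDifferenceField h N).E (toRat F N v) := by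
  have hq : algebraMap F (RatFrac F N) q - 1 ≠ 0 :=
    sub_ne_zero.2 (ratDifferenceField h N).q_ne_one
  have h1 := (ratDifferenceField h N).D_one_e_mul (toRat F N v)
  have h2 : (symE h N v : Laurent F N) = (q - 1)⁻¹ •
      ((symD h N 1 (symMul ⟨e₁ F N, e₁_mem⟩ v) : Laurent F N) -
        symMul ⟨e₁ F N, e₁_mem⟩ (symD h N 1 v)) := rfl
  rw [h2, toRat_smul, map_sub, toRat_symD, coe_symMul, coe_symMul, map_mul, map_mul, toRat_symD,
    toRat_e₁ h, h1, add_sub_cancel_left, map_inv₀, map_sub, map_one]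
  exact inv_mul_cancel_left₀ hq _

theorem macdonaldD_top (h : IsGeneric q s) (φ : RatFrac F N) :
    (ratDifferenceField h N).D N φ = (ratDifferenceField h N).τ Finset.univ φ := by
  have : (Finset.univ : Finset (Fin N)).powersetCard N = {Finset.univ} := by
    have := Finset.powersetCard_self (Finset.univ : Finset (Fin N))
    rwa [Finset.card_univ, Fintype.card_fin] at this
  rw [DifferenceField.D, this, Finset.sum_singleton, DifferenceField.A]
  simp

/-- If `v` is a joint eigenvector, then `e₁ v` is a sum of joint eigenvectors whose exponents are
obtained by adding one box. -/
theorem JointEigen.exists_e₁_mul_eq_sum [CharZero F] (h : IsGeneric q s) {β : Fin N → ℤ}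
    {p : Laurent F N} (hp : JointEigen q s β p) :
    ∃ v : Fin N → Laurent F N, e₁ F N * p = ∑ j, v j ∧
      ∀ j, JointEigen q s (β + Pi.single j 1) (v j) := by
  have hR := toRat_e₁ (N := N) h
  have hq : q - 1 ≠ 0 := sub_ne_zero.2 h.q_ne_one
  obtain ⟨v, hv1, hv2⟩ := exists_joint_eigen_decomposition (N := N) (symD h N)
    (symMul ⟨e₁ F N, e₁_mem⟩) (symE h N) q h.q_ne_one
    (fun k v => symLaurent_ext_toRat (by
      simp only [toRat_symD]; exact (ratDifferenceField h N).D_one_D_comm k _))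
    (fun v => by
      rw [symE, LinearMap.smul_apply, smul_smul, mul_inv_cancel₀ hq, one_smul,
        LinearMap.sub_apply, Module.End.mul_apply, Module.End.mul_apply, add_sub_cancel])
    (fun k v => symLaurent_ext_toRat (by
      rw [Submodule.coe_sub, Submodule.coe_sub, Submodule.coe_smul, map_sub, map_sub, toRat_smul]
      simp only [toRat_symD, toRat_symE, coe_symMul, map_mul, hR]
      exact (ratDifferenceField h N).D_e_relation k _))
    (fun v => symLaurent_ext_toRat (by
      rw [toRat_symD]; exact (ratDifferenceField h N).D_zero _))
    (fun v => symLaurent_ext_toRat (by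
      rw [toRat_symD, (ratDifferenceField h N).D_eq_zero (Nat.lt_succ_self N)]
      exact (map_zero _).symm))
    (fun v => symLaurent_ext_toRat (by
      rw [Submodule.coe_smul, toRat_smul]
      simp only [toRat_symD, coe_symMul, map_mul, hR, macdonaldD_top]
      rw [DifferenceField.τ_e, DifferenceField.e]
      change (_ + (algebraMap F (RatFrac F N) q - 1) * _) * _ = _
      ring))
    (spec q s β) (h.spec_ne_zero β) (h.spec_injective β) ⟨p, hp.1⟩
    (fun k => symLaurent_ext_toRat (by
      rw [toRat_symD, ← macdonaldD_eq, hp.2 k]; rfl))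
  refine ⟨fun j => v j, ?_, fun j => ⟨(v j).2, fun k => ?_⟩⟩
  · have := congrArg (fun v : symLaurent F N => (v : Laurent F N)) hv1
    simpa [coe_symMul] using this
  · rw [macdonaldD_eq h, ← toRat_symD, hv2 j k, ← spec_add_single h]
    rfl

end

/-! ### Stability: the lowest coefficient in the last variable -/

section
variable {F : Type*} [Field F] {N : ℕ} {q s : F}

theorem snoc_injective (c : ℤ) :
    Function.Injective (fun β : Fin N → ℤ => (Fin.snoc β c : Fin (N + 1) → ℤ)) := by
  intro β β' h
  funext i
  have := congrFun h i.castSucc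
  simpa using this

/-- The coefficient of `X_{N+1}^c`, a Laurent polynomial in one variable less. -/
noncomputable def res (F : Type*) [Field F] {N : ℕ} (c : ℤ) :
    Laurent F (N + 1) →ₗ[F] Laurent F N where
  toFun f := AddMonoidAlgebra.ofCoeff
    (Finsupp.comapDomain (fun β : Fin N → ℤ => (Fin.snoc β c : Fin (N + 1) → ℤ)) f.coeff
      (snoc_injective c).injOn)
  map_add' _ _ := laurent_ext fun _ => rfl
  map_smul' _ _ := laurent_ext fun _ => rfl

theorem coeff_res (c : ℤ) (f : Laurent F (N + 1)) (β : Fin N → ℤ) :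
    (res F c f).coeff β = f.coeff (Fin.snoc β c) := rfl

theorem snoc_comp_castSucc (α : Fin (N + 1) → ℤ) :
    (Fin.snoc (α ∘ Fin.castSucc) (α (Fin.last N)) : Fin (N + 1) → ℤ) = α := by
  funext i
  induction i using Fin.lastCases with
  | last => simp
  | cast i => simp

theorem res_single (c : ℤ) (α : Fin (N + 1) → ℤ) (x : F) :
    res F c (AddMonoidAlgebra.single α x) =
      if α (Fin.last N) = c then AddMonoidAlgebra.single (α ∘ Fin.castSucc) x else 0 := by
  refine laurent_ext fun β => ?_
  rw [coeff_res, AddMonoidAlgebra.coeff_single, Finsupp.single_apply]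
  have hiff : α = Fin.snoc β c ↔ α (Fin.last N) = c ∧ α ∘ Fin.castSucc = β := by
    constructor
    · rintro rfl
      exact ⟨by simp, by funext i; simp⟩
    · rintro ⟨rfl, rfl⟩
      exact (snoc_comp_castSucc α).symm
  by_cases h1 : α (Fin.last N) = c
  · simp only [h1, if_true, AddMonoidAlgebra.coeff_single, Finsupp.single_apply, hiff, true_and]
  · have h2 : ¬ α = Fin.snoc β c := fun h => h1 (hiff.1 h).1
    simp [h1, h2]

/-- The Laurent polynomials divisible by `X_{N+1}^c`. -/
def ordGE (F : Type*) [Field F] {N : ℕ} (c : ℤ) : Submodule F (Laurent F (N + 1)) where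
  carrier := {f | ∀ α, f.coeff α ≠ 0 → c ≤ α (Fin.last N)}
  zero_mem' := fun α h => absurd rfl h
  add_mem' := fun {f g} hf hg α h => by
    by_cases h1 : f.coeff α = 0
    · refine hg α fun h2 => h ?_
      rw [AddMonoidAlgebra.coeff_add, Finsupp.add_apply, h1, h2, add_zero]
    · exact hf α h1
  smul_mem' := fun a f hf α h => hf α fun h2 => h (by
    rw [AddMonoidAlgebra.coeff_smul_apply, h2, smul_zero])

theorem single_mem_ordGE {c : ℤ} {α : Fin (N + 1) → ℤ} (h : c ≤ α (Fin.last N)) (x : F) :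
    AddMonoidAlgebra.single α x ∈ ordGE F c := by
  intro β hβ
  rw [AddMonoidAlgebra.coeff_single, Finsupp.single_apply] at hβ
  by_cases he : α = β
  · rwa [← he]
  · simp [he] at hβ

/-- Decomposition into monomials divisible by `X_{N+1}^c`. -/
theorem ordGE_induction {c : ℤ} {p : Laurent F (N + 1) → Prop} {f : Laurent F (N + 1)}
    (hf : f ∈ ordGE F c) (h0 : p 0) (hadd : ∀ f g, p f → p g → p (f + g))
    (hs : ∀ α x, c ≤ α (Fin.last N) → p (AddMonoidAlgebra.single α x)) : p f := by
  rw [← AddMonoidAlgebra.sum_coeff_single f, Finsupp.sum]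
  exact Finset.sum_induction _ p hadd h0 fun α hα =>
    hs α _ (hf α (Finsupp.mem_support_iff.1 hα))

theorem res_mul {a b : ℤ} {f g : Laurent F (N + 1)} (hf : f ∈ ordGE F a) (hg : g ∈ ordGE F b) :
    res F (a + b) (f * g) = res F a f * res F b g ∧ f * g ∈ ordGE F (a + b) := by
  refine ordGE_induction (p := fun f => res F (a + b) (f * g) = res F a f * res F b g ∧
    f * g ∈ ordGE F (a + b)) hf ⟨by simp, by rw [zero_mul]; exact Submodule.zero_mem _⟩
    (fun f f' h h' => ⟨by rw [add_mul, map_add, map_add, h.1, h'.1, add_mul],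
      by rw [add_mul]; exact Submodule.add_mem _ h.2 h'.2⟩) fun α x hα => ?_
  refine ordGE_induction (p := fun g => res F (a + b) (AddMonoidAlgebra.single α x * g) =
    res F a (AddMonoidAlgebra.single α x) * res F b g ∧
    AddMonoidAlgebra.single α x * g ∈ ordGE F (a + b)) hg
    ⟨by simp, by rw [mul_zero]; exact Submodule.zero_mem _⟩
    (fun g g' h h' => ⟨by rw [mul_add, map_add, map_add, h.1, h'.1, mul_add],
      by rw [mul_add]; exact Submodule.add_mem _ h.2 h'.2⟩) fun β y hβ => ?_
  rw [AddMonoidAlgebra.single_mul_single]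
  refine ⟨?_, single_mem_ordGE (by rw [Pi.add_apply]; omega) _⟩
  rw [res_single, res_single, res_single]
  by_cases h1 : α (Fin.last N) = a
  · by_cases h2 : β (Fin.last N) = b
    · rw [if_pos h1, if_pos h2, if_pos (by rw [Pi.add_apply, h1, h2]),
        AddMonoidAlgebra.single_mul_single]
      rfl
    · rw [if_neg h2, mul_zero, if_neg (by rw [Pi.add_apply]; omega)]
  · rw [if_neg h1, zero_mul, if_neg (by rw [Pi.add_apply]; omega)]

theorem res_prod {ι : Type*} (A : Finset ι) (f : ι → Laurent F (N + 1))
    (hf : ∀ i ∈ A, f i ∈ ordGE F 0) :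
    res F 0 (∏ i ∈ A, f i) = ∏ i ∈ A, res F 0 (f i) ∧ ∏ i ∈ A, f i ∈ ordGE F 0 := by
  classical
  induction A using Finset.induction_on with
  | empty =>
    rw [Finset.prod_empty, Finset.prod_empty, AddMonoidAlgebra.one_def, res_single]
    exact ⟨by simp; rfl, single_mem_ordGE (by simp) _⟩
  | insert a t ha ih =>
    have h1 := ih fun i hi => hf i (Finset.mem_insert_of_mem hi)
    have h2 := res_mul (hf a (Finset.mem_insert_self _ _)) h1.2
    rw [add_zero] at h2
    rw [Finset.prod_insert ha, Finset.prod_insert ha, h2.1, h1.1]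
    exact ⟨rfl, h2.2⟩

theorem varX_mem_ordGE (i : Fin (N + 1)) : varX F i ∈ ordGE F 0 :=
  single_mem_ordGE (by simp [Pi.single_apply]; split_ifs <;> simp) _

theorem res_varX_castSucc (i : Fin N) : res F 0 (varX F i.castSucc) = varX F i := by
  rw [varX, res_single, if_pos (by simp [Fin.castSucc_ne_last i |>.symm]), varX]
  congr 1
  funext j
  simp [Pi.single_apply]

theorem res_varX_last : res F 0 (varX F (Fin.last N)) = 0 := by
  rw [varX, res_single, if_neg (by simp)]

theorem e₁_mem_ordGE : e₁ F (N + 1) ∈ ordGE F 0 := Submodule.sum_mem _ fun i _ => varX_mem_ordGE i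

theorem res_e₁ : res F 0 (e₁ F (N + 1)) = e₁ F N := by
  rw [e₁, Fin.sum_univ_castSucc, map_add, map_sum, res_varX_last, add_zero, e₁]
  exact Finset.sum_congr rfl fun i _ => res_varX_castSucc i

theorem prod_Ioi_castSucc {M : Type*} [CommMonoid M] (i : Fin N) (g : Fin (N + 1) → M) :
    ∏ j ∈ Finset.Ioi i.castSucc, g j = g (Fin.last N) * ∏ j ∈ Finset.Ioi i, g j.castSucc := by
  have : Finset.Ioi i.castSucc = insert (Fin.last N) ((Finset.Ioi i).map Fin.castSuccEmb) := by
    ext j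
    induction j using Fin.lastCases with
    | last => simp [Fin.castSucc_lt_last]
    | cast j => simp; exact fun _ => Fin.le_last _
  rw [this, Finset.prod_insert, Finset.prod_map]
  · rfl
  · simp

theorem vand_succ : vand F (N + 1) = ∏ i : Fin N, ((varX F (Fin.last N) - varX F i.castSucc) *
    ∏ j ∈ Finset.Ioi i, (varX F j.castSucc - varX F i.castSucc)) := by
  rw [vand, Fin.prod_univ_castSucc]
  have : Finset.Ioi (Fin.last N) = ∅ := by ext j; simp [Fin.le_last]
  rw [this, Finset.prod_empty, mul_one]
  exact Finset.prod_congr rfl fun i _ => prod_Ioi_castSucc i _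

theorem res_vand : res F 0 (vand F (N + 1)) = (∏ i : Fin N, -varX F i) * vand F N ∧
    vand F (N + 1) ∈ ordGE F 0 := by
  have h1 : ∀ i j : Fin (N + 1), varX F i - varX F j ∈ ordGE F 0 := fun i j =>
    Submodule.sub_mem _ (varX_mem_ordGE i) (varX_mem_ordGE j)
  have h2 : ∀ i : Fin N, _ := fun i => res_prod (Finset.Ioi i)
    (fun j => varX F j.castSucc - varX F i.castSucc) fun j _ => h1 _ _
  have h3 : ∀ i : Fin N, _ := fun i => res_mul (h1 (Fin.last N) i.castSucc) (h2 i).2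
  have h4 := res_prod Finset.univ _ fun i _ => (h3 i).2
  simp only [add_zero] at h3 h4
  rw [vand_succ]
  refine ⟨?_, h4.2⟩
  rw [h4.1, vand, ← Finset.prod_mul_distrib]
  refine Finset.prod_congr rfl fun i _ => ?_
  rw [(h3 i).1, (h2 i).1, map_sub, res_varX_last, res_varX_castSucc, zero_sub]
  congr 1
  refine Finset.prod_congr rfl fun j _ => ?_
  rw [map_sub, res_varX_castSucc, res_varX_castSucc]

theorem coeff_qShift (q : F) (I : Finset (Fin N)) (f : Laurent F N) (α : Fin N → ℤ) :
    (qShift q I f).coeff α = q ^ (∑ i ∈ I, α i) * f.coeff α := by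
  induction f using AddMonoidAlgebra.induction_linear with
  | zero => simp
  | add f g hf hg => simp [hf, hg, mul_add]
  | single β x =>
    rw [qShift_single, AddMonoidAlgebra.coeff_single, AddMonoidAlgebra.coeff_single,
      Finsupp.single_apply, Finsupp.single_apply]
    split_ifs with h
    · rw [h, mul_comm]
    · rw [mul_zero]

theorem qShift_mem_ordGE {c : ℤ} (q : F) (I : Finset (Fin (N + 1))) {f : Laurent F (N + 1)}
    (hf : f ∈ ordGE F c) : qShift q I f ∈ ordGE F c := fun α hα =>
  hf α fun h0 => hα (by rw [coeff_qShift, h0, mul_zero])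

theorem res_qShift_map (q : F) (c : ℤ) (J : Finset (Fin N)) (f : Laurent F (N + 1)) :
    res F c (qShift q (J.map Fin.castSuccEmb) f) = qShift q J (res F c f) := by
  refine laurent_ext fun β => ?_
  rw [coeff_res, coeff_qShift, coeff_qShift, coeff_res, Finset.sum_map]
  simp

theorem res_qShift_insert {q : F} (hq : q ≠ 0) (c : ℤ) (J : Finset (Fin N))
    (f : Laurent F (N + 1)) :
    res F c (qShift q (insert (Fin.last N) (J.map Fin.castSuccEmb)) f) =
      q ^ c • qShift q J (res F c f) := by
  refine laurent_ext fun β => ?_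
  rw [coeff_res, coeff_qShift, AddMonoidAlgebra.coeff_smul_apply, coeff_qShift, coeff_res,
    Finset.sum_insert (by simp [Fin.castSucc_ne_last]), Finset.sum_map, zpow_add₀ hq]
  simp [mul_assoc]

theorem qShift_mul {q : F} (hq : q ≠ 0) (J : Finset (Fin N)) (f g : Laurent F N) :
    qShift q J (f * g) = qShift q J f * qShift q J g := by
  have := qShift_eq_scaleHom (N := N) (Units.mk0 q hq) J
  rw [Units.val_mk0] at this
  rw [this, this, this, map_mul]

theorem qShift_prod_neg_varX {q : F} (hq : q ≠ 0) (J : Finset (Fin N)) :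
    qShift q J (∏ i : Fin N, -varX F i) = q ^ J.card • ∏ i : Fin N, -varX F i := by
  have := qShift_eq_scaleHom (N := N) (Units.mk0 q hq) J
  rw [Units.val_mk0] at this
  rw [this, map_prod]
  have h1 : ∀ i, scaleHom (unitsOn (Units.mk0 q hq) J) (-varX F i) =
      (if i ∈ J then q else 1) • -varX F i := fun i => by
    rw [map_neg, scaleHom_varX, smul_neg, unitsOn]
    split_ifs <;> simp
  simp_rw [h1, Algebra.smul_def]
  rw [Finset.prod_mul_distrib, ← map_prod, Finset.prod_ite_mem, Finset.univ_inter,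
    Finset.prod_const]

theorem qShift_empty (q : F) (f : Laurent F N) : qShift q ∅ f = f :=
  laurent_ext fun α => by rw [coeff_qShift]; simp

theorem sum_powersetCard_castSucc {M : Type*} [AddCommMonoid M] (G : Finset (Fin (N + 1)) → M)
    (k : ℕ) : ∑ I ∈ (Finset.univ : Finset (Fin (N + 1))).powersetCard (k + 1), G I =
      ∑ J ∈ (Finset.univ : Finset (Fin N)).powersetCard (k + 1), G (J.map Fin.castSuccEmb) +
      ∑ J ∈ (Finset.univ : Finset (Fin N)).powersetCard k,
        G (insert (Fin.last N) (J.map Fin.castSuccEmb)) := by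
  have hu : (Finset.univ : Finset (Fin (N + 1))) =
      insert (Fin.last N) (Finset.univ.map Fin.castSuccEmb) := by
    ext j
    induction j using Fin.lastCases with
    | last => simp
    | cast j => simp
  rw [hu, sum_powersetCard_insert (by simp [Fin.castSucc_ne_last]), Finset.powersetCard_map,
    Finset.powersetCard_map, Finset.sum_map, Finset.sum_map]
  rfl

/-- The splitting of the eigenvalues that corresponds to `res_clearedD`. -/
theorem eig_succ (h : IsGeneric q s) (k : ℕ) (β : Fin (N + 1) → ℤ) :
    eig q s (k + 1) β = s ^ (k + 1) * eig q s (k + 1) (β ∘ Fin.castSucc) +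
      s ^ (-(N : ℤ)) * q ^ β (Fin.last N) * (s ^ k * eig q s k (β ∘ Fin.castSucc)) := by
  have hs := h.s_ne_zero
  have h1 : ∀ i : Fin N, spec q s β i.castSucc = s * spec q s (β ∘ Fin.castSucc) i := fun i => by
    simp only [spec, Function.comp_apply, Fin.val_castSucc]
    rw [← mul_assoc, ← zpow_one_add₀ hs]
    congr 2; push_cast; ring
  have h2 : spec q s β (Fin.last N) = s ^ (-(N : ℤ)) * q ^ β (Fin.last N) := by
    simp only [spec, Fin.val_last]
    congr 2; push_cast; ring
  simp only [eig_eq_esym, ← esym_smul, ← h2, ← h1]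
  rw [esym, sum_powersetCard_castSucc, esym, esym, Finset.mul_sum]
  congr 1
  · exact Finset.sum_congr rfl fun J _ => by rw [Finset.prod_map]; rfl
  · refine Finset.sum_congr rfl fun J _ => ?_
    rw [Finset.prod_insert (by simp [Fin.castSucc_ne_last]), Finset.prod_map]; rfl

/-- The lowest coefficient of the Macdonald operators in the last variable: the sets `I` without the
last index give `D_{k+1}` and those with it give `D_k` in one variable less. -/
theorem res_clearedD (h : IsGeneric q s) (k : ℕ) (c : ℤ) {v : Laurent F (N + 1)}
    (hv : v ∈ ordGE F c) : res F c (clearedD q s (vand F (N + 1)) (k + 1) v) =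
      (∏ i : Fin N, -varX F i) * ((s ^ 2) ^ (k + 1) • clearedD q s (vand F N) (k + 1) (res F c v) +
        ((s ^ 2) ^ k * q ^ c) • clearedD q s (vand F N) k (res F c v)) := by
  have ht : s ^ 2 ≠ 0 := pow_ne_zero 2 h.s_ne_zero
  have hm : ∀ I, res F c (qShift (s ^ 2) I (vand F (N + 1)) * qShift q I v) =
      res F 0 (qShift (s ^ 2) I (vand F (N + 1))) * res F c (qShift q I v) := fun I => by
    have := (res_mul (qShift_mem_ordGE (s ^ 2) I res_vand.2) (qShift_mem_ordGE q I hv)).1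
    rwa [zero_add] at this
  have hV : ∀ J : Finset (Fin N), qShift (s ^ 2) J ((∏ i : Fin N, -varX F i) * vand F N) =
      (s ^ 2) ^ J.card • ((∏ i : Fin N, -varX F i) * qShift (s ^ 2) J (vand F N)) := fun J => by
    rw [qShift_mul ht, qShift_prod_neg_varX ht, smul_mul_assoc]
  rw [clearedD, map_sum, sum_powersetCard_castSucc, mul_add]
  congr 1
  · rw [clearedD, Finset.smul_sum, Finset.mul_sum]
    refine Finset.sum_congr rfl fun J hJ => ?_
    rw [hm, res_qShift_map, res_qShift_map, res_vand.1, hV, (Finset.mem_powersetCard.1 hJ).2,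
      smul_mul_assoc, mul_smul_comm, mul_assoc]
  · rw [clearedD, Finset.smul_sum, Finset.mul_sum]
    refine Finset.sum_congr rfl fun J hJ => ?_
    rw [hm, res_qShift_insert ht, res_qShift_insert h.q_ne_zero, res_vand.1, hV,
      (Finset.mem_powersetCard.1 hJ).2, zpow_zero, one_smul, smul_mul_assoc, mul_smul_comm,
      mul_smul_comm, smul_smul, mul_assoc]

/-- The extension of a permutation by a fixed last point. -/
def permSnoc (σ : Equiv.Perm (Fin N)) : Equiv.Perm (Fin (N + 1)) where
  toFun i := Fin.lastCases (Fin.last N) (fun j => (σ j).castSucc) i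
  invFun i := Fin.lastCases (Fin.last N) (fun j => (σ.symm j).castSucc) i
  left_inv i := by induction i using Fin.lastCases <;> simp
  right_inv i := by induction i using Fin.lastCases <;> simp

theorem res_mem_symLaurent (c : ℤ) {v : Laurent F (N + 1)} (hv : v ∈ symLaurent F (N + 1)) :
    res F c v ∈ symLaurent F N := by
  intro σ β
  rw [coeff_res, coeff_res, ← hv (permSnoc σ) (Fin.snoc β c)]
  congr 1
  funext i
  induction i using Fin.lastCases <;> simp [permSnoc]

/-- The lowest coefficient in the last variable of a joint eigenvector is a joint eigenvector. -/
theorem JointEigen.res (h : IsGeneric q s) {β : Fin (N + 1) → ℤ} {v : Laurent F (N + 1)}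
    (hv : JointEigen q s β v) (ho : v ∈ ordGE F (β (Fin.last N))) :
    JointEigen q s (β ∘ Fin.castSucc) (res F (β (Fin.last N)) v) := by
  have hs := h.s_ne_zero
  refine ⟨res_mem_symLaurent _ hv.1, fun k => ?_⟩
  rw [macdonaldD_eq_iff h]
  set c := β (Fin.last N) with hc
  -- The splittings of the operators and of the eigenvalues have the same shape, which allows an
  -- induction on `k`.
  induction k with
  | zero => simp [clearedD, eig, qShift_empty]
  | succ k ih =>
    have h1 := (macdonaldD_eq_iff h (k + 1) v _).1 (hv.2 (k + 1))
    have h2 := congrArg (_root_.res F c) h1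
    have h3 : _root_.res F c (vand F (N + 1) * v) =
        (∏ i : Fin N, -varX F i) * (vand F N * _root_.res F c v) := by
      have := (res_mul res_vand.2 ho).1
      rw [zero_add, res_vand.1, mul_assoc] at this
      exact this
    have hM : (∏ i : Fin N, -varX F i) ≠ 0 :=
      Finset.prod_ne_zero_iff.2 fun i _ => neg_ne_zero.2 (varX_ne_zero i)
    rw [res_clearedD h k c ho, mul_smul_comm, map_smul, map_smul, h3, ← mul_smul_comm,
      ← mul_smul_comm] at h2
    have h4 := mul_left_cancel₀ hM h2
    rw [ih, eig_succ h, ← hc, ← eq_sub_iff_add_eq, mul_smul_comm, smul_smul, smul_smul, smul_smul,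
      ← sub_smul] at h4
    have h5 : (s ^ 2) ^ (k + 1) ≠ 0 := pow_ne_zero _ (pow_ne_zero _ hs)
    rw [mul_smul_comm, smul_smul]
    refine smul_right_injective _ h5 ?_
    change (s ^ 2) ^ (k + 1) • _ = (s ^ 2) ^ (k + 1) • _
    rw [h4, smul_smul]
    congr 1
    generalize eig q s (k + 1) (β ∘ Fin.castSucc) = e1
    generalize eig q s k (β ∘ Fin.castSucc) = e0
    have e2 : s ^ (((k + 1 : ℕ) : ℤ) * (((N + 1 : ℕ) : ℤ) - 1)) * s ^ (k + 1) =
        (s ^ 2) ^ (k + 1) * s ^ (((k + 1 : ℕ) : ℤ) * ((N : ℤ) - 1)) := by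
      rw [← zpow_natCast s (k + 1), ← zpow_natCast s 2, ← zpow_natCast (s ^ ((2 : ℕ) : ℤ)),
        ← zpow_mul, ← zpow_add₀ hs, ← zpow_add₀ hs]
      congr 1; push_cast; ring
    have e3 : s ^ (((k + 1 : ℕ) : ℤ) * (((N + 1 : ℕ) : ℤ) - 1)) * (s ^ (-(N : ℤ)) * s ^ k) =
        (s ^ 2) ^ k * s ^ ((k : ℤ) * ((N : ℤ) - 1)) := by
      rw [← zpow_natCast s k, ← zpow_natCast s 2, ← zpow_natCast (s ^ ((2 : ℕ) : ℤ)),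
        ← zpow_mul, ← zpow_add₀ hs, ← zpow_add₀ hs, ← zpow_add₀ hs]
      congr 1; push_cast; ring
    linear_combination e1 * e2 + q ^ c * e0 * e3

theorem Dominated.last_le {ν lam : Weight (N + 1)} (h : Dominated ν lam) :
    lam.1 (Fin.last N) ≤ ν.1 (Fin.last N) := by
  have h1 := h.1
  rw [Fin.sum_univ_castSucc, Fin.sum_univ_castSucc] at h1
  have h2 : ∑ i : Fin N, ν.1 i.castSucc ≤ ∑ i : Fin N, lam.1 i.castSucc := by
    cases N with
    | zero => simp
    | succ n =>
      have := h.2 (Fin.last n).castSucc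
      rw [← Fin.map_castSuccEmb_Iic, Finset.sum_map, Finset.sum_map, ← Fin.top_eq_last,
        Finset.Iic_top] at this
      exact this
  omega

/-- All exponents of a joint eigenvector are rearrangements of weights below `β`, whose entries are
at least the last entry of `β`. -/
theorem JointEigen.mem_ordGE [CharZero F] (h : IsGeneric q s) {β : Fin (N + 1) → ℤ}
    {v : Laurent F (N + 1)} (hv : JointEigen q s β v) : v ∈ ordGE F (β (Fin.last N)) := by
  intro α hα
  obtain ⟨σ, hσ⟩ := exists_perm_antitone α
  rw [← hv.1 σ α] at hα
  obtain ⟨hβ, hd, -⟩ := hv.dominated h (ν := ⟨α ∘ σ, hσ⟩) hα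
  have h1 := Dominated.last_le hd
  have h2 : (α ∘ σ) (Fin.last N) ≤ (α ∘ σ) (σ.symm (Fin.last N)) := hσ (Fin.le_last _)
  simp only [Function.comp_apply, Equiv.apply_symm_apply] at h1 h2
  omega

end

/-! ### Duality: inverting the parameters and inverting the variables -/

section
variable {F : Type*} [Field F] {N : ℕ} {q s : F}

theorem sum_powersetCard_compl {M : Type*} [AddCommMonoid M] {k : ℕ} (hk : k ≤ N)
    (G : Finset (Fin N) → M) :
    ∑ I ∈ (Finset.univ : Finset (Fin N)).powersetCard k, G Iᶜ =
      ∑ I ∈ (Finset.univ : Finset (Fin N)).powersetCard (N - k), G I := by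
  refine Finset.sum_nbij' (fun I => Iᶜ) (fun I => Iᶜ) ?_ ?_ (fun _ _ => compl_compl _)
    (fun _ _ => compl_compl _) fun _ _ => rfl
  · intro I hI
    rw [Finset.mem_powersetCard_univ] at hI ⊢
    rw [Finset.card_compl, Fintype.card_fin, hI]
  · intro I hI
    rw [Finset.mem_powersetCard_univ] at hI ⊢
    rw [Finset.card_compl, Fintype.card_fin, hI]
    omega

theorem esym_inv {w : Fin N → F} (hw : ∀ i, w i ≠ 0) {k : ℕ} (hk : k ≤ N) :
    esym Finset.univ (fun i => (w i)⁻¹) k = (∏ i, w i)⁻¹ * esym Finset.univ w (N - k) := by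
  rw [esym, esym, ← sum_powersetCard_compl hk, Finset.mul_sum]
  refine Finset.sum_congr rfl fun I _ => ?_
  rw [Finset.prod_inv_distrib, ← Finset.prod_mul_prod_compl I, mul_inv, mul_assoc,
    inv_mul_cancel₀ (Finset.prod_ne_zero_iff.2 fun i _ => hw i), mul_one]

theorem esym_comp_perm (w : Fin N → F) (σ : Equiv.Perm (Fin N)) (k : ℕ) :
    esym Finset.univ (w ∘ σ) k = esym Finset.univ w k := by
  have h : (Finset.univ : Finset (Fin N)) = Finset.univ.map σ.toEmbedding := by simp
  conv_rhs => rw [h]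
  rw [esym, esym, Finset.powersetCard_map, Finset.sum_map]
  refine Finset.sum_congr rfl fun I _ => ?_
  change _ = ∏ i ∈ I.map σ.toEmbedding, w i
  rw [Finset.prod_map]
  rfl

theorem spec_inv (α : Fin N → ℤ) (i : Fin N) : spec q⁻¹ s⁻¹ α i = (spec q s α i)⁻¹ := by
  rw [spec, spec, mul_inv, inv_zpow, inv_zpow]

theorem eig_inv (h : IsGeneric q s) {k : ℕ} (hk : k ≤ N) (α : Fin N → ℤ) :
    eig q⁻¹ s⁻¹ k α = (eig q s N α)⁻¹ * eig q s (N - k) α := by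
  rw [eig_eq_esym, eig_eq_esym, eig_eq_esym]
  have : esym Finset.univ (spec q s α) N = ∏ i, spec q s α i := by
    have := esym_card Finset.univ (spec q s α)
    rwa [Finset.card_univ, Fintype.card_fin] at this
  rw [this, ← esym_inv (h.spec_ne_zero α) hk]
  exact esym_congr _ (fun i _ => spec_inv α i) k

theorem eig_ne_zero (h : IsGeneric q s) (α : Fin N → ℤ) : eig q s N α ≠ 0 := by
  have := esym_card Finset.univ (spec q s α)
  rw [Finset.card_univ, Fintype.card_fin] at this
  rw [eig_eq_esym, this]
  exact Finset.prod_ne_zero_iff.2 fun i _ => h.spec_ne_zero α i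

/-- Inverting `q` and `t` replaces a set `I` by its complement, up to the shift of all variables,
which is a scalar on homogeneous polynomials. -/
theorem macdonaldD_inv (h : IsGeneric q s) {k : ℕ} (hk : k ≤ N) {f : Laurent F N} {c : F}
    (hc : c ≠ 0) (hf : qShift q Finset.univ f = c • f) :
    macdonaldD N q⁻¹ s⁻¹ k f = c⁻¹ • macdonaldD N q s (N - k) f := by
  have h1 : ∀ I, qShift q⁻¹ I f = c⁻¹ • qShift q Iᶜ f := fun I => by
    refine laurent_ext fun α => ?_
    have h2 := congrArg (fun f => f.coeff α) hf
    simp only [coeff_qShift, AddMonoidAlgebra.coeff_smul_apply, smul_eq_mul] at h2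
    rw [coeff_qShift, AddMonoidAlgebra.coeff_smul_apply, coeff_qShift, smul_eq_mul,
      eq_inv_mul_iff_mul_eq₀ hc, mul_left_comm, ← h2, ← mul_assoc]
    congr 1
    rw [← Finset.sum_add_sum_compl I, zpow_add₀ h.q_ne_zero, inv_zpow, inv_mul_cancel_left₀]
    exact zpow_ne_zero _ h.q_ne_zero
  rw [macdonaldD_apply, macdonaldD_apply, ← sum_powersetCard_compl hk, Finset.smul_sum]
  refine Finset.sum_congr rfl fun I _ => ?_
  rw [h1, toRat_smul, compl_compl, Algebra.smul_def, mul_left_comm, Finset.prod_comm]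
  congr 2
  refine Finset.prod_congr rfl fun j _ => Finset.prod_congr rfl fun i _ => ?_
  rw [← neg_div_neg_eq, ← map_neg, ← map_neg, neg_sub, neg_sub, inv_inv]

/-- The joint eigenvectors do not change when `q` and `t` are inverted. -/
theorem JointEigen.inv (h : IsGeneric q s) {β : Fin N → ℤ} {v : Laurent F N}
    (hv : JointEigen q s β v) : JointEigen q⁻¹ s⁻¹ β v := by
  refine ⟨hv.1, fun k => ?_⟩
  rcases lt_or_ge N k with hk | hk
  · rw [macdonaldD_eq h.inv, DifferenceField.D_eq_zero _ hk, eig_eq_zero hk, zero_smul, map_zero]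
  · have h1 : qShift q Finset.univ v = eig q s N β • v := by
      refine toRat_injective ?_
      rw [← hv.2 N, macdonaldD_eq h, macdonaldD_top]
      change _ = scaleFrac _ _
      rw [scaleFrac_toRat, ← qShift_eq_scaleHom, Units.val_mk0]
    rw [macdonaldD_inv h hk (eig_ne_zero h β) h1, hv.2, Algebra.smul_def, ← toRat_smul, smul_smul,
      ← eig_inv h hk]

/-- The involution `X_i ↦ X_i⁻¹`. -/
noncomputable def invVars (F : Type*) [Field F] (N : ℕ) : Laurent F N ≃ₐ[F] Laurent F N :=
  AddMonoidAlgebra.domCongr F F (AddEquiv.neg (Fin N → ℤ))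

theorem coeff_invVars (f : Laurent F N) (α : Fin N → ℤ) :
    (invVars F N f).coeff α = f.coeff (-α) := by
  rw [invVars, AddMonoidAlgebra.coeff_domCongr]
  rfl

theorem invVars_varX (i : Fin N) : invVars F N (varX F i) = varXinv F i := by
  rw [varX, invVars, AddMonoidAlgebra.domCongr_single, varXinv]
  congr 1
  change -(Pi.single i 1 : Fin N → ℤ) = _
  rw [← Pi.single_neg]

theorem invVars_e₁ : invVars F N (e₁ F N) = e₁inv F N := by
  rw [e₁, e₁inv, map_sum]
  exact Finset.sum_congr rfl fun i _ => invVars_varX i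

theorem invVars_mem {f : Laurent F N} (hf : f ∈ symLaurent F N) :
    invVars F N f ∈ symLaurent F N := fun σ α => by
  rw [coeff_invVars, coeff_invVars]
  exact hf σ (-α)

theorem qShift_invVars (q : F) (I : Finset (Fin N)) (f : Laurent F N) :
    qShift q⁻¹ I (invVars F N f) = invVars F N (qShift q I f) :=
  laurent_ext fun α => by
    rw [coeff_qShift, coeff_invVars, coeff_invVars, coeff_qShift]
    simp

theorem toRat_varXinv (i : Fin N) : toRat F N (varXinv F i) = (toRat F N (varX F i))⁻¹ := by
  refine eq_inv_of_mul_eq_one_left ?_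
  rw [← map_mul, varXinv, varX, AddMonoidAlgebra.single_mul_single, ← Pi.single_add]
  simp [← AddMonoidAlgebra.one_def]

/-- The involution `X_i ↦ X_i⁻¹` of the rational functions. -/
noncomputable def invVarsFrac (F : Type*) [Field F] (N : ℕ) : RatFrac F N →+* RatFrac F N :=
  IsFractionRing.lift (A := Laurent F N)
    (g := (toRat F N).comp (invVars F N : Laurent F N →+* Laurent F N))
    (toRat_injective.comp (invVars F N).injective)

theorem invVarsFrac_toRat (f : Laurent F N) :
    invVarsFrac F N (toRat F N f) = toRat F N (invVars F N f) :=
  IsFractionRing.lift_algebraMap _ _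

theorem macdonaldD_invVars (h : IsGeneric q s) (k : ℕ) (f : Laurent F N) :
    macdonaldD N q⁻¹ s⁻¹ k (invVars F N f) = invVarsFrac F N (macdonaldD N q s k f) := by
  rw [macdonaldD_apply, macdonaldD_apply, map_sum]
  refine Finset.sum_congr rfl fun I _ => ?_
  rw [map_mul, invVarsFrac_toRat, qShift_invVars, map_prod]
  congr 1
  refine Finset.prod_congr rfl fun i hi => ?_
  rw [map_prod]
  refine Finset.prod_congr rfl fun j hj => ?_
  have hij : i ≠ j := by rintro rfl; exact (Finset.mem_compl.1 hj) hi
  rw [map_div₀, invVarsFrac_toRat, invVarsFrac_toRat]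
  simp only [map_sub, map_smul, invVars_varX, toRat_smul, toRat_varXinv, inv_inv, map_inv₀]
  have hX : ∀ i : Fin N, toRat F N (varX F i) ≠ 0 := (ratDifferenceField h N).X_ne_zero
  have hs := (ratDifferenceField h N).s_ne_zero
  change algebraMap F (RatFrac F N) s ≠ 0 at hs
  have h1 : toRat F N (varX F i) - toRat F N (varX F j) ≠ 0 :=
    sub_ne_zero.2 fun h' => hij (varX_injective (toRat_injective h'))
  have h2 : (toRat F N (varX F i))⁻¹ - (toRat F N (varX F j))⁻¹ ≠ 0 :=
    sub_ne_zero.2 fun h' => hij (varX_injective (toRat_injective (inv_injective h')))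
  have hi := hX i
  have hj := hX j
  generalize toRat F N (varX F i) = x at *
  generalize toRat F N (varX F j) = y at *
  rw [div_eq_div_iff h1 h2]
  field_simp
  ring

/-- The exponent `(-β_N, …, -β_1)`. -/
def dualWt (β : Fin N → ℤ) : Fin N → ℤ := fun i => -β i.rev

theorem dualWt_dualWt (β : Fin N → ℤ) : dualWt (dualWt β) = β := by
  funext i; simp [dualWt]

theorem dualWt_antitone {β : Fin N → ℤ} (hβ : Antitone β) : Antitone (dualWt β) := fun _ _ hij =>
  neg_le_neg (hβ (Fin.rev_le_rev.2 hij))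

theorem antitone_dualWt_iff {β : Fin N → ℤ} : Antitone (dualWt β) ↔ Antitone β :=
  ⟨fun h => by rw [← dualWt_dualWt β]; exact dualWt_antitone h, dualWt_antitone⟩

theorem eig_dualWt (k : ℕ) (β : Fin N → ℤ) : eig q⁻¹ s⁻¹ k (dualWt β) = eig q s k β := by
  rw [eig_eq_esym, eig_eq_esym, ← esym_comp_perm (spec q s β) Fin.revPerm]
  refine esym_congr _ (fun i _ => ?_) k
  rw [spec, Function.comp_apply, spec, dualWt, Fin.revPerm_apply, inv_zpow', inv_zpow', neg_neg]
  congr 2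
  rw [Fin.val_rev]
  omega

theorem coeff_invVars_dualWt {v : Laurent F N} (hv : v ∈ symLaurent F N) (β : Fin N → ℤ) :
    (invVars F N v).coeff (dualWt β) = v.coeff β := by
  rw [coeff_invVars, ← hv Fin.revPerm]
  congr 1
  funext i
  simp [dualWt]

/-- Inverting the variables inverts `q` and `t` in the Macdonald operators, which the joint
eigenvectors do not see. -/
theorem JointEigen.invVars (h : IsGeneric q s) {β : Fin N → ℤ} {v : Laurent F N}
    (hv : JointEigen q s β v) : JointEigen q s (dualWt β) (invVars F N v) := by
  have h1 : JointEigen q⁻¹ s⁻¹ (dualWt β) (_root_.invVars F N v) :=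
    ⟨invVars_mem hv.1, fun k => by
      rw [macdonaldD_invVars h, hv.2, invVarsFrac_toRat, map_smul, eig_dualWt]⟩
  have h2 := h1.inv h.inv
  rwa [inv_inv, inv_inv] at h2

end

/-! ### Bases of Macdonald polynomials -/

section
variable {F : Type*} [Field F] {N : ℕ} {q s : F}

theorem JointEigen.zero (β : Fin N → ℤ) : JointEigen q s β 0 :=
  ⟨Submodule.zero_mem _, fun k => by rw [map_zero, smul_zero, map_zero]⟩

/-- Joint eigenvectors with distinct exponents are linearly independent: the exponent of greatest
norm does not occur in the other terms. -/
theorem JointEigen.eq_zero_of_sum_eq_zero [CharZero F] (h : IsGeneric q s) {ι : Type*}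
    (A : Finset ι) {β : ι → Fin N → ℤ} (hβ : Function.Injective β) {v : ι → Laurent F N}
    (hv : ∀ i ∈ A, JointEigen q s (β i) (v i)) (h0 : ∑ i ∈ A, v i = 0) : ∀ i ∈ A, v i = 0 := by
  classical
  by_contra! hne
  obtain ⟨i₀, hi₀, hne⟩ := hne
  obtain ⟨i, hi, hmax⟩ := Finset.exists_max_image (A.filter fun i => v i ≠ 0)
    (fun i => ∑ j, β i j ^ 2) ⟨i₀, Finset.mem_filter.2 ⟨hi₀, hne⟩⟩
  rw [Finset.mem_filter] at hi
  have h1 : (v i).coeff (β i) ≠ 0 := fun h1 => hi.2 ((hv i hi.1).eq_zero h h1)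
  have hai : Antitone (β i) := by
    by_contra hna
    exact hi.2 ((hv i hi.1).eq_zero_of_not_antitone h hna)
  have h2 := congrArg (fun f : Laurent F N => f.coeff (β i)) h0
  simp only [coeff_sum'] at h2
  rw [Finset.sum_eq_single_of_mem i hi.1] at h2
  · exact h1 h2
  · intro j hj hji
    by_contra h3
    obtain ⟨haj, hd, -⟩ := (hv j hj).dominated h (ν := ⟨β i, hai⟩) h3
    have hb : Below ⟨β i, hai⟩ ⟨β j, haj⟩ :=
      ⟨hd, fun he => hji (hβ (congrArg Subtype.val he)).symm⟩
    have h4 := hb.normSq_lt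
    have h5 := hmax j (Finset.mem_filter.2 ⟨hj, fun hz => h3 (by rw [hz]; rfl)⟩)
    exact absurd h4 (not_lt.2 h5)

/-- A family of Macdonald polynomials, extended by zero to the exponents that are not dominant. -/
structure IsMacdonaldBasis (q s : F) (P : (Fin N → ℤ) → Laurent F N) : Prop where
  eigen : ∀ α, JointEigen q s α (P α)
  coeff_self : ∀ α, Antitone α → (P α).coeff α = 1

theorem exists_isMacdonaldBasis
    (hex : ∀ lam : Weight N, ∃ P, JointEigen q s lam.1 P ∧ P.coeff lam.1 = 1) :
    ∃ P : (Fin N → ℤ) → Laurent F N, IsMacdonaldBasis q s P := by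
  classical
  choose P hP1 hP2 using hex
  refine ⟨fun α => if hα : Antitone α then P ⟨α, hα⟩ else 0, fun α => ?_, fun α hα => ?_⟩
  · by_cases hα : Antitone α
    · simp only [dif_pos hα]; exact hP1 ⟨α, hα⟩
    · simp only [dif_neg hα]; exact JointEigen.zero α
  · simp only [dif_pos hα]; exact hP2 ⟨α, hα⟩

namespace IsMacdonaldBasis

variable {P : (Fin N → ℤ) → Laurent F N}

/-- The members of the family as symmetric Laurent polynomials. -/
def vec (hP : IsMacdonaldBasis q s P) (α : Fin N → ℤ) : symLaurent F N := ⟨P α, (hP.eigen α).1⟩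

theorem eq_zero [CharZero F] (hP : IsMacdonaldBasis q s P) (h : IsGeneric q s) {α : Fin N → ℤ}
    (hα : ¬ Antitone α) : P α = 0 := (hP.eigen α).eq_zero_of_not_antitone h hα

theorem eq_smul [CharZero F] (hP : IsMacdonaldBasis q s P) (h : IsGeneric q s) {α : Fin N → ℤ}
    {v : Laurent F N} (hv : JointEigen q s α v) : v = v.coeff α • P α := by
  by_cases hα : Antitone α
  · exact hv.eq_smul h (hP.eigen α) (hP.coeff_self α hα)
  · rw [hv.eq_zero_of_not_antitone h hα, hP.eq_zero h hα, smul_zero]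

theorem linearIndependent [CharZero F] (hP : IsMacdonaldBasis q s P) (h : IsGeneric q s) :
    LinearIndependent F (fun lam : Weight N => hP.vec lam.1) := by
  rw [linearIndependent_iff']
  intro A g hg i hi
  have h0 : ∑ i ∈ A, g i • P i.1 = 0 := by
    have := congrArg (fun v : symLaurent F N => (v : Laurent F N)) hg
    simpa [vec] using this
  have h1 := JointEigen.eq_zero_of_sum_eq_zero h A (β := fun lam : Weight N => lam.1)
    Subtype.val_injective (fun i _ => (hP.eigen i.1).smul (g i)) h0 i hi
  have h2 := congrArg (fun f : Laurent F N => f.coeff i.1) h1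
  simp only [AddMonoidAlgebra.coeff_smul_apply, hP.coeff_self _ i.2, smul_eq_mul, mul_one] at h2
  exact h2

theorem monomialSymm_mem_span [CharZero F] (hP : IsMacdonaldBasis q s P) (h : IsGeneric q s)
    (n : ℕ) : ∀ lam : Weight N, (normSq lam).toNat < n →
      monomialSymm F lam ∈ Submodule.span F (Set.range fun lam : Weight N => P lam.1) := by
  induction n with
  | zero => intro _ h; omega
  | succ n ih =>
    intro lam hlam
    obtain ⟨⟨a, ha, he⟩, -⟩ := (isMacdonald_iff h lam (P lam.1)).2
      ⟨hP.eigen _, hP.coeff_self _ lam.2⟩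
    rw [eq_sub_of_add_eq he.symm]
    refine Submodule.sub_mem _ (Submodule.subset_span ⟨lam, rfl⟩)
      (Submodule.sum_mem _ fun μ hμ => Submodule.smul_mem _ _ (ih μ ?_))
    have h1 := Below.normSq_lt (ha μ hμ)
    have h2 := normSq_nonneg μ
    omega

theorem span_eq_top [CharZero F] (hP : IsMacdonaldBasis q s P) (h : IsGeneric q s) :
    ⊤ ≤ Submodule.span F (Set.range fun lam : Weight N => hP.vec lam.1) := by
  intro f _
  have h1 : (f : Laurent F N) ∈ Submodule.span F (Set.range fun lam : Weight N => P lam.1) := by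
    rw [← sum_dominantCoeff f.2]
    exact Submodule.sum_mem _ fun μ _ => Submodule.smul_mem _ _
      (hP.monomialSymm_mem_span h _ μ (Nat.lt_succ_self _))
  have h2 : (Set.range fun lam : Weight N => P lam.1) =
      (symLaurent F N).subtype '' Set.range fun lam : Weight N => hP.vec lam.1 := by
    rw [← Set.range_comp]; rfl
  rw [h2, Submodule.span_image] at h1
  obtain ⟨g, hg, hgf⟩ := h1
  rwa [← Subtype.ext hgf]

/-- The Macdonald polynomials as a basis of the symmetric Laurent polynomials. -/
noncomputable def basis [CharZero F] (hP : IsMacdonaldBasis q s P) (h : IsGeneric q s) :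
    Module.Basis (Weight N) F (symLaurent F N) :=
  Module.Basis.mk (hP.linearIndependent h) (hP.span_eq_top h)

theorem basis_apply [CharZero F] (hP : IsMacdonaldBasis q s P) (h : IsGeneric q s)
    (lam : Weight N) : hP.basis h lam = hP.vec lam.1 := Module.Basis.mk_apply _ _ _

/-- The coordinate of `P_α` at `λ`, valid also for exponents `α` that are not dominant. -/
theorem coord_vec [CharZero F] (hP : IsMacdonaldBasis q s P) (h : IsGeneric q s) (lam : Weight N)
    (α : Fin N → ℤ) : (hP.basis h).coord lam (hP.vec α) = if α = lam.1 then 1 else 0 := by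
  by_cases hα : Antitone α
  · have h1 : hP.vec α = hP.basis h ⟨α, hα⟩ := (hP.basis_apply h ⟨α, hα⟩).symm
    rw [h1, Module.Basis.coord_apply, Module.Basis.repr_self, Finsupp.single_apply]
    simp only [Subtype.ext_iff]
  · have h1 : hP.vec α = 0 := Subtype.ext (hP.eq_zero h hα)
    rw [h1, map_zero, if_neg]
    rintro rfl
    exact hα lam.2

end IsMacdonaldBasis

/-! ### The Pieri coefficients -/

/-- The factor `S₂` at the parameters `q₁ = t⁻¹`, `q₂ = q`, `q₃ = t / q`. -/
def pieriFactor (q s x : F) : F := S₂ (s ^ 2)⁻¹ q (s ^ 2 * q⁻¹) x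

/-- The coefficient `∏_{l < i} S₂(w_l / w_i)` of `P_{α + ε_i}` in `e₁ P_α`. -/
def pieri (q s : F) (α : Fin N → ℤ) (i : Fin N) : F :=
  ∏ l ∈ Finset.Iio i, pieriFactor q s (spec q s α l / spec q s α i)

theorem spec_castSucc (h : IsGeneric q s) (α : Fin (N + 1) → ℤ) (i : Fin N) :
    spec q s α i.castSucc = s * spec q s (α ∘ Fin.castSucc) i := by
  simp only [spec, Function.comp_apply, Fin.val_castSucc]
  rw [← mul_assoc, ← zpow_one_add₀ h.s_ne_zero]
  congr 2; push_cast; ring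

theorem pieri_castSucc (h : IsGeneric q s) (α : Fin (N + 1) → ℤ) (i : Fin N) :
    pieri q s α i.castSucc = pieri q s (α ∘ Fin.castSucc) i := by
  rw [pieri, pieri, ← Fin.map_castSuccEmb_Iio, Finset.prod_map]
  refine Finset.prod_congr rfl fun l _ => ?_
  rw [Fin.coe_castSuccEmb, spec_castSucc h, spec_castSucc h, mul_div_mul_left _ _ h.s_ne_zero]

theorem IsGeneric.spec_div (h : IsGeneric q s) (α : Fin N → ℤ) (i l : Fin N) :
    spec q s α l / spec q s α i = q ^ (α l - α i) * (s ^ 2) ^ (((i : ℕ) : ℤ) - (l : ℕ)) := by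
  have hs := h.s_ne_zero
  rw [div_eq_iff (h.spec_ne_zero α i), spec, spec, zpow_sub₀ h.q_ne_zero]
  have h2 : s ^ ((N : ℤ) - 1 - 2 * ((l : ℕ) : ℤ)) =
      s ^ ((N : ℤ) - 1 - 2 * ((i : ℕ) : ℤ)) * (s ^ 2) ^ (((i : ℕ) : ℤ) - (l : ℕ)) := by
    rw [← zpow_natCast s 2, ← zpow_mul, ← zpow_add₀ hs]
    congr 1; push_cast; ring
  have := zpow_ne_zero (α i) h.q_ne_zero
  rw [h2]
  field_simp

/-- Ratios of spectral coordinates take the value `q^a t^b` only where expected. -/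
theorem IsGeneric.spec_div_eq (h : IsGeneric q s) {α : Fin N → ℤ} {i l : Fin N} (a b : ℤ)
    (he : spec q s α l / spec q s α i = q ^ a * (s ^ 2) ^ b) :
    ((i : ℕ) : ℤ) - (l : ℕ) = b ∧ α l = α i + a := by
  have hs := zpow_ne_zero b (pow_ne_zero 2 h.s_ne_zero)
  have hq := zpow_ne_zero a h.q_ne_zero
  have h1 : q ^ (α l - α i - a) * (s ^ 2) ^ (((i : ℕ) : ℤ) - (l : ℕ) - b) = 1 := by
    rw [zpow_sub₀ h.q_ne_zero, zpow_sub₀ (pow_ne_zero 2 h.s_ne_zero), div_mul_div_comm,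
      ← h.spec_div, he, div_self (mul_ne_zero hq hs)]
  have h2 := h.eq_zero_of_zpow_mul _ _ h1
  exact ⟨by omega, by omega⟩

theorem pieri_ne_zero (h : IsGeneric q s) {α : Fin N → ℤ} {i : Fin N}
    (hi : Antitone (α + Pi.single i 1)) : pieri q s α i ≠ 0 := by
  refine Finset.prod_ne_zero_iff.2 fun l hl => ?_
  have hl' := Finset.mem_Iio.1 hl
  have hs := h.s_ne_zero
  have hq := h.q_ne_zero
  have h1 := h.spec_div_eq (α := α) (i := i) (l := l)
  have h2 := hi hl'.le
  rw [Pi.add_apply, Pi.add_apply, Pi.single_eq_same, Pi.single_eq_of_ne hl'.ne, add_zero] at h2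
  generalize spec q s α l / spec q s α i = x at *
  have hv : (l : ℕ) < (i : ℕ) := hl'
  -- By genericity the only factor that could vanish is `1 - q₁ x`, for `l = i - 1` and equal row
  -- lengths; then the box could not be added.
  refine div_ne_zero (mul_ne_zero ?_ ?_) (mul_ne_zero ?_ ?_)
  · intro h0
    have := h1 1 (-1) (by
      rw [zpow_one, zpow_neg_one]; field_simp; field_simp at h0; linear_combination -h0)
    omega
  · intro h0
    have := h1 0 1 (by
      rw [zpow_zero, zpow_one]; field_simp at h0; linear_combination -h0)
    omega
  · intro h0
    have := h1 0 0 (by rw [zpow_zero, zpow_zero]; linear_combination -h0)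
    omega
  · intro h0
    have := h1 1 0 (by rw [zpow_one, zpow_zero]; field_simp at h0; linear_combination -h0)
    omega

end

/-! ### Existence of Macdonald polynomials -/

section
variable {F : Type*} [Field F] {N : ℕ} {q s : F}

/-- The Pieri formula for a family of Macdonald polynomials. -/
def HasPieri (q s : F) (P : (Fin N → ℤ) → Laurent F N) : Prop :=
  ∀ α, Antitone α → e₁ F N * P α = ∑ i, pieri q s α i • P (α + Pi.single i 1)

theorem add_single_injective (α : Fin N → ℤ) :
    Function.Injective fun i => α + (Pi.single i 1 : Fin N → ℤ) := fun i j hij => by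
  by_contra hne
  have := congrFun (add_left_cancel hij) i
  rw [Pi.single_eq_same, Pi.single_eq_of_ne hne] at this
  exact one_ne_zero this

theorem add_single_castSucc (β : Fin (N + 1) → ℤ) (j : Fin N) :
    (β + Pi.single j.castSucc 1) ∘ Fin.castSucc = β ∘ Fin.castSucc + Pi.single j 1 := by
  funext i
  simp [Pi.single_apply]

theorem add_single_castSucc_last (β : Fin (N + 1) → ℤ) (j : Fin N) :
    (β + (Pi.single j.castSucc 1 : Fin (N + 1) → ℤ)) (Fin.last N) = β (Fin.last N) := by
  rw [Pi.add_apply, Pi.single_eq_of_ne (Fin.castSucc_ne_last j).symm, add_zero]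

/-- The Pieri formula in `N` variables determines all but the last coefficient of the Pieri formula
in `N + 1` variables. -/
theorem coeff_pieri_castSucc [CharZero F] (h : IsGeneric q s) {P : (Fin N → ℤ) → Laurent F N}
    (hP : IsMacdonaldBasis q s P) (hPi : HasPieri q s P) {β : Fin (N + 1) → ℤ} (hβ : Antitone β)
    {p : Laurent F (N + 1)} (hp : JointEigen q s β p) (hp1 : p.coeff β = 1)
    {v : Fin (N + 1) → Laurent F (N + 1)} (hv : e₁ F (N + 1) * p = ∑ j, v j)
    (hvj : ∀ j, JointEigen q s (β + Pi.single j 1) (v j)) (j : Fin N)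
    (hj : Antitone (β + Pi.single j.castSucc 1)) :
    (v j.castSucc).coeff (β + Pi.single j.castSucc 1) = pieri q s β j.castSucc := by
  have hmono : Monotone (Fin.castSucc : Fin N → Fin (N + 1)) := Fin.strictMono_castSucc.monotone
  have hcast : ∀ i : Fin N, JointEigen q s (β ∘ Fin.castSucc + Pi.single i 1)
      (res F (β (Fin.last N)) (v i.castSucc)) := fun i => by
    have := (hvj i.castSucc).res h ((hvj i.castSucc).mem_ordGE h)
    rwa [add_single_castSucc_last, add_single_castSucc] at this
  -- A box in the last row raises the order in the last variable.
  have hlast : res F (β (Fin.last N)) (v (Fin.last N)) = 0 := by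
    refine laurent_ext fun α => ?_
    by_contra h0
    rw [coeff_res] at h0
    have := (hvj (Fin.last N)).mem_ordGE h _ h0
    rw [Pi.add_apply, Pi.single_eq_same, Fin.snoc_last] at this
    omega
  have hres : res F (β (Fin.last N)) p = P (β ∘ Fin.castSucc) := by
    have h1 := hP.eq_smul h (hp.res h (hp.mem_ordGE h))
    rwa [coeff_res, snoc_comp_castSucc, hp1, one_smul] at h1
  have h1 := (res_mul e₁_mem_ordGE (hp.mem_ordGE h)).1
  rw [zero_add, res_e₁, hres, hPi _ (hβ.comp_monotone hmono), hv, Fin.sum_univ_castSucc, map_add,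
    hlast, add_zero, map_sum, ← sub_eq_zero, ← Finset.sum_sub_distrib] at h1
  have h2 := JointEigen.eq_zero_of_sum_eq_zero h Finset.univ
    (add_single_injective (β ∘ Fin.castSucc))
    (fun i _ => (hcast i).sub ((hP.eigen _).smul _)) h1 j (Finset.mem_univ j)
  have h3 := congrArg (fun f : Laurent F N => f.coeff (β ∘ Fin.castSucc + Pi.single j 1)) h2
  have h4 : Antitone (β ∘ Fin.castSucc + Pi.single j 1) := by
    rw [← add_single_castSucc]
    exact hj.comp_monotone hmono
  simp only [AddMonoidAlgebra.coeff_sub, Finsupp.sub_apply, AddMonoidAlgebra.coeff_smul_apply,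
    hP.coeff_self _ h4, smul_eq_mul, mul_one, coeff_res] at h3
  rw [pieri_castSucc h, ← sub_eq_zero]
  have h5 := snoc_comp_castSucc (β + (Pi.single j.castSucc 1 : Fin (N + 1) → ℤ))
  rw [add_single_castSucc, add_single_castSucc_last] at h5
  rwa [h5] at h3

/-- A constant weight is minimal for the dominance order. -/
theorem eq_of_dominated_const {ν lam : Weight N} {c : ℤ} (hlam : ∀ i, lam.1 i = c)
    (h : Dominated ν lam) : ν = lam := by
  have hle : ∀ i, ν.1 i ≤ lam.1 i := fun i => by
    have : NeZero N := ⟨by have := i.2; omega⟩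
    have h0 := h.2 0
    have h1 : Finset.Iic (0 : Fin N) = {0} := by
      ext j
      rw [Finset.mem_Iic, Finset.mem_singleton]
      exact ⟨fun h => le_antisymm h (Fin.zero_le j), fun h => h ▸ le_rfl⟩
    rw [h1, Finset.sum_singleton, Finset.sum_singleton] at h0
    have h2 := ν.2 (Fin.zero_le i)
    rw [hlam] at h0 ⊢
    exact h2.trans h0
  have h3 := (Finset.sum_eq_sum_iff_of_le fun i (_ : i ∈ Finset.univ) => hle i).1 h.1
  exact Subtype.ext (funext fun i => h3 i (Finset.mem_univ i))

theorem exists_jointEigen_const [CharZero F] (h : IsGeneric q s) {lam : Weight N} {c : ℤ}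
    (hlam : ∀ i, lam.1 i = c) : ∃ P, JointEigen q s lam.1 P ∧ P.coeff lam.1 = 1 := by
  refine ⟨monomialSymm F lam, ⟨monomialSymm_mem lam, fun k => ?_⟩, ?_⟩
  · obtain ⟨g, hg, he⟩ := exists_macdonaldD_monomialSymm h k lam
    have h0 : g = 0 := symLaurent_ext hg.1 (Submodule.zero_mem _) fun ν => by
      by_contra hne
      have hb := hg.2 ν hne
      exact hb.2 (eq_of_dominated_const hlam hb.1)
    rw [he, h0, add_zero]
  · rw [coeff_monomialSymm_weight, if_pos rfl]

/-- A dominant weight that is not constant is obtained from another one by adding a box to a row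
other than the last. -/
theorem exists_sub_single_antitone {α : Fin (N + 1) → ℤ} (hα : Antitone α)
    (hne : ∃ i, α i ≠ α (Fin.last N)) :
    ∃ i : Fin N, Antitone (α - Pi.single i.castSucc 1) := by
  obtain ⟨i₀, hi₀⟩ := hne
  obtain ⟨i, hi, hmax⟩ := Finset.exists_max_image
    (Finset.univ.filter fun i => α i ≠ α (Fin.last N)) id
    ⟨i₀, Finset.mem_filter.2 ⟨Finset.mem_univ _, hi₀⟩⟩
  rw [Finset.mem_filter] at hi
  have hil : i ≠ Fin.last N := fun h => hi.2 (by rw [h])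
  obtain ⟨i, rfl⟩ := Fin.exists_castSucc_eq.2 hil
  refine ⟨i, fun j k hjk => ?_⟩
  rw [Pi.sub_apply, Pi.sub_apply, Pi.single_apply, Pi.single_apply]
  have h1 := hα hjk
  have h2 := hα (Fin.le_last i.castSucc)
  by_cases h3 : k = i.castSucc
  · rw [if_pos h3]
    split_ifs <;> omega
  · rw [if_neg h3]
    split_ifs with h4
    · subst h4
      have h5 : α k = α (Fin.last N) := by
        by_contra h6
        have := hmax k (Finset.mem_filter.2 ⟨Finset.mem_univ _, h6⟩)
        exact h3 (le_antisymm this hjk)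
      have := hi.2
      omega
    · omega

/-- Existence of the Macdonald polynomials in `N + 1` variables. For a constant weight `m_λ` is an
eigenvector; otherwise `λ = μ + ε_i` with `i` not the last row, and the component of `e₁ P_μ` at `λ`
does not vanish because its leading coefficient is a Pieri coefficient in `N` variables. -/
theorem exists_jointEigen_succ [CharZero F] (h : IsGeneric q s) {P : (Fin N → ℤ) → Laurent F N}
    (hP : IsMacdonaldBasis q s P) (hPi : HasPieri q s P) (n : ℕ) :
    ∀ lam : Weight (N + 1), ∑ i, (lam.1 i - lam.1 (Fin.last N)) < n →
      ∃ P, JointEigen q s lam.1 P ∧ P.coeff lam.1 = 1 := by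
  induction n with
  | zero =>
    intro lam hlam
    exact absurd hlam (not_lt.2 (Finset.sum_nonneg fun i _ =>
      sub_nonneg.2 (lam.2 (Fin.le_last i))))
  | succ n ih =>
    intro lam hlam
    by_cases hc : ∃ i, lam.1 i ≠ lam.1 (Fin.last N)
    · obtain ⟨i, hi⟩ := exists_sub_single_antitone lam.2 hc
      obtain ⟨p, hp, hp1⟩ := ih ⟨_, hi⟩ (by
        simp only [Pi.sub_apply, Pi.single_eq_of_ne (Fin.castSucc_ne_last i).symm, sub_zero]
        have h1 : ∑ j, (Pi.single i.castSucc 1 : Fin (N + 1) → ℤ) j = 1 := by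
          rw [Finset.sum_pi_single' i.castSucc (1 : ℤ) Finset.univ, if_pos (Finset.mem_univ _)]
        have h2 : ∑ j, (lam.1 j - (Pi.single i.castSucc 1 : Fin (N + 1) → ℤ) j -
            lam.1 (Fin.last N)) = ∑ j, (lam.1 j - lam.1 (Fin.last N)) - 1 := by
          conv_rhs => rw [← h1, ← Finset.sum_sub_distrib]
          exact Finset.sum_congr rfl fun j _ => by ring
        rw [h2]
        push_cast at hlam
        omega)
      have he : lam.1 - Pi.single i.castSucc 1 + Pi.single i.castSucc 1 = lam.1 :=
        sub_add_cancel _ _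
      obtain ⟨v, hv, hvj⟩ := hp.exists_e₁_mul_eq_sum h
      have h1 := coeff_pieri_castSucc h hP hPi hi hp hp1 hv hvj i (by rw [he]; exact lam.2)
      have h2 : pieri q s (lam.1 - Pi.single i.castSucc 1) i.castSucc ≠ 0 :=
        pieri_ne_zero h (by rw [he]; exact lam.2)
      have h3 := hvj i.castSucc
      rw [he] at h1 h3
      refine ⟨_, h3.smul (pieri q s (lam.1 - Pi.single i.castSucc 1) i.castSucc)⁻¹, ?_⟩
      rw [AddMonoidAlgebra.coeff_smul_apply, h1, smul_eq_mul, inv_mul_cancel₀ h2]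
    · push Not at hc
      exact exists_jointEigen_const h hc

theorem dualWt_dualWt_add_single (α : Fin N → ℤ) (i : Fin N) :
    dualWt (dualWt α + Pi.single i.rev 1) = α - Pi.single i 1 := by
  funext j
  simp [dualWt, Pi.single_apply, Fin.rev_eq_iff]
  ring

/-! ### Multiplication operators in a Macdonald basis -/

/-- The coefficient of `P_{α + ε_i}` in `e₁ P_α`, and `0` if `α + ε_i` is not dominant. -/
noncomputable def IsMacdonaldBasis.pieriCoeff [CharZero F] {P : (Fin N → ℤ) → Laurent F N}
    (hP : IsMacdonaldBasis q s P) (h : IsGeneric q s) (α : Fin N → ℤ) (i : Fin N) : F :=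
  if Antitone (α + Pi.single i 1) then
    ((hP.eigen α).exists_e₁_mul_eq_sum h).choose i |>.coeff (α + Pi.single i 1) else 0

namespace IsMacdonaldBasis

variable {P : (Fin N → ℤ) → Laurent F N}

theorem e₁_mul [CharZero F] (hP : IsMacdonaldBasis q s P) (h : IsGeneric q s) (α : Fin N → ℤ) :
    e₁ F N * P α = ∑ i, hP.pieriCoeff h α i • P (α + Pi.single i 1) := by
  obtain ⟨h1, h2⟩ := ((hP.eigen α).exists_e₁_mul_eq_sum h).choose_spec
  refine h1.trans (Finset.sum_congr rfl fun i _ => ?_)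
  rw [pieriCoeff]
  split_ifs with hi
  · exact hP.eq_smul h (h2 i)
  · rw [zero_smul]
    exact (h2 i).eq_zero_of_not_antitone h hi

theorem pieriCoeff_eq_zero [CharZero F] (hP : IsMacdonaldBasis q s P) (h : IsGeneric q s)
    {α : Fin N → ℤ} {i : Fin N} (hi : ¬ Antitone (α + Pi.single i 1)) :
    hP.pieriCoeff h α i = 0 := if_neg hi

theorem pieriCoeff_castSucc [CharZero F] {P' : (Fin (N + 1) → ℤ) → Laurent F (N + 1)}
    (hP' : IsMacdonaldBasis q s P') (h : IsGeneric q s) (hP : IsMacdonaldBasis q s P)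
    (hPi : HasPieri q s P) {α : Fin (N + 1) → ℤ} (hα : Antitone α) (i : Fin N)
    (hi : Antitone (α + Pi.single i.castSucc 1)) :
    hP'.pieriCoeff h α i.castSucc = pieri q s α i.castSucc := by
  obtain ⟨h1, h2⟩ := ((hP'.eigen α).exists_e₁_mul_eq_sum h).choose_spec
  rw [pieriCoeff, if_pos hi]
  exact coeff_pieri_castSucc h hP hPi hα (hP'.eigen α) (hP'.coeff_self α hα) h1 h2 i hi

theorem invVars_apply [CharZero F] (hP : IsMacdonaldBasis q s P) (h : IsGeneric q s)
    (α : Fin N → ℤ) : invVars F N (P α) = P (dualWt α) := by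
  by_cases hα : Antitone α
  · rw [hP.eq_smul h ((hP.eigen α).invVars h), coeff_invVars_dualWt (hP.eigen α).1,
      hP.coeff_self α hα, one_smul]
  · rw [hP.eq_zero h hα, hP.eq_zero h (mt antitone_dualWt_iff.1 hα), map_zero]

/-- The expansion of `e₁(X⁻¹) P_α` is the image of that of `e₁ P` under the duality. -/
theorem e₁inv_mul [CharZero F] (hP : IsMacdonaldBasis q s P) (h : IsGeneric q s)
    (α : Fin N → ℤ) : e₁inv F N * P α =
      ∑ i, hP.pieriCoeff h (dualWt α) i.rev • P (α - Pi.single i 1) := by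
  have h1 := congrArg (invVars F N) (hP.e₁_mul h (dualWt α))
  rw [map_mul, invVars_e₁, hP.invVars_apply h, dualWt_dualWt, map_sum] at h1
  rw [h1, ← Equiv.sum_comp Fin.revPerm]
  refine Finset.sum_congr rfl fun i _ => ?_
  rw [map_smul, hP.invVars_apply h, Fin.revPerm_apply, dualWt_dualWt_add_single]

end IsMacdonaldBasis
end

/-! ### The norm relations -/

section
variable {F : Type*} [Field F] {N : ℕ} {q s : F}

theorem eig_one (α : Fin N → ℤ) : eig q s 1 α = ∑ i, spec q s α i := by
  rw [eig_eq_esym, esym, Finset.powersetCard_one, Finset.sum_map]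
  exact Finset.sum_congr rfl fun i _ => Finset.prod_singleton _ _

theorem eig_one_add_single (h : IsGeneric q s) (α : Fin N → ℤ) (i : Fin N) :
    eig q s 1 (α + Pi.single i 1) = eig q s 1 α + (q - 1) * spec q s α i := by
  rw [eig_one, eig_one, spec_add_single h, Finset.sum_update_of_mem (Finset.mem_univ i),
    ← Finset.add_sum_erase _ _ (Finset.mem_univ i), Finset.sdiff_singleton_eq_erase]
  ring

theorem spec_sub_single (h : IsGeneric q s) (α : Fin N → ℤ) (j : Fin N) :
    spec q s (α - Pi.single j 1) = Function.update (spec q s α) j (q⁻¹ * spec q s α j) := by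
  have h1 := spec_add_single h (α - Pi.single j 1) j
  rw [sub_add_cancel] at h1
  rw [h1, Function.update_self, inv_mul_cancel_left₀ h.q_ne_zero, Function.update_idem,
    Function.update_eq_self]

theorem spec_dualWt (β : Fin N → ℤ) (i : Fin N) :
    spec q s (dualWt β) i.rev = (spec q s β i)⁻¹ := by
  rw [spec, spec, dualWt, Fin.rev_rev, mul_inv, ← zpow_neg, ← zpow_neg]
  congr 2
  rw [Fin.val_rev]
  omega

namespace IsMacdonaldBasis

variable {P : (Fin N → ℤ) → Laurent F N}

/-- The product of the coefficient of `P_{α + ε_i}` in `e₁ P_α` and the coefficient of `P_α` in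
`e₁(X⁻¹) P_{α + ε_i}`. -/
noncomputable def normCoeff [CharZero F] (hP : IsMacdonaldBasis q s P) (h : IsGeneric q s)
    (α : Fin N → ℤ) (i : Fin N) : F :=
  hP.pieriCoeff h α i * hP.pieriCoeff h (dualWt (α + Pi.single i 1)) i.rev

theorem dualWt_add_single (α : Fin N → ℤ) (i : Fin N) :
    dualWt (α + Pi.single i 1) + Pi.single i.rev 1 = dualWt α := by
  funext j
  by_cases hj : j = i.rev
  · subst hj; simp [dualWt]
  · have : j.rev ≠ i := fun h => hj (by rw [← h, Fin.rev_rev])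
    simp [dualWt, hj, this]

theorem normCoeff_eq_zero [CharZero F] (hP : IsMacdonaldBasis q s P) (h : IsGeneric q s)
    {α : Fin N → ℤ} {i : Fin N} (hα : ¬ (Antitone α ∧ Antitone (α + Pi.single i 1))) :
    hP.normCoeff h α i = 0 := by
  rw [normCoeff]
  by_cases h1 : Antitone (α + Pi.single i 1)
  · rw [hP.pieriCoeff_eq_zero h (α := dualWt _), mul_zero]
    rw [dualWt_add_single, antitone_dualWt_iff]
    exact fun h2 => hα ⟨h2, h1⟩
  · rw [hP.pieriCoeff_eq_zero h h1, zero_mul]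

theorem symMul_e₁_vec [CharZero F] (hP : IsMacdonaldBasis q s P) (h : IsGeneric q s)
    (α : Fin N → ℤ) : symMul ⟨e₁ F N, e₁_mem⟩ (hP.vec α) =
      ∑ i, hP.pieriCoeff h α i • hP.vec (α + Pi.single i 1) := by
  refine Subtype.ext ?_
  rw [coe_symMul, AddSubmonoidClass.coe_finsetSum]
  exact hP.e₁_mul h α

theorem symMul_e₁inv_vec [CharZero F] (hP : IsMacdonaldBasis q s P) (h : IsGeneric q s)
    (α : Fin N → ℤ) : symMul ⟨e₁inv F N, e₁inv_mem⟩ (hP.vec α) =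
      ∑ i, hP.pieriCoeff h (dualWt α) i.rev • hP.vec (α - Pi.single i 1) := by
  refine Subtype.ext ?_
  rw [coe_symMul, AddSubmonoidClass.coe_finsetSum]
  exact hP.e₁inv_mul h α

theorem symD_vec [CharZero F] (hP : IsMacdonaldBasis q s P) (h : IsGeneric q s)
    (α : Fin N → ℤ) (k : ℕ) : symD h N k (hP.vec α) = eig q s k α • hP.vec α :=
  symLaurent_ext_toRat (by
    rw [toRat_symD, ← macdonaldD_eq]
    exact (hP.eigen α).2 k)

theorem symE_vec [CharZero F] (hP : IsMacdonaldBasis q s P) (h : IsGeneric q s)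
    (α : Fin N → ℤ) : symE h N (hP.vec α) =
      ∑ i, (hP.pieriCoeff h α i * spec q s α i) • hP.vec (α + Pi.single i 1) := by
  have hq : q - 1 ≠ 0 := sub_ne_zero.2 h.q_ne_one
  rw [symE, LinearMap.smul_apply, LinearMap.sub_apply, Module.End.mul_apply, Module.End.mul_apply,
    hP.symD_vec h, map_smul, hP.symMul_e₁_vec h, map_sum, Finset.smul_sum,
    ← Finset.sum_sub_distrib, Finset.smul_sum]
  refine Finset.sum_congr rfl fun i _ => ?_
  rw [map_smul, hP.symD_vec h, smul_smul, smul_smul, ← sub_smul, smul_smul, eig_one_add_single h]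
  congr 1
  field_simp
  ring

theorem symE_symMul_e₁inv [CharZero F] (h : IsGeneric q s) (v : symLaurent F N) :
    symE h N (symMul ⟨e₁inv F N, e₁inv_mem⟩ v) =
      symMul ⟨e₁inv F N, e₁inv_mem⟩ (symE h N v) + (q⁻¹ - 1) • symD h N 1 v :=
  symLaurent_ext_toRat (by
    rw [Submodule.coe_add, Submodule.coe_smul, map_add, toRat_smul]
    simp only [toRat_symD, toRat_symE, coe_symMul, map_mul, toRat_e₁inv h]
    rw [DifferenceField.E_eInv_mul, map_sub, map_one, map_inv₀]
    rfl)

theorem add_single_sub_single_eq (α : Fin N → ℤ) (i j : Fin N) :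
    α + Pi.single i 1 - Pi.single j 1 = α ↔ j = i := by
  rw [add_sub_assoc, add_eq_left, sub_eq_zero]
  constructor
  · intro h
    by_contra hne
    have := congrFun h j
    rw [Pi.single_eq_same, Pi.single_eq_of_ne hne] at this
    exact zero_ne_one this
  · rintro rfl; rfl

theorem sub_single_add_single_eq (α : Fin N → ℤ) (i j : Fin N) :
    α - Pi.single i 1 + Pi.single j 1 = α ↔ j = i := by
  rw [sub_add_eq_add_sub, add_single_sub_single_eq, eq_comm]

/-- The diagonal coefficient of first adding and then removing a box, with a weight `c i` on adding
a box to row `i`. -/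
theorem coord_e₁inv_sum [CharZero F] (hP : IsMacdonaldBasis q s P) (h : IsGeneric q s)
    (lam : Weight N) (c : Fin N → F) :
    (hP.basis h).coord lam (symMul ⟨e₁inv F N, e₁inv_mem⟩
      (∑ i, (hP.pieriCoeff h lam.1 i * c i) • hP.vec (lam.1 + Pi.single i 1))) =
      ∑ i, c i * hP.normCoeff h lam.1 i := by
  rw [map_sum, map_sum]
  refine Finset.sum_congr rfl fun i _ => ?_
  rw [map_smul, map_smul, hP.symMul_e₁inv_vec h, map_sum, Finset.sum_eq_single i]
  · rw [map_smul, hP.coord_vec h, if_pos ((add_single_sub_single_eq _ _ _).2 rfl), normCoeff]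
    simp only [smul_eq_mul]
    ring
  · intro j _ hj
    rw [map_smul, hP.coord_vec h, if_neg (mt (add_single_sub_single_eq _ _ _).1 hj), smul_zero]
  · exact fun h => absurd (Finset.mem_univ i) h

/-- The diagonal coefficient of first removing a box and then applying an operator that adds one. -/
theorem coord_sum_e₁inv [CharZero F] (hP : IsMacdonaldBasis q s P) (h : IsGeneric q s)
    (lam : Weight N) (T : Module.End F (symLaurent F N)) (c : (Fin N → ℤ) → Fin N → F)
    (hT : ∀ α, T (hP.vec α) = ∑ i, (hP.pieriCoeff h α i * c α i) • hP.vec (α + Pi.single i 1)) :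
    (hP.basis h).coord lam (T (symMul ⟨e₁inv F N, e₁inv_mem⟩ (hP.vec lam.1))) =
      ∑ i, c (lam.1 - Pi.single i 1) i * hP.normCoeff h (lam.1 - Pi.single i 1) i := by
  rw [hP.symMul_e₁inv_vec h, map_sum, map_sum]
  refine Finset.sum_congr rfl fun i _ => ?_
  rw [map_smul, map_smul, hT, map_sum, Finset.sum_eq_single i]
  · rw [map_smul, hP.coord_vec h, if_pos ((sub_single_add_single_eq _ _ _).2 rfl), normCoeff,
      sub_add_cancel]
    simp only [smul_eq_mul]
    ring
  · intro j _ hj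
    rw [map_smul, hP.coord_vec h, if_neg (mt (sub_single_add_single_eq _ _ _).1 hj), smul_zero]
  · exact fun h => absurd (Finset.mem_univ i) h

/-- The diagonal part of the relation `[e₁, e₁(X⁻¹)] = 0`. -/
theorem sum_normCoeff [CharZero F] (hP : IsMacdonaldBasis q s P) (h : IsGeneric q s)
    (lam : Weight N) : ∑ i, hP.normCoeff h lam.1 i =
      ∑ i, hP.normCoeff h (lam.1 - Pi.single i 1) i := by
  have h1 := hP.coord_e₁inv_sum h lam fun _ => 1
  have h2 := hP.coord_sum_e₁inv h lam (symMul ⟨e₁ F N, e₁_mem⟩) (fun _ _ => 1) fun α => by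
    simp only [mul_one, hP.symMul_e₁_vec h]
  simp only [mul_one, one_mul, ← hP.symMul_e₁_vec h] at h1 h2
  rw [← h1, ← h2]
  congr 1
  exact Subtype.ext (mul_left_comm _ _ _)

/-- The diagonal part of the relation between `∑ A_i X_i T_i`, `e₁(X⁻¹)` and `D^{(1)}`. -/
theorem sum_spec_mul_normCoeff [CharZero F] (hP : IsMacdonaldBasis q s P) (h : IsGeneric q s)
    (lam : Weight N) : ∑ i, q⁻¹ * spec q s lam.1 i * hP.normCoeff h (lam.1 - Pi.single i 1) i =
      ∑ i, spec q s lam.1 i * hP.normCoeff h lam.1 i +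
        (q⁻¹ - 1) * ∑ i, spec q s lam.1 i := by
  have h1 := hP.coord_e₁inv_sum h lam fun i => spec q s lam.1 i
  have h2 := hP.coord_sum_e₁inv h lam (symE h N) (fun α i => spec q s α i) (hP.symE_vec h)
  rw [← hP.symE_vec h] at h1
  rw [symE_symMul_e₁inv, map_add, map_smul, h1, hP.symD_vec h, map_smul, hP.coord_vec h,
    if_pos rfl, eig_one, smul_eq_mul, smul_eq_mul, mul_one] at h2
  rw [h2]
  refine Finset.sum_congr rfl fun i _ => ?_
  rw [spec_sub_single h, Function.update_self]

end IsMacdonaldBasis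
end

/-! ### The Pieri formula -/

section
variable {F : Type*} [Field F] {N : ℕ} {q s : F}

theorem pieriFactor_reflect (h : IsGeneric q s) {x : F} (hx : x ≠ 0) :
    pieriFactor q s (q / x) = pieriFactor q s x := by
  have hq := h.q_ne_zero
  have hs := h.s_ne_zero
  exact S₂_reflect q _ _ x hq hx (by field_simp)

/-- The expected coefficient of `P_{β - ε_i}` in `e₁(X⁻¹) P_β`. -/
theorem pieri_dualWt (h : IsGeneric q s) (β : Fin N → ℤ) (i : Fin N) :
    pieri q s (dualWt β) i.rev =
      ∏ l ∈ Finset.Ioi i, pieriFactor q s (q * spec q s β l / spec q s β i) := by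
  have h1 : Finset.Iio i.rev = (Finset.Ioi i).map Fin.revPerm.toEmbedding := by
    ext l
    simp only [Finset.mem_Iio, Finset.mem_map, Finset.mem_Ioi]
    constructor
    · intro hl
      exact ⟨l.rev, Fin.lt_rev_iff.1 hl, Fin.rev_rev l⟩
    · rintro ⟨l, hl, rfl⟩
      exact Fin.rev_lt_rev.2 hl
  rw [pieri, h1, Finset.prod_map]
  refine Finset.prod_congr rfl fun l _ => ?_
  have hl := h.spec_ne_zero β l
  have hi := h.spec_ne_zero β i
  change pieriFactor q s (spec q s (dualWt β) l.rev / _) = _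
  rw [spec_dualWt, spec_dualWt, ← pieriFactor_reflect h (div_ne_zero (inv_ne_zero hl)
    (inv_ne_zero hi))]
  congr 1
  field_simp

/-- The expected value `∏_{l ≠ i} S₂(w_l / w_i)` of `IsMacdonaldBasis.normCoeff`. -/
def normFactor (q s : F) (α : Fin N → ℤ) (i : Fin N) : F :=
  ∏ l ∈ Finset.univ.erase i, pieriFactor q s (spec q s α l / spec q s α i)

theorem pieri_mul_pieri_dualWt (h : IsGeneric q s) (α : Fin N → ℤ) (i : Fin N) :
    pieri q s α i * pieri q s (dualWt (α + Pi.single i 1)) i.rev = normFactor q s α i := by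
  have h1 : (Finset.univ : Finset (Fin N)).erase i = Finset.Iio i ∪ Finset.Ioi i := by
    ext l
    simp only [Finset.mem_erase, Finset.mem_univ, and_true, Finset.mem_union, Finset.mem_Iio,
      Finset.mem_Ioi]
    exact lt_or_lt_iff_ne.symm
  rw [pieri_dualWt h, pieri, normFactor, h1, Finset.prod_union (Finset.disjoint_left.2
    fun l hl hl' => lt_asymm (Finset.mem_Iio.1 hl) (Finset.mem_Ioi.1 hl'))]
  congr 1
  refine Finset.prod_congr rfl fun l hl => ?_
  have hli : l ≠ i := (Finset.mem_Ioi.1 hl).ne'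
  rw [spec_add_single h, Function.update_self, Function.update_of_ne hli,
    mul_div_mul_left _ _ h.q_ne_zero]

theorem normFactor_sub_single (h : IsGeneric q s) (α : Fin N → ℤ) (i : Fin N) :
    normFactor q s (α - Pi.single i 1) i =
      ∏ l ∈ Finset.univ.erase i, pieriFactor q s (q * spec q s α l / spec q s α i) := by
  refine Finset.prod_congr rfl fun l hl => ?_
  have hli : l ≠ i := (Finset.mem_erase.1 hl).1
  have hq := h.q_ne_zero
  have hi := h.spec_ne_zero α i
  rw [spec_sub_single h, Function.update_self, Function.update_of_ne hli]
  congr 1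
  field_simp

theorem normFactor_identities (h : IsGeneric q s) (α : Fin N → ℤ) :
    ∑ i, normFactor q s α i = ∑ i, normFactor q s (α - Pi.single i 1) i ∧
      ∑ i, q⁻¹ * spec q s α i * normFactor q s (α - Pi.single i 1) i =
        ∑ i, spec q s α i * normFactor q s α i + (q⁻¹ - 1) * ∑ i, spec q s α i := by
  have hq := h.q_ne_zero
  have hs := h.s_ne_zero
  obtain ⟨h1, h2⟩ := sum_S₂_identities Finset.univ (spec q s α) q (s ^ 2)⁻¹ (s ^ 2 * q⁻¹) hq
    h.q_ne_one (inv_ne_one.2 h.t_ne_one)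
    (fun h' => h.t_ne_q (by rwa [← div_eq_mul_inv, div_eq_one_iff_eq hq] at h'))
    (fun i _ => h.spec_ne_zero α i) (fun i _ j _ hij => h.spec_injective α hij)
    (fun i _ j _ hij => by
      obtain ⟨rfl, h'⟩ := h.eq_of_spec_eq (α := α) (β := α) 1 (by rw [zpow_one]; exact hij)
      omega) (by field_simp)
  simp only [normFactor_sub_single h]
  rw [Finset.sum_sub_distrib, sub_eq_zero] at h1
  refine ⟨h1, ?_⟩
  simp only [mul_sub, Finset.sum_sub_distrib] at h2
  have h3 : ∑ i, spec q s α i * (q * normFactor q s α i) =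
      q * ∑ i, spec q s α i * normFactor q s α i := by
    rw [Finset.mul_sum]; exact Finset.sum_congr rfl fun i _ => by ring
  have h4 : ∑ i, q⁻¹ * spec q s α i * ∏ l ∈ Finset.univ.erase i,
      pieriFactor q s (q * spec q s α l / spec q s α i) =
      q⁻¹ * ∑ i, spec q s α i * ∏ l ∈ Finset.univ.erase i,
        pieriFactor q s (q * spec q s α l / spec q s α i) := by
    rw [Finset.mul_sum]; exact Finset.sum_congr rfl fun i _ => by ring
  change ∑ i, spec q s α i * (q * normFactor q s α i) - ∑ i, spec q s α i *
    ∏ l ∈ Finset.univ.erase i, pieriFactor q s (q * spec q s α l / spec q s α i) = _ at h2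
  rw [h4]
  rw [h3] at h2
  field_simp
  linear_combination -h2

theorem pieriFactor_t (h : IsGeneric q s) : pieriFactor q s (s ^ 2) = 0 := by
  have hs := h.s_ne_zero
  rw [pieriFactor, S₂, inv_mul_cancel₀ (pow_ne_zero 2 hs), sub_self, mul_zero, zero_div]

theorem pieriFactor_q_div_t (h : IsGeneric q s) : pieriFactor q s (q / s ^ 2) = 0 := by
  rw [pieriFactor_reflect h (pow_ne_zero 2 h.s_ne_zero), pieriFactor_t h]

theorem normFactor_eq_zero {α : Fin N → ℤ} {i l : Fin N} (hli : l ≠ i)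
    (h0 : pieriFactor q s (spec q s α l / spec q s α i) = 0) : normFactor q s α i = 0 :=
  Finset.prod_eq_zero (Finset.mem_erase.2 ⟨hli, Finset.mem_univ l⟩) h0

/-- The box in row `i` cannot be added because row `i - 1` has the same length. -/
theorem normFactor_eq_zero_of_not_antitone_add (h : IsGeneric q s) {α : Fin N → ℤ} {i : Fin N}
    (hα : Antitone α) (hi : ¬ Antitone (α + Pi.single i 1)) : normFactor q s α i = 0 := by
  simp only [Antitone, not_forall, not_le, Pi.add_apply] at hi
  obtain ⟨j, k, hjk, hlt⟩ := hi
  have h1 := hα hjk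
  have hki : k = i := by
    by_contra hne
    rw [Pi.single_eq_of_ne hne, Pi.single_apply] at hlt
    split_ifs at hlt <;> omega
  subst hki
  have hji : j ≠ k := by rintro rfl; exact lt_irrefl _ hlt
  rw [Pi.single_eq_same, Pi.single_eq_of_ne hji] at hlt
  have hjk' : (j : ℕ) < k := Fin.lt_def.1 (lt_of_le_of_ne hjk hji)
  set l : Fin N := ⟨(k : ℕ) - 1, by omega⟩ with hl
  have hlk : l ≤ k := Fin.le_def.2 (by simp only [hl]; omega)
  have hjl : j ≤ l := Fin.le_def.2 (by simp only [hl]; omega)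
  have h2 := hα hlk
  have h3 := hα hjl
  refine normFactor_eq_zero (l := l) (fun he => ?_) ?_
  · have := congrArg Fin.val he
    simp only [hl] at this
    omega
  · have e1 : α l - α k = 0 := by omega
    have e2 : ((k : ℕ) : ℤ) - (l : ℕ) = 1 := by simp only [hl]; omega
    rw [h.spec_div, e1, e2, zpow_zero, one_mul, zpow_one, pieriFactor_t h]

/-- The box in row `i` cannot be removed because row `i + 1` has the same length. -/
theorem normFactor_eq_zero_of_not_antitone (h : IsGeneric q s) {α : Fin N → ℤ} {i : Fin N}
    (hα : ¬ Antitone α) (hi : Antitone (α + Pi.single i 1)) : normFactor q s α i = 0 := by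
  simp only [Antitone, not_forall, not_le] at hα
  obtain ⟨j, k, hjk, hlt⟩ := hα
  have h1 := hi hjk
  rw [Pi.add_apply, Pi.add_apply] at h1
  have hji : j = i := by
    by_contra hne
    rw [Pi.single_eq_of_ne hne, Pi.single_apply] at h1
    split_ifs at h1 <;> omega
  subst hji
  have hkj : k ≠ j := by rintro rfl; exact lt_irrefl _ hlt
  rw [Pi.single_eq_same, Pi.single_eq_of_ne hkj] at h1
  have hjk' : (j : ℕ) < k := Fin.lt_def.1 (lt_of_le_of_ne hjk (Ne.symm hkj))
  set l : Fin N := ⟨(j : ℕ) + 1, by omega⟩ with hl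
  have hlj : l ≠ j := fun he => by
    have := congrArg Fin.val he
    simp only [hl] at this
    omega
  have hjl : j ≤ l := Fin.le_def.2 (by simp only [hl]; omega)
  have hlk : l ≤ k := Fin.le_def.2 (by simp only [hl]; omega)
  have h2 := hi hjl
  have h3 := hi hlk
  rw [Pi.add_apply, Pi.add_apply, Pi.single_eq_same, Pi.single_eq_of_ne hlj] at h2
  rw [Pi.add_apply, Pi.add_apply, Pi.single_eq_of_ne hkj, Pi.single_eq_of_ne hlj] at h3
  refine normFactor_eq_zero hlj ?_
  have e1 : α l - α j = 1 := by omega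
  have e2 : ((j : ℕ) : ℤ) - (l : ℕ) = -1 := by simp only [hl]; omega
  rw [h.spec_div, e1, e2, zpow_one, zpow_neg_one, ← div_eq_mul_inv, pieriFactor_q_div_t h]

/-- A function on the edges `α → α + ε_i` of the graph of dominant weights that is supported on the
first and the last row is determined to be zero by two linear relations at each vertex. The
relations at a vertex `α` with `α_1 - α_N = m` express the values on the edges towards the vertices
with `α_1 - α_N = m + 1` through those on the edges towards `m - 1`. -/
theorem edge_function_eq_zero (h : IsGeneric q s) (hN : 0 < N)
    {Z : (Fin (N + 1) → ℤ) → Fin (N + 1) → F}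
    (hz : ∀ α i, ¬ (Antitone α ∧ Antitone (α + Pi.single i 1)) →
      (Antitone α ∨ Antitone (α + Pi.single i 1)) → Z α i = 0)
    (hmid : ∀ α i, i ≠ 0 → i ≠ Fin.last N → Antitone α → Antitone (α + Pi.single i 1) → Z α i = 0)
    (e0 : ∀ α, Antitone α → ∑ i, Z α i = ∑ i, Z (α - Pi.single i 1) i)
    (e1 : ∀ α, Antitone α → ∑ i, spec q s α i * Z α i =
      ∑ i, q⁻¹ * spec q s α i * Z (α - Pi.single i 1) i)
    {α : Fin (N + 1) → ℤ} (hα : Antitone α) : Z α (Fin.last N) = 0 := by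
  have hne : (0 : Fin (N + 1)) ≠ Fin.last N := fun he => by
    have := congrArg Fin.val he
    simp at this
    omega
  have hsum : ∀ f : Fin (N + 1) → F, (∀ i, i ≠ 0 → i ≠ Fin.last N → f i = 0) →
      ∑ i, f i = f 0 + f (Fin.last N) := fun f hf =>
    Finset.sum_eq_add_of_mem _ _ (Finset.mem_univ _) (Finset.mem_univ _) hne
      fun i _ hi => hf i hi.1 hi.2
  have hZ : ∀ α, Antitone α → ∀ i, i ≠ 0 → i ≠ Fin.last N → Z α i = 0 := fun α hα i h0 hl => by
    by_cases hi : Antitone (α + Pi.single i 1)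
    · exact hmid α i h0 hl hα hi
    · exact hz α i (fun h => hi h.2) (Or.inl hα)
  have hZ' : ∀ α, Antitone α → ∀ i, i ≠ 0 → i ≠ Fin.last N → Z (α - Pi.single i 1) i = 0 :=
    fun α hα i h0 hl => by
    by_cases hi : Antitone (α - Pi.single i 1)
    · exact hmid _ i h0 hl hi (by rwa [sub_add_cancel])
    · exact hz _ i (fun h => hi h.1) (Or.inr (by rwa [sub_add_cancel]))
  -- The edges at `α` that lead away from the constant weights: adding a box to the first row, and
  -- removing one from the last row.
  have key : ∀ m : ℕ, ∀ α : Fin (N + 1) → ℤ, Antitone α → α 0 - α (Fin.last N) < m →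
      Z α 0 = 0 ∧ Z (α - Pi.single (Fin.last N) 1) (Fin.last N) = 0 := by
    intro m
    induction m with
    | zero =>
      intro α hα hlt
      have := hα (Fin.zero_le (Fin.last N))
      push_cast at hlt
      omega
    | succ m ih =>
      intro α hα hlt
      push_cast at hlt
      have hA : Z α (Fin.last N) = 0 := by
        by_cases hl : Antitone (α + Pi.single (Fin.last N) 1)
        · have := (ih _ hl (by
            rw [Pi.add_apply, Pi.add_apply, Pi.single_eq_same, Pi.single_eq_of_ne hne]
            omega)).2
          rwa [add_sub_cancel_right] at this
        · exact hz α _ (fun h => hl h.2) (Or.inl hα)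
      have hB : Z (α - Pi.single 0 1) 0 = 0 := by
        by_cases hl : Antitone (α - Pi.single 0 1)
        · exact (ih _ hl (by
            rw [Pi.sub_apply, Pi.sub_apply, Pi.single_eq_same, Pi.single_eq_of_ne hne.symm]
            omega)).1
        · exact hz _ _ (fun h => hl h.1) (Or.inr (by rwa [sub_add_cancel]))
      have h0 := e0 α hα
      have h1 := e1 α hα
      rw [hsum _ (hZ α hα), hsum _ (hZ' α hα), hA, hB, add_zero, zero_add] at h0
      rw [hsum _ fun i hi hi' => by rw [hZ α hα i hi hi', mul_zero],
        hsum _ fun i hi hi' => by rw [hZ' α hα i hi hi', mul_zero], hA, hB, mul_zero, mul_zero,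
        add_zero, zero_add, h0, ← sub_eq_zero, ← sub_mul, mul_eq_zero] at h1
      -- The determinant of the two relations in the two remaining unknowns.
      have h2 : spec q s α 0 - q⁻¹ * spec q s α (Fin.last N) ≠ 0 := fun h3 =>
        hne (h.eq_of_spec_eq (α := α) (β := α) (-1) (by
          rw [zpow_neg_one]; exact sub_eq_zero.1 h3)).1
      have h3 := h1.resolve_left h2
      exact ⟨h0.trans h3, h3⟩
  by_cases hl : Antitone (α + Pi.single (Fin.last N) 1)
  · have := key _ _ hl (lt_of_lt_of_le (lt_add_one _) (Int.self_le_toNat _)) |>.2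
    rwa [add_sub_cancel_right] at this
  · exact hz α _ (fun h => hl h.2) (Or.inl hα)

theorem pieri_zero (α : Fin (N + 1) → ℤ) : pieri q s α 0 = 1 := by
  have : Finset.Iio (0 : Fin (N + 1)) = ∅ := by
    ext j; simp
  rw [pieri, this, Finset.prod_empty]

namespace IsMacdonaldBasis

/-- All Pieri coefficients but the last are given by stability, and their duals are those for all
boxes but the first. The remaining coefficient follows from the two norm relations. -/
theorem pieriCoeff_succ [CharZero F] {P : (Fin N → ℤ) → Laurent F N}
    {P' : (Fin (N + 1) → ℤ) → Laurent F (N + 1)} (hP' : IsMacdonaldBasis q s P')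
    (h : IsGeneric q s) (hP : IsMacdonaldBasis q s P) (hPi : HasPieri q s P) (hN : 0 < N)
    {α : Fin (N + 1) → ℤ} (hα : Antitone α) (i : Fin (N + 1))
    (hi : Antitone (α + Pi.single i 1)) : hP'.pieriCoeff h α i = pieri q s α i := by
  have hst : ∀ (α : Fin (N + 1) → ℤ) (i : Fin (N + 1)), i ≠ Fin.last N → Antitone α →
      Antitone (α + Pi.single i 1) → hP'.pieriCoeff h α i = pieri q s α i :=
    fun α i hil hα hi => by
      obtain ⟨j, rfl⟩ := Fin.exists_castSucc_eq.2 hil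
      exact hP'.pieriCoeff_castSucc h hP hPi hα j hi
  have hst' : ∀ (α : Fin (N + 1) → ℤ) (i : Fin (N + 1)), i ≠ 0 → Antitone α →
      Antitone (α + Pi.single i 1) → hP'.pieriCoeff h (dualWt (α + Pi.single i 1)) i.rev =
        pieri q s (dualWt (α + Pi.single i 1)) i.rev := fun α i hi0 hα hi =>
    hst _ _ (fun he => hi0 (by rw [← Fin.rev_rev i, he, Fin.rev_last])) (dualWt_antitone hi)
      (by rw [dualWt_add_single]; exact dualWt_antitone hα)
  by_cases hil : i = Fin.last N
  swap
  · exact hst α i hil hα hi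
  subst hil
  have hne : Fin.last N ≠ 0 := fun he => by
    have := congrArg Fin.val he
    simp at this
    omega
  have key := edge_function_eq_zero h hN
    (Z := fun α i => hP'.normCoeff h α i - normFactor q s α i)
    (fun α i h1 h2 => by
      rw [hP'.normCoeff_eq_zero h h1, zero_sub, neg_eq_zero]
      rcases h2 with h2 | h2
      · exact normFactor_eq_zero_of_not_antitone_add h h2 fun h3 => h1 ⟨h2, h3⟩
      · exact normFactor_eq_zero_of_not_antitone h (fun h3 => h1 ⟨h3, h2⟩) h2)
    (fun α i h0 hl hα hi => by
      rw [normCoeff, hst α i hl hα hi, hst' α i h0 hα hi, pieri_mul_pieri_dualWt h, sub_self])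
    (fun α hα => by
      rw [Finset.sum_sub_distrib, Finset.sum_sub_distrib, hP'.sum_normCoeff h ⟨α, hα⟩,
        (normFactor_identities h α).1])
    (fun α hα => by
      have h1 := hP'.sum_spec_mul_normCoeff h ⟨α, hα⟩
      have h2 := (normFactor_identities h α).2
      simp only [mul_sub, Finset.sum_sub_distrib]
      linear_combination h2 - h1) hα
  rw [normCoeff, hst' α _ hne hα hi, ← pieri_mul_pieri_dualWt h, ← sub_mul, Fin.rev_last,
    pieri_zero, mul_one] at key
  exact sub_eq_zero.1 key

theorem hasPieri_succ [CharZero F] {P : (Fin N → ℤ) → Laurent F N}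
    {P' : (Fin (N + 1) → ℤ) → Laurent F (N + 1)} (hP' : IsMacdonaldBasis q s P')
    (h : IsGeneric q s) (hP : IsMacdonaldBasis q s P) (hPi : HasPieri q s P) (hN : 0 < N) :
    HasPieri q s P' := fun α hα => by
  rw [hP'.e₁_mul h]
  refine Finset.sum_congr rfl fun i _ => ?_
  by_cases hi : Antitone (α + Pi.single i 1)
  · rw [hP'.pieriCoeff_succ h hP hPi hN hα i hi]
  · rw [hP'.eq_zero h hi, smul_zero, smul_zero]

/-- In one variable `P_α = X ^ α`, and there is only the leading coefficient to compare. -/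
theorem hasPieri_one [CharZero F] {P : (Fin 1 → ℤ) → Laurent F 1}
    (hP : IsMacdonaldBasis q s P) (h : IsGeneric q s) : HasPieri q s P := fun α hα => by
  have hanti : ∀ β : Fin 1 → ℤ, Antitone β := fun β i j _ => by rw [Subsingleton.elim i j]
  have h1 := hP.e₁_mul h α
  rw [Fin.sum_univ_one] at h1 ⊢
  rw [pieri_zero, one_smul, h1]
  have h2 := congrArg (fun f : Laurent F 1 => f.coeff (α + Pi.single 0 1)) h1
  rw [e₁, Fin.sum_univ_one, varX] at h2
  simp only [AddMonoidAlgebra.coeff_smul_apply, hP.coeff_self _ (hanti _)] at h2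
  rw [add_comm α, AddMonoidAlgebra.coeff_single_mul_add, hP.coeff_self _ hα] at h2
  rw [add_comm α]
  simp only [smul_eq_mul, mul_one] at h2
  rw [← h2, one_smul]

end IsMacdonaldBasis

/-- Macdonald polynomials exist and satisfy the Pieri formula. -/
theorem exists_isMacdonaldBasis_hasPieri [CharZero F] (h : IsGeneric q s) (N : ℕ) :
    ∃ P : (Fin N → ℤ) → Laurent F N, IsMacdonaldBasis q s P ∧ HasPieri q s P := by
  induction N with
  | zero =>
    obtain ⟨P, hP⟩ := exists_isMacdonaldBasis (N := 0) (q := q) (s := s) fun lam =>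
      exists_jointEigen_const h (c := 0) fun i => i.elim0
    exact ⟨P, hP, fun α _ => by simp [e₁]⟩
  | succ N ih =>
    obtain ⟨P, hP, hPi⟩ := ih
    obtain ⟨P', hP'⟩ := exists_isMacdonaldBasis fun lam =>
      exists_jointEigen_succ h hP hPi (∑ i, (lam.1 i - lam.1 (Fin.last N)) + 1).toNat lam
        (lt_of_lt_of_le (lt_add_one _) (Int.self_le_toNat _))
    rcases Nat.eq_zero_or_pos N with rfl | hN
    · exact ⟨P', hP', hP'.hasPieri_one h⟩
    · exact ⟨P', hP', hP'.hasPieri_succ h hP hPi hN⟩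

end

/-! ### The Fock module -/

section
variable {F : Type*} [Field F] {N : ℕ} {q s : F}

theorem coeff_one_prod {ι : Type*} (A : Finset ι) (f : ι → PowerSeries F)
    (hf : ∀ i ∈ A, PowerSeries.constantCoeff (f i) = 1) :
    PowerSeries.coeff 1 (∏ i ∈ A, f i) = ∑ i ∈ A, PowerSeries.coeff 1 (f i) := by
  classical
  induction A using Finset.induction_on with
  | empty => simp [PowerSeries.coeff_one]
  | insert a t ha ih =>
    have h1 : PowerSeries.constantCoeff (∏ i ∈ t, f i) = 1 := by
      rw [map_prod]
      exact Finset.prod_eq_one fun i hi => hf i (Finset.mem_insert_of_mem hi)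
    rw [Finset.prod_insert ha, Finset.sum_insert ha, PowerSeries.coeff_one_mul, h1,
      hf a (Finset.mem_insert_self _ _), ih fun i hi => hf i (Finset.mem_insert_of_mem hi)]
    ring

theorem constantCoeff_lin (a : F) : PowerSeries.constantCoeff (lin a) = 1 := by
  simp [lin]

theorem coeff_one_lin (a : F) : PowerSeries.coeff 1 (lin a) = -a := by
  rw [lin, map_sub, PowerSeries.coeff_C_mul, PowerSeries.coeff_one_X, PowerSeries.coeff_one,
    if_neg one_ne_zero, mul_one, zero_sub]

theorem constantCoeff_lin_quotient (a b c d : F) :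
    PowerSeries.constantCoeff (lin a * lin b * (lin c * lin d)⁻¹) = 1 := by
  simp [constantCoeff_lin]

theorem coeff_one_lin_quotient (a b c d : F) :
    PowerSeries.coeff 1 (lin a * lin b * (lin c * lin d)⁻¹) = c + d - a - b := by
  have h0 : PowerSeries.constantCoeff (lin c * lin d) ≠ 0 := by simp [constantCoeff_lin]
  have h1 : lin a * lin b * (lin c * lin d)⁻¹ * (lin c * lin d) = lin a * lin b := by
    rw [mul_assoc, PowerSeries.inv_mul_cancel _ h0, mul_one]
  have h2 := congrArg (PowerSeries.coeff 1) h1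
  rw [PowerSeries.coeff_one_mul, constantCoeff_lin_quotient, PowerSeries.coeff_one_mul (lin a),
    PowerSeries.coeff_one_mul (lin c)] at h2
  simp only [map_mul, constantCoeff_lin, coeff_one_lin] at h2
  linear_combination h2

theorem coeff_one_prod_S₂plus (q₁ q₂ q₃ : F) (w : Fin N → F) :
    PowerSeries.coeff 1 (∏ i, S₂plus q₁ q₂ q₃ (w i)) = (1 + q₂⁻¹ - q₁ - q₃) * ∑ i, w i := by
  rw [coeff_one_prod Finset.univ (fun i => S₂plus q₁ q₂ q₃ (w i))
    fun i _ => constantCoeff_lin_quotient _ _ _ _, Finset.mul_sum]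
  refine Finset.sum_congr rfl fun i _ => ?_
  rw [S₂plus, coeff_one_lin_quotient]
  ring

theorem coeff_one_prod_S₂minus (q₁ q₂ q₃ : F) (w : Fin N → F) :
    PowerSeries.coeff 1 (∏ i, S₂minus q₁ q₂ q₃ (w i)) =
      (1 + q₂ - q₁⁻¹ - q₃⁻¹) * ∑ i, (w i)⁻¹ := by
  rw [coeff_one_prod Finset.univ (fun i => S₂minus q₁ q₂ q₃ (w i))
    fun i _ => constantCoeff_lin_quotient _ _ _ _, Finset.mul_sum]
  refine Finset.sum_congr rfl fun i _ => ?_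
  rw [S₂minus, coeff_one_lin_quotient]
  ring

theorem coord_eq (h : IsGeneric q s) (u : F) (lam : Weight N) (i : Fin N) :
    coord (s ^ 2)⁻¹ q u lam i = u * s⁻¹ ^ ((N : ℤ) - 1) * spec q s lam.1 i := by
  have hs := h.s_ne_zero
  have h1 : (s ^ 2)⁻¹ ^ (i : ℕ) = s⁻¹ ^ ((N : ℤ) - 1) * s ^ ((N : ℤ) - 1 - 2 * ((i : ℕ) : ℤ)) := by
    rw [inv_zpow', ← zpow_add₀ hs, ← zpow_natCast s 2, ← zpow_neg, ← zpow_natCast (s ^ _),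
      ← zpow_mul]
    congr 1
    push_cast
    ring
  rw [coord, spec, h1]
  ring

theorem coord_div_coord (h : IsGeneric q s) {u : F} (hu : u ≠ 0) (lam : Weight N) (x : F)
    (i l : Fin N) : coord (s ^ 2)⁻¹ q u lam l / (x * coord (s ^ 2)⁻¹ q u lam i) =
      x⁻¹ * spec q s lam.1 l / spec q s lam.1 i := by
  have h1 : u * s⁻¹ ^ ((N : ℤ) - 1) ≠ 0 :=
    mul_ne_zero hu (zpow_ne_zero _ (inv_ne_zero h.s_ne_zero))
  rw [coord_eq h, coord_eq h, mul_left_comm x, mul_div_mul_left _ _ h1, div_mul_eq_div_div_swap,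
    div_eq_mul_inv _ x, mul_comm _ x⁻¹, mul_div_assoc]

namespace IsMacdonaldBasis

variable {P : (Fin N → ℤ) → Laurent F N}

/-- The isomorphism `|λ⟩ ↦ P_λ`. -/
noncomputable def fockEquiv [CharZero F] (hP : IsMacdonaldBasis q s P) (h : IsGeneric q s) :
    Fock F N ≃ₗ[F] symLaurent F N := (hP.basis h).repr.symm

theorem fockEquiv_single [CharZero F] (hP : IsMacdonaldBasis q s P) (h : IsGeneric q s)
    (lam : Weight N) (c : F) :
    (hP.fockEquiv h (Finsupp.single lam c) : Laurent F N) = c • P lam.1 := by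
  rw [fockEquiv, Module.Basis.repr_symm_single, hP.basis_apply]
  rfl

theorem fockEquiv_ket [CharZero F] (hP : IsMacdonaldBasis q s P) (h : IsGeneric q s)
    (α : Fin N → ℤ) : (hP.fockEquiv h (ket F α) : Laurent F N) = P α := by
  rw [ket]
  split_ifs with hα
  · exact (hP.fockEquiv_single h ⟨α, hα⟩ 1).trans (one_smul F _)
  · rw [map_zero, hP.eq_zero h hα]
    rfl

theorem fockEquiv_Emode [CharZero F] (hP : IsMacdonaldBasis q s P) (h : IsGeneric q s)
    (hPi : HasPieri q s P) {u : F} (hu : u ≠ 0) (cE : F) (v : Fock F N) :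
    (hP.fockEquiv h (Emode (s ^ 2)⁻¹ q (s ^ 2 * q⁻¹) u cE 0 v) : Laurent F N) =
      cE • (e₁ F N * (hP.fockEquiv h v : Laurent F N)) := by
  induction v using Finsupp.induction_linear with
  | zero => simp
  | add v w hv hw =>
    rw [map_add, map_add, map_add, Submodule.coe_add, Submodule.coe_add, hv, hw, mul_add, smul_add]
  | single lam c =>
    rw [hP.fockEquiv_single h, mul_smul_comm, smul_comm cE, Emode,
      Finsupp.linearCombination_single, map_smul, map_smul, map_sum, Submodule.coe_smul,
      Submodule.coe_smul, AddSubmonoidClass.coe_finsetSum, hPi _ lam.2]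
    congr 2
    refine Finset.sum_congr rfl fun i _ => ?_
    rw [map_smul, Submodule.coe_smul, hP.fockEquiv_ket h, zpow_zero, one_mul]
    congr 1
    refine Finset.prod_congr rfl fun l _ => ?_
    rw [← one_mul (coord _ _ _ _ i), coord_div_coord h hu, inv_one, one_mul]
    rfl

theorem fockEquiv_Fmode [CharZero F] (hP : IsMacdonaldBasis q s P) (h : IsGeneric q s)
    (hPi : HasPieri q s P) {u : F} (hu : u ≠ 0) (cF : F) (v : Fock F N) :
    (hP.fockEquiv h (Fmode (s ^ 2)⁻¹ q (s ^ 2 * q⁻¹) u cF 0 v) : Laurent F N) =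
      cF • (e₁inv F N * (hP.fockEquiv h v : Laurent F N)) := by
  induction v using Finsupp.induction_linear with
  | zero => simp
  | add v w hv hw =>
    rw [map_add, map_add, map_add, Submodule.coe_add, Submodule.coe_add, hv, hw, mul_add, smul_add]
  | single lam c =>
    have h1 := congrArg (invVars F N) (hPi _ (dualWt_antitone lam.2))
    rw [map_mul, invVars_e₁, hP.invVars_apply h, dualWt_dualWt, map_sum] at h1
    rw [hP.fockEquiv_single h, mul_smul_comm, smul_comm cF, Fmode,
      Finsupp.linearCombination_single, map_smul, map_smul, map_sum, Submodule.coe_smul,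
      Submodule.coe_smul, AddSubmonoidClass.coe_finsetSum, h1,
      ← Equiv.sum_comp Fin.revPerm (fun i => invVars F N _)]
    congr 2
    refine Finset.sum_congr rfl fun i _ => ?_
    rw [map_smul, Submodule.coe_smul, hP.fockEquiv_ket h, zpow_zero, one_mul, map_smul,
      hP.invVars_apply h, Fin.revPerm_apply, pieri_dualWt h, dualWt_dualWt_add_single]
    congr 1
    refine Finset.prod_congr rfl fun l _ => ?_
    rw [coord_div_coord h hu, inv_inv]
    rfl

/-- Operators that are diagonal in the basis `|λ⟩` correspond to operators with eigenvectors `P_λ`.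
-/
theorem fockEquiv_diagonal [CharZero F] (hP : IsMacdonaldBasis q s P) (h : IsGeneric q s)
    (c : Weight N → F) (d : F) (T : Laurent F N →ₗ[F] RatFrac F N)
    (hT : ∀ lam : Weight N, d • T (P lam.1) = toRat F N (c lam • P lam.1)) (v : Fock F N) :
    toRat F N (hP.fockEquiv h
      (Finsupp.linearCombination F (fun lam => Finsupp.single lam (c lam)) v)) =
      d • T (hP.fockEquiv h v) := by
  induction v using Finsupp.induction_linear with
  | zero => simp
  | add v w hv hw =>
    rw [map_add, map_add, map_add, Submodule.coe_add, Submodule.coe_add, map_add, map_add, hv, hw,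
      smul_add]
  | single lam x =>
    have h1 : toRat F N (x • (c lam • P lam.1)) = x • toRat F N (c lam • P lam.1) := by
      rw [toRat_smul]; exact (Algebra.smul_def _ _).symm
    rw [Finsupp.linearCombination_single, map_smul, Submodule.coe_smul, hP.fockEquiv_single h,
      hP.fockEquiv_single h, h1, ← hT, map_smul, smul_comm d]

theorem fockEquiv_Kplus [CharZero F] (hP : IsMacdonaldBasis q s P) (h : IsGeneric q s)
    (u : F) (v : Fock F N) :
    toRat F N (hP.fockEquiv h (Kplus (s ^ 2)⁻¹ q (s ^ 2 * q⁻¹) u 1 v)) =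
      (u * (1 - (s ^ 2)⁻¹) * (1 - s ^ 2 * q⁻¹) * s⁻¹ ^ ((N : ℤ) - 1)) •
        macdonaldD N q s 1 (hP.fockEquiv h v) := by
  refine hP.fockEquiv_diagonal h _ _ _ (fun lam => ?_) v
  rw [(hP.eigen lam.1).2, Algebra.smul_def _ (toRat F N _), ← toRat_smul, smul_smul,
    coeff_one_prod_S₂plus, eig_one]
  simp only [coord_eq h, ← Finset.mul_sum]
  congr 2
  have hq := h.q_ne_zero
  have hs := h.s_ne_zero
  generalize s⁻¹ ^ ((N : ℤ) - 1) = c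
  field_simp
  ring

theorem fockEquiv_Kminus [CharZero F] (hP : IsMacdonaldBasis q s P) (h : IsGeneric q s)
    (u : F) (v : Fock F N) :
    toRat F N (hP.fockEquiv h (Kminus (s ^ 2)⁻¹ q (s ^ 2 * q⁻¹) u 1 v)) =
      (u⁻¹ * (1 - (s ^ 2)⁻¹⁻¹) * (1 - (s ^ 2 * q⁻¹)⁻¹) * s⁻¹ ^ (-((N : ℤ) - 1))) •
        macdonaldD N q⁻¹ s⁻¹ 1 (hP.fockEquiv h v) := by
  refine hP.fockEquiv_diagonal h _ _ _ (fun lam => ?_) v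
  rw [((hP.eigen lam.1).inv h).2, Algebra.smul_def _ (toRat F N _), ← toRat_smul, smul_smul,
    coeff_one_prod_S₂minus, eig_one]
  simp only [coord_eq h, spec_inv, mul_inv, ← Finset.mul_sum, ← zpow_neg]
  congr 2
  have hq := h.q_ne_zero
  have hs := h.s_ne_zero
  generalize s⁻¹ ^ (-((N : ℤ) - 1)) = c
  generalize u⁻¹ = u'
  field_simp
  ring

end IsMacdonaldBasis

theorem exists_unique_isMacdonald [CharZero F] {P : (Fin N → ℤ) → Laurent F N}
    (hP : IsMacdonaldBasis q s P) (h : IsGeneric q s) (lam : Weight N) :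
    ∃! P : Laurent F N, IsMacdonald q s lam P := by
  refine ⟨P lam.1, (isMacdonald_iff h lam _).2 ⟨hP.eigen _, hP.coeff_self _ lam.2⟩,
    fun P' hP' => ?_⟩
  obtain ⟨h1, h2⟩ := (isMacdonald_iff h lam P').1 hP'
  rw [hP.eq_smul h h1, h2, one_smul]

end
theorem mainTheorem1 {F : Type*} [Field F] [CharZero F] (N : ℕ)
    (q t s q₁ q₂ q₃ u cE cF : F)
    (hq : q ≠ 0) (ht : t ≠ 0) (hu : u ≠ 0)
    (hgen : ∀ a b : ℤ, q ^ a * t ^ b = 1 → a = 0 ∧ b = 0)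
    (hs : s ^ 2 = t)
    (hq₁ : q₁ = t⁻¹) (hq₂ : q₂ = q) (hq₁₂₃ : q₁ * q₂ * q₃ = 1) :
    (∀ lam : Weight N,
      ∃! P : Laurent F N, IsMacdonald q s lam P) ∧
    ∃ Φ : Fock F N ≃ₗ[F] symLaurent F N,
      (∀ lam : Weight N,
        IsMacdonald q s lam (Φ (Finsupp.single lam 1) : Laurent F N)) ∧
      (∀ v, (Φ (Emode q₁ q₂ q₃ u cE 0 v) : Laurent F N) =
        cE • (e₁ F N * (Φ v : Laurent F N))) ∧
      (∀ v, (Φ (Fmode q₁ q₂ q₃ u cF 0 v) : Laurent F N) =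
        cF • (e₁inv F N * (Φ v : Laurent F N))) ∧
      (∀ v, algebraMap (Laurent F N) (RatFrac F N)
          (Φ (Kplus q₁ q₂ q₃ u 1 v)) =
        (u * (1 - q₁) * (1 - q₃) * s⁻¹ ^ ((N : ℤ) - 1)) •
          macdonaldD N q s 1 (Φ v)) ∧
      (∀ v, algebraMap (Laurent F N) (RatFrac F N)
          (Φ (Kminus q₁ q₂ q₃ u 1 v)) =
        (u⁻¹ * (1 - q₁⁻¹) * (1 - q₃⁻¹) * s⁻¹ ^ (-((N : ℤ) - 1))) •
          macdonaldD N q⁻¹ s⁻¹ 1 (Φ v)) := by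
  have hs0 : s ≠ 0 := by
    rintro rfl
    exact ht (by rw [← hs, zero_pow two_ne_zero])
  subst hs
  have h : IsGeneric q s := ⟨hq, hs0, fun a b => hgen a b⟩
  have h3 : q₃ = s ^ 2 * q⁻¹ := by
    rw [hq₁, hq₂] at hq₁₂₃
    field_simp at hq₁₂₃ ⊢
    linear_combination hq₁₂₃
  subst hq₁ hq₂ h3
  obtain ⟨P, hP, hPi⟩ := exists_isMacdonaldBasis_hasPieri h N
  refine ⟨exists_unique_isMacdonald hP h, hP.fockEquiv h, fun lam => ?_,
    hP.fockEquiv_Emode h hPi hu cE, hP.fockEquiv_Fmode h hPi hu cF, hP.fockEquiv_Kplus h u,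
    hP.fockEquiv_Kminus h u⟩
  rw [hP.fockEquiv_single h, one_smul]
  exact (isMacdonald_iff h lam _).2 ⟨hP.eigen _, hP.coeff_self _ lam.2⟩
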